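/- Let $(M,\sigma,\mu)$ be a $\sigma$-finite measure space, $L^\infty=L^\infty(M)$ (complex valued), $f^*$ the complex conjugate of $f$, and let $(T_t)_{t\ge0}$, $T_t=e^{-tL}$, be a semigroup of positive, weak*-continuous linear contractions on $L^\infty$ with $T_tf\to f$ weak* as $t\to0+$ for every $f\in L^\infty$. For a semigroup $(S_t)$ on $L^\infty$, its negative generator is $Af=\lim_{y\to0+}(f-S_yf)/y$ (weak* limit, defined on the domain $D(A)$ of those $f$ for which the limit exists); its gradient form is $2\Gamma_A(f,g)=-A(f^*g)+A(f^*)g+f^*A(g)$, defined when $f^*,g,f^*g\in D(A)$, and $\Gamma_A(f)=\Gamma_A(f,f)$. One says that $(S_t)$ satisfies the $\Gamma^2\ge0$ criterion if $$S_t|S_uf|^2-|S_tS_uf|^2\le S_u\big(S_t|f|^2-|S_tf|^2\big)\qquad\text{for all } t,u>0,\ f\in L^\infty. \tag{1}$$ For $0<\alpha<1$ let $\phi_{t,\alpha}$ be the function on $(0,\infty)$ with Laplace transform $e^{-tz^\alpha}$, let $T_{t,\alpha}f=e^{-tL^\alpha}f=\int_0^\infty T_uf\,\phi_{t,\alpha}(u)\,du$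 (weak* integral, $t>0$; $T_{0,\alpha}=\mathrm{id}$) be the subordinated semigroup, and let $L^\alpha$ denote its negative generator. Assume that $(T_t)$ satisfies (1), and let $0<\alpha<1$. Then $(T_{t,\alpha})$ satisfies (1). Moreover $t\mapsto T_{t,\alpha}f$ is norm-smooth on $(0,\infty)$ and $\Gamma_{L^\alpha}(T_{t,\alpha}f)$ is defined for all $t>0$, $f\in L^\infty$, and $$T_{s,\alpha}\Gamma_{L^\alpha}(T_{v+t,\alpha}f)\le T_{v+s,\alpha}\Gamma_{L^\alpha}(T_{t,\alpha}f)\qquad\text{for all } s,v,t>0,\ f\in L^\infty .$$ Finally, for every $f\in L^\infty$ for which $\Gamma_{L^\alpha}(f)$ is defined, every $j\in\{0,1,2,\dots\}$ and every $s>0$, $\Gamma_{L^\alpha}(s^j\partial_s^jT_{s,\alpha}f)$ is defined and $$\Gamma_{L^\alpha}\big(s^j\partial_s^jT_{s,\alpha}f\big)\le\Big(\frac{10\,j}{1-\alpha}\Big)^{2j}\,T_{s,\alpha}\Gamma_{L^\alpha}(f)$$ (with $0^0=1$ for $j=0$). -/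

import Mathlib

open MeasureTheory Filter Topology Set
open scoped ENNReal ComplexOrder ContDiff ComplexConjugate

noncomputable section

namespace SubordGamma

variable {M : Type*} [MeasurableSpace M]

/-- Complex-valued essentially bounded functions on `M`, modulo a.e. equality. Its order `f ≤ g`
(through `ComplexOrder`) says that `g - f` is a.e. real and nonnegative; `star` is the pointwise
complex conjugation. -/
abbrev Linf (μ : Measure M) : Type _ := Lp ℂ ∞ μ

/-- The pointwise product of two elements of `L^∞`. -/
def mul {μ : Measure M} (f g : Linf μ) : Linf μ :=
  ((Lp.memLp g).mul (r := ∞) (Lp.memLp f)).toLp (fun x => f x * g x)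

/-- `|f|² = f^* f`. -/
def absSq {μ : Measure M} (f : Linf μ) : Linf μ := mul (star f) f

/-- The duality bracket `⟨f, g⟩ = ∫ f g^*` between `L^∞` and `L^1`. -/
def pairing {μ : Measure M} (f : Linf μ) (g : Lp ℂ 1 μ) : ℂ := ∫ x, f x * conj (g x) ∂μ

/-- The weak* topology of `L^∞` as the dual of `L^1`. -/
@[reducible] def weakStar (μ : Measure M) : TopologicalSpace (Linf μ) :=
  TopologicalSpace.induced (fun f (g : Lp ℂ 1 μ) => pairing f g) inferInstance

/-- Weak* convergence of `F` to `h` along the filter `l`. -/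
def TendstoWeakStar {ι : Type*} {μ : Measure M} (F : ι → Linf μ) (l : Filter ι) (h : Linf μ) :
    Prop :=
  ∀ g : Lp ℂ 1 μ, Tendsto (fun i => pairing (F i) g) l (𝓝 (pairing h g))

/-- `(T t)_{t ≥ 0}` is a semigroup of positive, weak*-continuous contractions on `L^∞` which is
weak* continuous at `t = 0+`. Values of `T` at negative times are irrelevant. -/
structure IsPositiveSemigroup {μ : Measure M} (T : ℝ → Linf μ →ₗ[ℂ] Linf μ) : Prop where
  positive : ∀ t : ℝ, 0 ≤ t → ∀ f : Linf μ, 0 ≤ f → 0 ≤ T t f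
  contraction : ∀ t : ℝ, 0 ≤ t → ∀ f : Linf μ, ‖T t f‖ ≤ ‖f‖
  weakStar_continuous : ∀ t : ℝ, 0 ≤ t → @Continuous _ _ (weakStar μ) (weakStar μ) (T t)
  map_zero : ∀ f : Linf μ, T 0 f = f
  map_add : ∀ s t : ℝ, 0 ≤ s → 0 ≤ t → ∀ f : Linf μ, T (s + t) f = T s (T t f)
  tendsto_zero : ∀ f : Linf μ, TendstoWeakStar (fun t : ℝ => T t f) (𝓝[>] 0) f

/-- The `Γ² ≥ 0` criterion for a family `(S t)_{t ≥ 0}` of maps on `L^∞`: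
`S_t |S_u f|² - |S_t S_u f|² ≤ S_u (S_t |f|² - |S_t f|²)`. -/
def GammaTwo {μ : Measure M} (S : ℝ → Linf μ → Linf μ) : Prop :=
  ∀ t u : ℝ, 0 < t → 0 < u → ∀ f : Linf μ,
    S t (absSq (S u f)) - absSq (S t (S u f)) ≤ S u (S t (absSq f) - absSq (S t f))

/-- The density `φ_{s,α}` on `(0,∞)` whose Laplace transform is `t ↦ exp (-s t^α)`, as the
inverse Laplace transform
`φ_{s,α}(u) = (1 / 2πi) ∫_{σ - i∞}^{σ + i∞} e^{z u} e^{-s z^α} dz` with `σ = 1`, `z = 1 + i y`,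
the power being the principal one. (The integral is real.) -/
def phi (s α u : ℝ) : ℝ :=
  (1 / (2 * Real.pi)) *
    (∫ y : ℝ, Complex.exp ((1 + y * Complex.I) * u) *
      Complex.exp (-s * (1 + y * Complex.I) ^ (α : ℂ))).re

/-- `h` is the weak* integral `∫_0^∞ w(u) F(u) du` in `L^∞`. -/
def IsWeakStarIntegral {μ : Measure M} (w : ℝ → ℝ) (F : ℝ → Linf μ) (h : Linf μ) : Prop :=
  ∀ g : Lp ℂ 1 μ, IntegrableOn (fun u : ℝ => (w u : ℂ) * pairing (F u) g) (Ioi 0) ∧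
    pairing h g = ∫ u in Ioi (0 : ℝ), (w u : ℂ) * pairing (F u) g

open Classical in
/-- The subordinated family `T_{t,α} f = ∫_0^∞ T_u f φ_{t,α}(u) du` (weak* integral), `t > 0`,
and `T_{0,α} = id`. -/
def subord {μ : Measure M} (T : ℝ → Linf μ →ₗ[ℂ] Linf μ) (α t : ℝ) (f : Linf μ) : Linf μ :=
  if t = 0 then f
  else if h : ∃ k, IsWeakStarIntegral (phi t α) (fun u => T u f) k then h.choose
  else 0

/-- `f` lies in the domain of the negative generator `A` of `S`, and `A f = h`:
`h = lim_{y → 0+} (f - S_y f) / y` in the weak* topology. -/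
def IsNegGen {μ : Measure M} (S : ℝ → Linf μ → Linf μ) (f h : Linf μ) : Prop :=
  TendstoWeakStar (fun y : ℝ => y⁻¹ • (f - S y f)) (𝓝[>] 0) h

/-- The domain of the negative generator of `S`. -/
def InDomain {μ : Measure M} (S : ℝ → Linf μ → Linf μ) (f : Linf μ) : Prop :=
  ∃ h, IsNegGen S f h

open Classical in
/-- The negative generator of `S` (with value `0` off its domain). -/
def negGen {μ : Measure M} (S : ℝ → Linf μ → Linf μ) (f : Linf μ) : Linf μ :=
  if h : InDomain S f then h.choose else 0

/-- The gradient form `Γ_A(f, g)` of the negative generator `A` of `S` is defined: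
`f^*`, `g` and `f^* g` lie in the domain of `A`. -/
def GammaDefined {μ : Measure M} (S : ℝ → Linf μ → Linf μ) (f g : Linf μ) : Prop :=
  InDomain S (star f) ∧ InDomain S g ∧ InDomain S (mul (star f) g)

/-- The gradient form of the negative generator `A` of `S`:
`2 Γ_A(f, g) = -A(f^* g) + A(f^*) g + f^* A(g)`. -/
def gammaForm {μ : Measure M} (S : ℝ → Linf μ → Linf μ) (f g : Linf μ) : Linf μ :=
  (1 / 2 : ℝ) •
    (-negGen S (mul (star f) g) + mul (negGen S (star f)) g + mul (star f) (negGen S g))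

end SubordGamma

end

/-!
Write `S_s = T_{s,α}`, `p = 1 / (1 - α)` and, for a positive contraction `P` of `L^∞`,
`carre P f = P |f|² - |P f|²`. This is nonnegative by the Kadison–Schwarz inequality, and the
criterion `Γ² ≥ 0` for a semigroup `(S_t)` reads `carre S_t (S_u f) ≤ S_u (carre S_t f)`.

**Jensen's inequality for `carre`.** The map `carre P` is a nonnegative quadratic form. Suppose
`carre P (T_u f) ≤ T_u (carre P f)` for all `u > 0`. Integrating
`0 ≤ carre P (T_u f - c(u) F)`, where `F = ∫ ψ(u) T_u f du` and `c = ψ / φ`, against `φ > 0` gives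
`carre P F ≤ ∫ φ(u) T_u (carre P f) du` as soon as `∫ ψ² / φ ≤ 1` (`carre_avg_le`). With
`ψ = φ = φ_{y,α}` and `P = T_v`, and after a rearrangement of the four terms, this shows
`carre S_y (T_v f) ≤ T_v (carre S_y f)`; a second application, with `P = S_y`, gives the
criterion for `(S_t)`, and also the bound `carre S_y (∂_s S_s f) ≤ (p / s)² S_s (carre S_y f)`,
provided the Fisher information `∫ (s ∂_s φ_{s,α})² / φ_{s,α}` is at most `p²`.

**The stable density.** All that is needed about `φ_{s,α}` follows from Zolotarev's formula
`φ_{s,α}(u) = α p / (π u) ∫_0^π x A(θ) e^{- x A(θ)} dθ` with `x = s^p u^{-α p}` (`phi_eq`), proved by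
moving the contour of the inverse Laplace transform to a curve on which the exponent is real. It
exhibits `φ_{s,α}` as positive, of mass one, and as an average over `θ` of dilates of `t e^{-t}`. A
change of `s` dilates the profile by a factor `κ = (s'/s)^p`, so that `s ∂_s φ_{s,α}` has the same
form with the profile `(1 - t) t e^{-t}` times `p`, and the Cauchy–Schwarz inequality in `θ` bounds
the Fisher information by that of the exponential law (`fisher_bound`). The convolution identity
`φ_{s,α} * φ_{t,α} = φ_{s+t,α}` comes from Fourier inversion of the exponentially tilted densities.

**Higher derivatives.** Since `S_s = S_{s-a} S_a`, the `j`-th time derivative of `S_s` at `s = j a` is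
the `j`-th power of the first derivative of `S_a` at time `a`. Iterating the first order bound gives
`carre S_y (s^j ∂_s^j S_s f) ≤ (j p)^{2j} S_s (carre S_y f)`. Dividing by `2 y` and letting `y → 0`
turns estimates for `carre S_y` into estimates for the gradient form (`gammaForm_le`): on the domain
of the form, `carre S_y f / (2 y)` converges to it weak*.

**Domains.** The orbits are norm differentiable, so only `|S_c f|²` needs an argument. By the
criterion, `y ↦ carre S_y (S_{c-y} f)` is superadditive and nonnegative, and hence its quotient by `y`
converges weak* as `y → 0` (`exists_tendsto_carre`); it differs from `S_y |S_c f|² - |S_c f|²` by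
`S_y (|S_c f|² - |S_{c-y} f|²)`, whose quotient by `y` converges by norm differentiability.
-/

noncomputable section

namespace SubordGamma

/-! ### The Bromwich integral in logarithmic coordinates -/

/-- The integrand `e^{zu} e^{-s z^α}` of the inverse Laplace transform at `z = 1 + i y`. -/
def bromwich (s α u y : ℝ) : ℂ :=
  Complex.exp ((1 + y * Complex.I) * u) * Complex.exp (-s * (1 + y * Complex.I) ^ (α : ℂ))

/-- The form `e^{zu - s z^α} dz` in the coordinate `ζ = log z`, in which it is entire. -/
def logIntegrand (s α u : ℝ) (ζ : ℂ) : ℂ :=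
  Complex.exp (u * Complex.exp ζ - s * Complex.exp (α * ζ)) * Complex.exp ζ

lemma exists_primitive (s α u : ℝ) :
    ∃ G : ℂ → ℂ, (∀ ζ, HasDerivAt G (logIntegrand s α u ζ) ζ) ∧ ∀ x : ℝ, (G x).im = 0 := by
  have hd : Differentiable ℂ (logIntegrand s α u) := by unfold logIntegrand; fun_prop
  obtain ⟨G, hG0, hG⟩ := (Differentiable.isExactOn_univ hd).with_val_at 0 0
  have hG' : ∀ ζ, HasDerivAt G (logIntegrand s α u ζ) ζ := fun ζ => hG ζ (mem_univ ζ)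
  refine ⟨G, hG', fun x => ?_⟩
  have hreal : ∀ x : ℝ, (logIntegrand s α u x).im = 0 := by
    intro x
    have : logIntegrand s α u x =
        ((Real.exp (u * Real.exp x - s * Real.exp (α * x)) * Real.exp x : ℝ) : ℂ) := by
      unfold logIntegrand; push_cast; ring_nf
    rw [this, Complex.ofReal_im]
  have hder : ∀ x : ℝ, HasDerivAt (fun x : ℝ => (G x).im) 0 x := by
    intro x
    have h1 := (hG' x).comp_ofReal
    have h2 := (Complex.imCLM.hasFDerivAt.comp_hasDerivAt x h1)
    simpa [Function.comp_def, hreal x] using h2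
  have := is_const_of_deriv_eq_zero (fun x => (hder x).differentiableAt)
    (fun x => (hder x).deriv) x 0
  rw [this]; simp [hG0]

lemma norm_logIntegrand (s α u : ℝ) {r : ℝ} (hr : 0 < r) (θ : ℝ) :
    ‖logIntegrand s α u (Real.log r + θ * Complex.I)‖ =
      r * Real.exp (u * (r * Real.cos θ) - s * (r ^ α * Real.cos (α * θ))) := by
  have e1 : Complex.exp (Real.log r + θ * Complex.I) = r * Complex.exp (θ * Complex.I) := by
    rw [Complex.exp_add, ← Complex.ofReal_exp, Real.exp_log hr]
  have e2 : Complex.exp (α * (Real.log r + θ * Complex.I)) =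
      (r ^ α : ℝ) * Complex.exp ((α * θ : ℝ) * Complex.I) := by
    rw [mul_add, Complex.exp_add, Real.rpow_def_of_pos hr]
    push_cast; ring_nf
  rw [logIntegrand, e1, e2, norm_mul, norm_mul, Complex.norm_exp_ofReal_mul_I, Complex.norm_exp,
    Complex.norm_real, Real.norm_of_nonneg hr.le, mul_one, mul_comm]
  congr 2
  simp only [Complex.sub_re, Complex.re_ofReal_mul, Complex.exp_ofReal_mul_I_re]

lemma norm_primitive_arc_le {s α u : ℝ} {G : ℂ → ℂ}
    (hG : ∀ ζ, HasDerivAt G (logIntegrand s α u ζ) ζ) {r : ℝ} (hr : 0 < r) {a b B : ℝ}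
    (hB : ∀ θ ∈ uIcc a b,
      r * Real.exp (u * (r * Real.cos θ) - s * (r ^ α * Real.cos (α * θ))) ≤ B) :
    ‖G (Real.log r + b * Complex.I) - G (Real.log r + a * Complex.I)‖ ≤ B * |b - a| := by
  have hder : ∀ θ : ℝ, HasDerivAt (fun θ : ℝ => G (Real.log r + θ * Complex.I))
      (logIntegrand s α u (Real.log r + θ * Complex.I) * Complex.I) θ := by
    intro θ
    have h1 : HasDerivAt (fun θ : ℝ => (Real.log r + θ * Complex.I : ℂ)) Complex.I θ := by
      simpa using ((Complex.ofRealCLM.hasDerivAt (x := θ)).mul_const Complex.I).const_add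
        (Real.log r : ℂ)
    exact (hG _).comp θ h1
  refine (convex_uIcc a b).norm_image_sub_le_of_norm_hasDerivWithin_le
    (fun θ _ => (hder θ).hasDerivWithinAt) (fun θ hθ => ?_) left_mem_uIcc right_mem_uIcc
  rw [norm_mul, Complex.norm_I, mul_one, norm_logIntegrand s α u hr]
  exact hB θ hθ

lemma hasDerivAt_primitive_line {s α u : ℝ} {G : ℂ → ℂ}
    (hG : ∀ ζ, HasDerivAt G (logIntegrand s α u ζ) ζ) (y : ℝ) :
    HasDerivAt (fun y : ℝ => G (Complex.log (1 + y * Complex.I)))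
      (Complex.I * bromwich s α u y) y := by
  have hz : (1 + y * Complex.I : ℂ) ∈ Complex.slitPlane := by left; simp
  have hz0 := Complex.slitPlane_ne_zero hz
  have h1 : HasDerivAt (fun y : ℝ => (1 + y * Complex.I : ℂ)) Complex.I y := by
    simpa using ((Complex.ofRealCLM.hasDerivAt (x := y)).mul_const Complex.I).const_add (1 : ℂ)
  have h2 := h1.clog_real hz
  have h3 := (hG (Complex.log (1 + y * Complex.I))).comp y h2
  refine h3.congr_deriv ?_
  rw [logIntegrand, bromwich, Complex.exp_log hz0, Complex.cpow_def_of_ne_zero hz0,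
    ← Complex.exp_add]
  field_simp
  ring_nf

lemma re_cpow_line {α : ℝ} (y : ℝ) (hα0 : 0 ≤ α) (hα1 : α ≤ 1) :
    |y| ^ α * Real.cos (α * (Real.pi / 2)) ≤ (((1 + y * Complex.I : ℂ)) ^ (α : ℂ)).re := by
  have hz0 : (1 + y * Complex.I : ℂ) ≠ 0 := by
    intro h; simpa using congrArg Complex.re h
  have hre : ((1 + y * Complex.I : ℂ)).re = 1 := by simp
  have harg : |Complex.arg (1 + y * Complex.I)| ≤ Real.pi / 2 := by
    rw [Complex.abs_arg_le_pi_div_two_iff]; simp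
  have hn : |y| ≤ ‖(1 + y * Complex.I : ℂ)‖ := by
    simpa using Complex.abs_im_le_norm (1 + y * Complex.I : ℂ)
  have hform : (((1 + y * Complex.I : ℂ)) ^ (α : ℂ)).re =
      ‖(1 + y * Complex.I : ℂ)‖ ^ α * Real.cos (α * Complex.arg (1 + y * Complex.I)) := by
    rw [Complex.cpow_ofReal_re, mul_comm α]
  rw [hform]
  have hpi := Real.pi_pos
  have hc0 : 0 ≤ Real.cos (α * (Real.pi / 2)) :=
    Real.cos_nonneg_of_mem_Icc ⟨by nlinarith, by nlinarith⟩
  have hc : Real.cos (α * (Real.pi / 2)) ≤ Real.cos (α * Complex.arg (1 + y * Complex.I)) := by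
    rw [← Real.cos_abs (α * Complex.arg _), abs_mul, abs_of_nonneg hα0]
    refine Real.cos_le_cos_of_nonneg_of_le_pi (by positivity) (by nlinarith) (by gcongr)
  gcongr

lemma norm_bromwich_le {s α : ℝ} (hs : 0 < s) (hα0 : 0 < α) (hα1 : α < 1) (u y : ℝ) :
    ‖bromwich s α u y‖ ≤
      Real.exp u * Real.exp (-(s * Real.cos (α * (Real.pi / 2))) * |y| ^ α) := by
  rw [bromwich, norm_mul, Complex.norm_exp, Complex.norm_exp]
  have e1 : ((1 + y * Complex.I) * u : ℂ).re = u := by simp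
  have e2 : (-s * (1 + y * Complex.I) ^ (α : ℂ) : ℂ).re =
      -(s * ((1 + y * Complex.I : ℂ) ^ (α : ℂ)).re) := by
    rw [← Complex.ofReal_neg, Complex.re_ofReal_mul]; ring
  rw [e1, e2]
  have := re_cpow_line y hα0.le hα1.le
  gcongr
  nlinarith

lemma cos_alpha_pos {α : ℝ} (hα0 : 0 < α) (hα1 : α < 1) : 0 < Real.cos (α * (Real.pi / 2)) := by
  have hpi := Real.pi_pos
  exact Real.cos_pos_of_mem_Ioo ⟨by nlinarith, by nlinarith⟩

lemma continuous_bromwich (s α u : ℝ) : Continuous (bromwich s α u) := by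
  unfold bromwich
  have h : Continuous fun y : ℝ => (1 + y * Complex.I : ℂ) ^ (α : ℂ) := by
    refine continuous_iff_continuousAt.2 fun y => ?_
    have : ContinuousAt (fun z : ℂ => z ^ (α : ℂ)) (1 + y * Complex.I) :=
      continuousAt_cpow_const (by left; simp)
    exact ContinuousAt.comp (g := fun z : ℂ => z ^ (α : ℂ)) this
      (by fun_prop : Continuous fun y : ℝ => (1 + y * Complex.I : ℂ)).continuousAt
  fun_prop

lemma integrable_exp_neg_abs_rpow {α b : ℝ} (hα0 : 0 < α) (hb : 0 < b) :
    Integrable fun y : ℝ => Real.exp (-b * |y| ^ α) := by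
  have h := integrableOn_rpow_mul_exp_neg_mul_rpow (s := 0) (by norm_num) hα0 hb
  simp only [Real.rpow_zero, one_mul] at h
  have h' : IntegrableOn (fun y : ℝ => Real.exp (-b * |y| ^ α)) (Ioi 0) :=
    h.congr_fun (fun y hy => by rw [abs_of_pos hy]) measurableSet_Ioi
  rw [← integrableOn_univ, ← Iic_union_Ioi (a := (0 : ℝ)), integrableOn_union]
  refine ⟨?_, h'⟩
  rw [← Measure.map_neg_eq_self (volume : Measure ℝ)]
  let m : MeasurableEmbedding fun x : ℝ => -x := (Homeomorph.neg ℝ).measurableEmbedding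
  rw [m.integrableOn_map_iff]
  simp_rw [Function.comp_def, abs_neg, neg_preimage, neg_Iic, neg_zero]
  exact Iff.mpr integrableOn_Ici_iff_integrableOn_Ioi h'

lemma integrable_bromwich {s α : ℝ} (hs : 0 < s) (hα0 : 0 < α) (hα1 : α < 1) (u : ℝ) :
    Integrable (bromwich s α u) := by
  have hc := cos_alpha_pos hα0 hα1
  refine ((integrable_exp_neg_abs_rpow hα0 (mul_pos hs hc)).const_mul (Real.exp u)).mono'
    (continuous_bromwich s α u).aestronglyMeasurable
    (ae_of_all _ fun y => norm_bromwich_le hs hα0 hα1 u y)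

lemma bromwich_neg (s α u y : ℝ) : bromwich s α u (-y) = conj (bromwich s α u y) := by
  have hz : (1 + y * Complex.I : ℂ) ∈ Complex.slitPlane := by left; simp
  have e1 : (1 + ((-y : ℝ) : ℂ) * Complex.I) = conj (1 + y * Complex.I : ℂ) := by simp
  have harg : (1 + y * Complex.I : ℂ).arg ≠ Real.pi := (Complex.mem_slitPlane_iff_arg.1 hz).1
  have e2 : (conj (1 + y * Complex.I : ℂ)) ^ (α : ℂ) = conj ((1 + y * Complex.I : ℂ) ^ (α : ℂ)) := by
    rw [Complex.conj_cpow _ _ harg, Complex.conj_ofReal]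
  rw [bromwich, bromwich, e1, e2]
  simp only [map_mul, ← Complex.exp_conj, map_neg, Complex.conj_ofReal]

/-- The Bromwich integral is twice the limit of the imaginary part of the primitive along the
upper half of the line `Re z = 1`. -/
lemma tendsto_primitive_line {s α u : ℝ} (hs : 0 < s) (hα0 : 0 < α) (hα1 : α < 1) {G : ℂ → ℂ}
    (hG : ∀ ζ, HasDerivAt G (logIntegrand s α u ζ) ζ) (hG0 : ∀ x : ℝ, (G x).im = 0) :
    ∃ L : ℝ, Tendsto (fun Y : ℝ => (G (Complex.log (1 + Y * Complex.I))).im) atTop (𝓝 L) ∧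
      ∫ y, bromwich s α u y = ((2 * L : ℝ) : ℂ) := by
  have hint := integrable_bromwich hs hα0 hα1 u
  set I0 := ∫ y in Ioi (0 : ℝ), bromwich s α u y with hI0
  refine ⟨I0.re, ?_, ?_⟩
  · have h1 := intervalIntegral_tendsto_integral_Ioi 0 hint.integrableOn tendsto_id
    have h2 := (Complex.continuous_re.tendsto _).comp h1
    refine h2.congr fun Y => ?_
    have h3 : ∫ y in (0 : ℝ)..Y, Complex.I * bromwich s α u y =
        G (Complex.log (1 + Y * Complex.I)) - G (Complex.log (1 + (0 : ℝ) * Complex.I)) :=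
      intervalIntegral.integral_eq_sub_of_hasDerivAt
        (fun y _ => hasDerivAt_primitive_line hG y)
        ((continuous_const.mul (continuous_bromwich s α u)).intervalIntegrable _ _)
    rw [intervalIntegral.integral_const_mul] at h3
    have h4 := congrArg Complex.im h3
    have h5 : (G (Complex.log (1 + (0 : ℝ) * Complex.I))).im = 0 := by
      have := hG0 0
      simpa using this
    rw [Complex.sub_im, h5, sub_zero, Complex.I_mul_im] at h4
    exact h4
  · rw [← integral_add_compl (measurableSet_Ioi (a := (0 : ℝ))) hint, compl_Ioi]
    have h1 : ∫ y in Iic (0 : ℝ), bromwich s α u y = conj I0 := by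
      have := integral_comp_neg_Iic (0 : ℝ) (fun y => bromwich s α u (-y))
      simp only [neg_neg, neg_zero] at this
      rw [this, hI0, ← integral_conj]
      simp only [bromwich_neg]
    rw [h1, Complex.add_conj]

lemma tendsto_mul_exp_neg_rpow {α C c : ℝ} (hα0 : 0 < α) (hc : 0 < c) :
    Tendsto (fun r : ℝ => r * Real.exp (C - c * r ^ α)) atTop (𝓝 0) := by
  have h1 := (tendsto_rpow_mul_exp_neg_mul_atTop_nhds_zero (1 / α) c hc).comp
    (tendsto_rpow_atTop hα0)
  have h2 := h1.mul_const (Real.exp C)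
  rw [zero_mul] at h2
  refine h2.congr' ?_
  filter_upwards [eventually_gt_atTop 0] with r hr
  rw [Function.comp_apply, ← Real.rpow_mul hr.le, mul_one_div_cancel hα0.ne', Real.rpow_one,
    sub_eq_add_neg, Real.exp_add]
  ring_nf

lemma log_line (Y : ℝ) : Complex.log (1 + Y * Complex.I) =
    Real.log ‖(1 + Y * Complex.I : ℂ)‖ + (Complex.arg (1 + Y * Complex.I)) * Complex.I := rfl

lemma tendsto_norm_line : Tendsto (fun Y : ℝ => ‖(1 + Y * Complex.I : ℂ)‖) atTop atTop := by
  refine tendsto_atTop_mono (fun Y => ?_) tendsto_id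
  refine (le_abs_self Y).trans ?_
  simpa using Complex.abs_im_le_norm (1 + Y * Complex.I : ℂ)

lemma arg_line_mem {Y : ℝ} (hY : 0 ≤ Y) :
    Complex.arg (1 + Y * Complex.I) ∈ Icc 0 (Real.pi / 2) := by
  refine ⟨Complex.arg_nonneg_iff.2 (by simpa using hY), ?_⟩
  have : |Complex.arg (1 + Y * Complex.I)| ≤ Real.pi / 2 := by
    rw [Complex.abs_arg_le_pi_div_two_iff]; simp
  exact (le_abs_self _).trans this

/-- Closing the contour to the right: the Bromwich integral vanishes for `u ≤ 0`. -/
lemma integral_bromwich_of_nonpos {s α u : ℝ} (hs : 0 < s) (hα0 : 0 < α) (hα1 : α < 1)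
    (hu : u ≤ 0) : ∫ y, bromwich s α u y = 0 := by
  obtain ⟨G, hG, hG0⟩ := exists_primitive s α u
  obtain ⟨L, hL, hI⟩ := tendsto_primitive_line hs hα0 hα1 hG hG0
  have hpi := Real.pi_pos
  have hc := cos_alpha_pos hα0 hα1
  suffices h : L = 0 by rw [hI, h]; simp
  refine tendsto_nhds_unique hL ?_
  have hlim := ((tendsto_mul_exp_neg_rpow (C := 0) hα0 (mul_pos hs hc)).comp
    tendsto_norm_line).mul_const (Real.pi / 2)
  rw [zero_mul] at hlim
  refine squeeze_zero_norm' ?_ hlim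
  filter_upwards [eventually_gt_atTop 0] with Y hY
  set r := ‖(1 + Y * Complex.I : ℂ)‖ with hr
  have hr0 : 0 < r := norm_pos_iff.2 (by intro h; simpa using congrArg Complex.re h)
  obtain ⟨ha0, ha1⟩ := arg_line_mem hY.le
  set a := Complex.arg (1 + Y * Complex.I)
  have hB : ∀ θ ∈ uIcc 0 a,
      r * Real.exp (u * (r * Real.cos θ) - s * (r ^ α * Real.cos (α * θ))) ≤
        r * Real.exp (0 - s * Real.cos (α * (Real.pi / 2)) * r ^ α) := by
    intro θ hθ
    rw [uIcc_of_le ha0] at hθ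
    have h1 : 0 ≤ Real.cos θ := Real.cos_nonneg_of_mem_Icc ⟨by linarith [hθ.1], hθ.2.trans ha1⟩
    have h2 : Real.cos (α * (Real.pi / 2)) ≤ Real.cos (α * θ) := by
      refine Real.cos_le_cos_of_nonneg_of_le_pi (mul_nonneg hα0.le hθ.1) (by nlinarith) ?_
      have := hθ.2.trans ha1
      gcongr
    have h3 : u * (r * Real.cos θ) ≤ 0 := mul_nonpos_of_nonpos_of_nonneg hu (by positivity)
    have h4 : 0 < r ^ α := Real.rpow_pos_of_pos hr0 _
    have h5 : s * (r ^ α * Real.cos (α * (Real.pi / 2))) ≤ s * (r ^ α * Real.cos (α * θ)) := by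
      gcongr
    refine mul_le_mul_of_nonneg_left (Real.exp_le_exp.2 ?_) hr0.le
    linarith
  have h1 := norm_primitive_arc_le hG hr0 hB
  have h2 : (G (Real.log r + (0 : ℝ) * Complex.I)).im = 0 := by simpa using hG0 (Real.log r)
  rw [log_line, Function.comp_apply]
  calc ‖(G (Real.log r + a * Complex.I)).im‖
      = ‖(G (Real.log r + a * Complex.I) - G (Real.log r + (0 : ℝ) * Complex.I)).im‖ := by
        rw [Complex.sub_im, h2, sub_zero]
    _ ≤ _ := Complex.abs_im_le_norm _
    _ ≤ _ := h1
    _ ≤ _ := by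
      rw [sub_zero, abs_of_nonneg ha0]
      gcongr

/-- On the part `Re z ≤ 1` of a large circle `|z| = r`, the exponent `u z - s z^α` has real part at
most `C - c r^α`. -/
lemma exists_arc_bound {s α u : ℝ} (hs : 0 < s) (hα0 : 0 < α) (hα1 : α < 1) (hu : 0 < u) :
    ∃ c > 0, ∀ᶠ r : ℝ in atTop, ∀ θ ∈ Icc 0 Real.pi, r * Real.cos θ ≤ 1 →
      u * (r * Real.cos θ) - s * (r ^ α * Real.cos (α * θ)) ≤ u - c * r ^ α := by
  have hpi := Real.pi_pos
  -- the angle `θ₀` lies in the left half plane while `α θ₀` is still below `π / 2`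
  set θ₀ := Real.pi / 2 * (2 - α) with hθ₀
  have hk : 0 < Real.cos (α * θ₀) :=
    Real.cos_pos_of_mem_Ioo ⟨by
      have h1 : 0 ≤ θ₀ := mul_nonneg (by linarith) (by linarith)
      linarith [mul_nonneg hα0.le h1], by rw [hθ₀]; nlinarith [sq_pos_of_pos (sub_pos.2 hα1)]⟩
  have hκ : 0 < -Real.cos θ₀ := by
    rw [neg_pos]
    exact Real.cos_neg_of_pi_div_two_lt_of_lt (by rw [hθ₀]; nlinarith) (by rw [hθ₀]; nlinarith)
  refine ⟨min (s * Real.cos (α * θ₀)) 1, lt_min (mul_pos hs hk) one_pos, ?_⟩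
  have hsmall : ∀ᶠ r : ℝ in atTop, (s + 1) * r ^ α ≤ u * -Real.cos θ₀ * r := by
    have h1 := tendsto_rpow_neg_atTop (sub_pos.2 hα1)
    have hpos : 0 < u * -Real.cos θ₀ / (s + 1) := by positivity
    filter_upwards [h1.eventually (gt_mem_nhds hpos), eventually_gt_atTop 0] with r hr hr0
    have hsplit : r ^ α = r ^ (-(1 - α)) * r := by
      rw [← Real.rpow_add_one hr0.ne']; ring_nf
    calc (s + 1) * r ^ α ≤ (s + 1) * (u * -Real.cos θ₀ / (s + 1) * r) := by
          rw [hsplit]; gcongr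
      _ = _ := by field_simp
  filter_upwards [hsmall, eventually_gt_atTop 0] with r hr hr0 θ hθ hre
  have hrα : 0 < r ^ α := Real.rpow_pos_of_pos hr0 _
  have hm1 : min (s * Real.cos (α * θ₀)) 1 * r ^ α ≤ s * Real.cos (α * θ₀) * r ^ α := by
    gcongr; exact min_le_left _ _
  have hm2 : min (s * Real.cos (α * θ₀)) 1 * r ^ α ≤ 1 * r ^ α := by
    gcongr; exact min_le_right _ _
  rcases le_total θ θ₀ with h | h
  · have h1 : Real.cos (α * θ₀) ≤ Real.cos (α * θ) :=
      Real.cos_le_cos_of_nonneg_of_le_pi (mul_nonneg hα0.le hθ.1)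
        (by rw [hθ₀]; nlinarith [sq_pos_of_pos (sub_pos.2 hα1)]) (by gcongr)
    have h2 : s * (r ^ α * Real.cos (α * θ₀)) ≤ s * (r ^ α * Real.cos (α * θ)) := by gcongr
    nlinarith
  · have h1 : Real.cos θ ≤ Real.cos θ₀ :=
      Real.cos_le_cos_of_nonneg_of_le_pi (by rw [hθ₀]; nlinarith) hθ.2 h
    have h2 : u * (r * Real.cos θ) ≤ u * (r * Real.cos θ₀) := by gcongr
    have h3 : -(s * r ^ α) ≤ s * (r ^ α * Real.cos (α * θ)) := by
      have := Real.neg_one_le_cos (α * θ)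
      nlinarith [mul_pos hs hrα]
    nlinarith

/-! ### Zolotarev's formula -/

/-- Zolotarev's function `A(θ)` on `(0, π)`. -/
def zolotarev (α θ : ℝ) : ℝ :=
  Real.sin ((1 - α) * θ) / Real.sin θ * (Real.sin (α * θ) / Real.sin θ) ^ (α / (1 - α))

/-- The similarity variable `x = s^{1/(1-α)} u^{-α/(1-α)}` of the stable density. -/
def simVar (s α u : ℝ) : ℝ := s * (s / u) ^ (α / (1 - α))

lemma simVar_pos {s α u : ℝ} (hs : 0 < s) (hu : 0 < u) : 0 < simVar s α u := by
  unfold simVar; positivity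

lemma sin_mul_pos {β θ : ℝ} (hβ0 : 0 < β) (hβ1 : β ≤ 1) (hθ : θ ∈ Ioo 0 Real.pi) :
    0 < Real.sin (β * θ) :=
  Real.sin_pos_of_pos_of_lt_pi (mul_pos hβ0 hθ.1) (by nlinarith [hθ.1, hθ.2])

lemma zolotarev_pos {α θ : ℝ} (hα0 : 0 < α) (hα1 : α < 1) (hθ : θ ∈ Ioo 0 Real.pi) :
    0 < zolotarev α θ := by
  have h1 := sin_mul_pos hα0 hα1.le hθ
  have h2 := sin_mul_pos (sub_pos.2 hα1) (by linarith) hθ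
  have h3 := Real.sin_pos_of_pos_of_lt_pi hθ.1 hθ.2
  unfold zolotarev; positivity

lemma measurable_zolotarev (α : ℝ) : Measurable (zolotarev α) := by
  unfold zolotarev; fun_prop

/-- The logarithm of the modulus of the point of argument `θ` on the steepest descent contour, on
which `u z - s z^α` is real. -/
def contourLog (s α u θ : ℝ) : ℝ :=
  1 / (1 - α) * Real.log (s / u * (Real.sin (α * θ) / Real.sin θ))

section contour

variable {s α u θ : ℝ}

lemma exp_contourLog (hs : 0 < s) (hα0 : 0 < α) (hα1 : α < 1) (hu : 0 < u)
    (hθ : θ ∈ Ioo 0 Real.pi) :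
    Real.exp (contourLog s α u θ) = s / u * (Real.sin (α * θ) / Real.sin θ) *
      Real.exp (α * contourLog s α u θ) := by
  have h1 := sin_mul_pos hα0 hα1.le hθ
  have h3 := Real.sin_pos_of_pos_of_lt_pi hθ.1 hθ.2
  have hq : 0 < s / u * (Real.sin (α * θ) / Real.sin θ) := by positivity
  have h4 : 1 - α ≠ 0 := by linarith
  rw [← Real.exp_log hq, ← Real.exp_add, contourLog]
  congr 1
  field_simp; ring

lemma exp_alpha_contourLog (hs : 0 < s) (hα0 : 0 < α) (hα1 : α < 1) (hu : 0 < u)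
    (hθ : θ ∈ Ioo 0 Real.pi) :
    Real.exp (α * contourLog s α u θ) =
      (s / u) ^ (α / (1 - α)) * (Real.sin (α * θ) / Real.sin θ) ^ (α / (1 - α)) := by
  have h1 := sin_mul_pos hα0 hα1.le hθ
  have h3 := Real.sin_pos_of_pos_of_lt_pi hθ.1 hθ.2
  have hq : 0 < s / u * (Real.sin (α * θ) / Real.sin θ) := by positivity
  rw [← Real.mul_rpow (by positivity) (by positivity), Real.rpow_def_of_pos hq, contourLog]
  congr 1; ring

lemma logIntegrand_contour (hs : 0 < s) (hα0 : 0 < α) (hα1 : α < 1) (hu : 0 < u)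
    (hθ : θ ∈ Ioo 0 Real.pi) :
    logIntegrand s α u (contourLog s α u θ + θ * Complex.I) =
      (Real.exp (-(simVar s α u * zolotarev α θ)) * Real.exp (contourLog s α u θ) : ℝ) *
        Complex.exp (θ * Complex.I) := by
  have h1 := sin_mul_pos hα0 hα1.le hθ
  have h3 := Real.sin_pos_of_pos_of_lt_pi hθ.1 hθ.2
  set ℓ := contourLog s α u θ with hℓ
  have e1 : Complex.exp (ℓ + θ * Complex.I) = Real.exp ℓ * Complex.exp (θ * Complex.I) := by
    rw [Complex.exp_add, Complex.ofReal_exp]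
  have e2 : Complex.exp (α * (ℓ + θ * Complex.I)) =
      Real.exp (α * ℓ) * Complex.exp ((α * θ : ℝ) * Complex.I) := by
    rw [mul_add, Complex.exp_add, Complex.ofReal_exp]
    push_cast; ring_nf
  have e3 : (u * Complex.exp (ℓ + θ * Complex.I) - s * Complex.exp (α * (ℓ + θ * Complex.I)) : ℂ) =
      (-(simVar s α u * zolotarev α θ) : ℝ) := by
    have hexp := exp_contourLog hs hα0 hα1 hu hθ
    have hexp2 := exp_alpha_contourLog hs hα0 hα1 hu hθ
    have hsin : Real.sin ((1 - α) * θ) =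
        Real.sin θ * Real.cos (α * θ) - Real.cos θ * Real.sin (α * θ) := by
      rw [← Real.sin_sub]; ring_nf
    rw [e1, e2]
    apply Complex.ext
    · simp only [Complex.sub_re, Complex.re_ofReal_mul, Complex.exp_ofReal_mul_I_re,
        Complex.ofReal_re]
      rw [← hℓ] at hexp hexp2
      rw [simVar, zolotarev, hexp, hexp2, hsin]
      field_simp
      ring
    · simp only [Complex.sub_im, Complex.im_ofReal_mul, Complex.exp_ofReal_mul_I_im,
        Complex.ofReal_im]
      rw [← hℓ] at hexp
      rw [hexp]
      field_simp
      ring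
  rw [logIntegrand, e3, e1, ← Complex.ofReal_exp]
  push_cast; ring

lemma hasDerivAt_contourLog (hs : 0 < s) (hα0 : 0 < α) (hα1 : α < 1) (hu : 0 < u)
    (hθ : θ ∈ Ioo 0 Real.pi) :
    HasDerivAt (contourLog s α u) (1 / (1 - α) * (α * Real.cos (α * θ) / Real.sin (α * θ) -
      Real.cos θ / Real.sin θ)) θ := by
  have h1 := sin_mul_pos hα0 hα1.le hθ
  have h3 := Real.sin_pos_of_pos_of_lt_pi hθ.1 hθ.2
  have d1 : HasDerivAt (fun θ => Real.sin (α * θ)) (Real.cos (α * θ) * α) θ := by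
    simpa using ((hasDerivAt_id θ).const_mul α).sin
  have hq : s / u * (Real.sin (α * θ) / Real.sin θ) ≠ 0 := by positivity
  have d2 := (((d1.div (Real.hasDerivAt_sin θ) h3.ne').const_mul (s / u)).log hq).const_mul
    (1 / (1 - α))
  refine d2.congr_deriv ?_
  have : 1 - α ≠ 0 := by linarith
  simp only [Pi.div_apply]
  field_simp

lemma hasDerivAt_primitive_contour (hs : 0 < s) (hα0 : 0 < α) (hα1 : α < 1) (hu : 0 < u)
    (hθ : θ ∈ Ioo 0 Real.pi) {G : ℂ → ℂ} (hG : ∀ ζ, HasDerivAt G (logIntegrand s α u ζ) ζ) :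
    HasDerivAt (fun θ : ℝ => (G (contourLog s α u θ + θ * Complex.I)).im)
      (α / (1 - α) / u * (simVar s α u * zolotarev α θ *
        Real.exp (-(simVar s α u * zolotarev α θ)))) θ := by
  have h1 := sin_mul_pos hα0 hα1.le hθ
  have h3 := Real.sin_pos_of_pos_of_lt_pi hθ.1 hθ.2
  have hd := (hasDerivAt_contourLog hs hα0 hα1 hu hθ).ofReal_comp.add
    ((Complex.ofRealCLM.hasDerivAt (x := θ)).mul_const Complex.I)
  have hd2 := Complex.imCLM.hasFDerivAt.comp_hasDerivAt θ ((hG _).comp θ hd)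
  refine hd2.congr_deriv ?_
  have hsin : Real.sin ((1 - α) * θ) =
      Real.sin θ * Real.cos (α * θ) - Real.cos θ * Real.sin (α * θ) := by
    rw [← Real.sin_sub]; ring_nf
  have hexp := exp_contourLog hs hα0 hα1 hu hθ
  have hexp2 := exp_alpha_contourLog hs hα0 hα1 hu hθ
  have hα : 1 - α ≠ 0 := by linarith
  simp only [Pi.add_apply, Complex.ofRealCLM_apply]
  rw [logIntegrand_contour hs hα0 hα1 hu hθ, mul_assoc, Complex.imCLM_apply, Complex.im_ofReal_mul,
    Complex.mul_im, Complex.exp_ofReal_mul_I_re, Complex.exp_ofReal_mul_I_im]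
  simp only [Complex.add_im, Complex.add_re, Complex.ofReal_im, Complex.ofReal_re, one_mul,
    Complex.I_re, Complex.I_im, zero_add, add_zero, Complex.ofReal_one]
  rw [hexp, hexp2]
  conv_rhs => rw [zolotarev, simVar, hsin]
  rw [zolotarev, simVar, hsin]
  field_simp
  ring

lemma tendsto_sin_ratio_zero (α : ℝ) :
    Tendsto (fun θ => Real.sin (α * θ) / Real.sin θ) (𝓝[>] 0) (𝓝 α) := by
  have d1 : HasDerivAt (fun θ => Real.sin (α * θ)) α 0 := by
    simpa using ((hasDerivAt_id (0 : ℝ)).const_mul α).sin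
  have d2 : HasDerivAt Real.sin 1 0 := by simpa using Real.hasDerivAt_sin 0
  have l1 := (d1.tendsto_slope_zero_right).div d2.tendsto_slope_zero_right one_ne_zero
  rw [div_one] at l1
  refine l1.congr' ?_
  filter_upwards [self_mem_nhdsWithin] with t ht
  have : t ≠ 0 := ne_of_gt ht
  simp only [Pi.div_apply, zero_add, mul_zero, Real.sin_zero, sub_zero, smul_eq_mul]
  rw [mul_div_mul_left _ _ (inv_ne_zero this)]

lemma tendsto_sin_ratio_pi (hα0 : 0 < α) (hα1 : α < 1) :
    Tendsto (fun θ => Real.sin (α * θ) / Real.sin θ) (𝓝[<] Real.pi) atTop := by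
  have hpi := Real.pi_pos
  have h1 : Tendsto (fun θ => Real.sin (α * θ)) (𝓝[<] Real.pi) (𝓝 (Real.sin (α * Real.pi))) :=
    ((by fun_prop : Continuous fun θ => Real.sin (α * θ)).tendsto _).mono_left nhdsWithin_le_nhds
  have h2 : Tendsto Real.sin (𝓝[<] Real.pi) (𝓝[>] 0) := by
    refine tendsto_nhdsWithin_iff.2 ⟨?_, ?_⟩
    · have := (Real.continuous_sin.tendsto Real.pi).mono_left
        (nhdsWithin_le_nhds (s := Iio Real.pi))
      rwa [Real.sin_pi] at this
    · filter_upwards [Ioo_mem_nhdsLT hpi] with θ hθ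
      exact Real.sin_pos_of_pos_of_lt_pi hθ.1 hθ.2
  have hpos : 0 < Real.sin (α * Real.pi) :=
    Real.sin_pos_of_pos_of_lt_pi (by positivity) (by nlinarith)
  simp only [div_eq_mul_inv]
  exact h1.pos_mul_atTop hpos h2.inv_tendsto_nhdsGT_zero

lemma tendsto_exp_contourLog_pi (hs : 0 < s) (hα0 : 0 < α) (hα1 : α < 1) (hu : 0 < u) :
    Tendsto (fun θ => Real.exp (contourLog s α u θ)) (𝓝[<] Real.pi) atTop := by
  refine Real.tendsto_exp_atTop.comp ?_
  unfold contourLog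
  have : 0 < 1 / (1 - α) := one_div_pos.2 (sub_pos.2 hα1)
  exact (Real.tendsto_log_atTop.comp
    ((tendsto_sin_ratio_pi hα0 hα1).const_mul_atTop (div_pos hs hu))).const_mul_atTop this

lemma tendsto_primitive_contour_pi (hs : 0 < s) (hα0 : 0 < α) (hα1 : α < 1) (hu : 0 < u)
    {G : ℂ → ℂ} (hG : ∀ ζ, HasDerivAt G (logIntegrand s α u ζ) ζ) {L : ℝ}
    (hL : Tendsto (fun Y : ℝ => (G (Complex.log (1 + Y * Complex.I))).im) atTop (𝓝 L)) :
    Tendsto (fun θ : ℝ => (G (contourLog s α u θ + θ * Complex.I)).im) (𝓝[<] Real.pi) (𝓝 L) := by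
  have hpi := Real.pi_pos
  obtain ⟨c, hc, hbound⟩ := exists_arc_bound hs hα0 hα1 hu
  -- the contour point of argument `θ` is joined by an arc to the point `1 + i Y` of equal modulus
  have hr := tendsto_exp_contourLog_pi hs hα0 hα1 hu
  have hYlim : Tendsto (fun θ => Real.sqrt (Real.exp (contourLog s α u θ) ^ 2 - 1))
      (𝓝[<] Real.pi) atTop := by
    refine Real.tendsto_sqrt_atTop.comp (tendsto_atTop_add_const_right _ _ ?_)
    exact (tendsto_pow_atTop two_ne_zero).comp hr
  have hL2 := hL.comp hYlim
  have hdiff : Tendsto (fun θ : ℝ => (G (contourLog s α u θ + θ * Complex.I)).im -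
      (G (Complex.log (1 + (Real.sqrt (Real.exp (contourLog s α u θ) ^ 2 - 1) : ℝ) *
        Complex.I))).im) (𝓝[<] Real.pi) (𝓝 0) := by
    have hlim := ((tendsto_mul_exp_neg_rpow (C := u) hα0 hc).comp hr).mul_const Real.pi
    rw [zero_mul] at hlim
    refine squeeze_zero_norm' ?_ hlim
    filter_upwards [hr.eventually hbound, hr.eventually (eventually_gt_atTop 1),
      Ioo_mem_nhdsLT (a := Real.pi / 2) (b := Real.pi) (by linarith)] with θ hb hr1 hθ
    rw [Function.comp_apply]
    set r := Real.exp (contourLog s α u θ) with hrdef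
    set Y := Real.sqrt (r ^ 2 - 1) with hY
    have hr0 : 0 < r := Real.exp_pos _
    have hY2 : Y ^ 2 = r ^ 2 - 1 := Real.sq_sqrt (by nlinarith)
    have hnorm : ‖(1 + Y * Complex.I : ℂ)‖ = r := by
      have : (1 + Y * Complex.I : ℂ) = ((1 : ℝ) : ℂ) + Y * Complex.I := by simp
      rw [this, Complex.norm_add_mul_I, hY2]
      rw [show (1 : ℝ) ^ 2 + (r ^ 2 - 1) = r ^ 2 by ring, Real.sqrt_sq hr0.le]
    have hlogr : contourLog s α u θ = Real.log r := by rw [hrdef, Real.log_exp]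
    obtain ⟨ha0, ha1⟩ := arg_line_mem (Real.sqrt_nonneg (r ^ 2 - 1))
    rw [← hY] at ha0 ha1
    set a := Complex.arg (1 + Y * Complex.I) with ha
    have hcosa : r * Real.cos a = 1 := by
      have := Complex.norm_mul_cos_arg (1 + Y * Complex.I)
      rw [hnorm] at this; simpa using this
    rw [log_line, hnorm, ← ha, hlogr]
    have haθ : a ≤ θ := by linarith [hθ.1]
    have hB : ∀ φ ∈ uIcc a θ,
        r * Real.exp (u * (r * Real.cos φ) - s * (r ^ α * Real.cos (α * φ))) ≤
          r * Real.exp (u - c * r ^ α) := by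
      intro φ hφ
      rw [uIcc_of_le haθ] at hφ
      have hφpi : φ ∈ Icc 0 Real.pi := ⟨ha0.trans hφ.1, hφ.2.trans hθ.2.le⟩
      have hcos : r * Real.cos φ ≤ 1 := by
        rw [← hcosa]
        exact mul_le_mul_of_nonneg_left
          (Real.cos_le_cos_of_nonneg_of_le_pi ha0 hφpi.2 hφ.1) hr0.le
      exact mul_le_mul_of_nonneg_left (Real.exp_le_exp.2 (hb φ hφpi hcos)) hr0.le
    rw [← Complex.sub_im]
    refine (Complex.abs_im_le_norm _).trans ((norm_primitive_arc_le hG hr0 hB).trans ?_)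
    refine mul_le_mul_of_nonneg_left ?_ (by positivity)
    rw [abs_of_nonneg (by linarith)]
    linarith [hθ.2]
  have := hdiff.add hL2
  simp only [Function.comp_apply, sub_add_cancel, zero_add] at this
  exact this

lemma tendsto_primitive_contour_zero (hs : 0 < s) (hα0 : 0 < α) (hu : 0 < u)
    {G : ℂ → ℂ} (hG : ∀ ζ, HasDerivAt G (logIntegrand s α u ζ) ζ) (hG0 : ∀ x : ℝ, (G x).im = 0) :
    Tendsto (fun θ : ℝ => (G (contourLog s α u θ + θ * Complex.I)).im) (𝓝[>] 0) (𝓝 0) := by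
  have hGc : Continuous G := continuous_iff_continuousAt.2 fun z => (hG z).continuousAt
  have h0 : 0 < s / u * α := by positivity
  have h1 : Tendsto (contourLog s α u) (𝓝[>] 0) (𝓝 (1 / (1 - α) * Real.log (s / u * α))) :=
    (((tendsto_sin_ratio_zero α).const_mul (s / u)).log h0.ne').const_mul _
  have h2 : Tendsto (fun θ : ℝ => (θ : ℂ) * Complex.I) (𝓝[>] 0) (𝓝 0) := by
    have : Continuous fun θ : ℝ => (θ : ℂ) * Complex.I := by fun_prop
    simpa using (this.tendsto 0).mono_left nhdsWithin_le_nhds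
  have h3 := ((Complex.continuous_im.comp hGc).tendsto _).comp
    (((Complex.continuous_ofReal.tendsto _).comp h1).add h2)
  simp only [Function.comp_apply, add_zero, hG0] at h3
  exact h3

lemma mul_exp_neg_le_one {t : ℝ} : t * Real.exp (-t) ≤ 1 := by
  have h1 := Real.add_one_le_exp t
  have h2 : Real.exp t * Real.exp (-t) = 1 := by rw [← Real.exp_add]; simp
  nlinarith [Real.exp_pos (-t)]

lemma integrableOn_zolotarev (hα0 : 0 < α) (hα1 : α < 1) {x : ℝ} (hx : 0 ≤ x) :
    IntegrableOn (fun θ => x * zolotarev α θ * Real.exp (-(x * zolotarev α θ)))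
      (Ioo 0 Real.pi) := by
  have hm := measurable_zolotarev α
  refine Measure.integrableOn_of_bounded (M := 1) (by simp) (by fun_prop) ?_
  filter_upwards [ae_restrict_mem measurableSet_Ioo] with θ hθ
  have := zolotarev_pos hα0 hα1 hθ
  rw [Real.norm_of_nonneg (by positivity)]
  exact mul_exp_neg_le_one

/-- **Zolotarev's formula** for the one-sided stable density. -/
lemma phi_eq (hs : 0 < s) (hα0 : 0 < α) (hα1 : α < 1) (hu : 0 < u) :
    phi s α u = α / (1 - α) / (Real.pi * u) * ∫ θ in Ioo 0 Real.pi,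
      simVar s α u * zolotarev α θ * Real.exp (-(simVar s α u * zolotarev α θ)) := by
  have hpi := Real.pi_pos
  obtain ⟨G, hG, hG0⟩ := exists_primitive s α u
  obtain ⟨L, hL, hI⟩ := tendsto_primitive_line hs hα0 hα1 hG hG0
  have hint := integrableOn_zolotarev hα0 hα1 (simVar_pos (α := α) hs hu).le
  have key := intervalIntegral.integral_eq_sub_of_hasDerivAt_of_tendsto hpi
    (fun θ hθ => hasDerivAt_primitive_contour hs hα0 hα1 hu hθ hG)
    ((intervalIntegrable_iff_integrableOn_Ioo_of_le hpi.le).2 (hint.const_mul _))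
    (tendsto_primitive_contour_zero hs hα0 hu hG hG0)
    (tendsto_primitive_contour_pi hs hα0 hα1 hu hG hL)
  rw [sub_zero, intervalIntegral.integral_of_le hpi.le, integral_Ioc_eq_integral_Ioo,
    integral_const_mul] at key
  have hphi : phi s α u = 1 / (2 * Real.pi) * (2 * L) := by
    rw [phi]
    congr 1
    have := congrArg Complex.re hI
    rwa [Complex.ofReal_re] at this
  rw [hphi, ← key]
  field_simp

end contour

/-! ### Scale mixtures of a profile -/

/-- The kernel obtained from Zolotarev's formula by replacing the profile `t e^{-t}` by `h`. -/
def stableKernel (h : ℝ → ℝ) (α s u : ℝ) : ℝ :=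
  α / (1 - α) / (Real.pi * u) * ∫ θ in Ioo 0 Real.pi, h (simVar s α u * zolotarev α θ)

section kernel

variable {α s : ℝ} {h : ℝ → ℝ}

lemma simVar_eq {u : ℝ} (hs : 0 < s) (hu : 0 < u) :
    simVar s α u = s * s ^ (α / (1 - α)) * u ^ (-(α / (1 - α))) := by
  rw [simVar, Real.div_rpow hs.le hu.le, Real.rpow_neg hu.le]; ring

@[fun_prop]
lemma measurable_simVar (s α : ℝ) : Measurable (simVar s α) := by
  unfold simVar; fun_prop

/-- For a fixed angle, the change of variables `t = x(u) A` turns `γ du / u` into `dt / t`. -/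
lemma scale_integral (hs : 0 < s) (hα0 : 0 < α) (hα1 : α < 1) {a : ℝ} (ha : 0 < a) :
    (IntegrableOn (fun u => α / (1 - α) / u * h (simVar s α u * a)) (Ioi 0) ↔
      IntegrableOn (fun t => h t / t) (Ioi 0)) ∧
    ∫ u in Ioi 0, α / (1 - α) / u * h (simVar s α u * a) = ∫ t in Ioi 0, h t / t := by
  have hγ : 0 < α / (1 - α) := div_pos hα0 (sub_pos.2 hα1)
  set γ := α / (1 - α) with hγd
  set c := s * s ^ γ * a with hc
  have hc0 : 0 < c := by positivity
  have hcongr : EqOn (fun u => γ / u * h (simVar s α u * a))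
      (fun u => (|(-γ)| * u ^ (-γ - 1)) • (fun y => h (c * y) / y) (u ^ (-γ))) (Ioi 0) := by
    intro u hu
    have hu : 0 < u := hu
    have e1 : simVar s α u * a = c * u ^ (-γ) := by rw [simVar_eq hs hu, hc]; ring
    have e2 : u ^ (-γ - 1) = u ^ (-γ) / u := by rw [Real.rpow_sub_one hu.ne']
    have e3 : u ^ (-γ) ≠ 0 := (Real.rpow_pos_of_pos hu _).ne'
    simp only [e1, e2, abs_neg, abs_of_pos hγ, smul_eq_mul]
    field_simp
  have hscale : EqOn (fun y => h (c * y) / y) (fun y => c * ((fun t => h t / t) (c * y)))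
      (Ioi 0) := by
    intro y hy
    have hy : y ≠ 0 := ne_of_gt hy
    simp only
    field_simp
  constructor
  · rw [integrableOn_congr_fun hcongr measurableSet_Ioi,
      integrableOn_Ioi_comp_rpow_iff (fun y => h (c * y) / y) (neg_ne_zero.2 hγ.ne'),
      integrableOn_congr_fun hscale measurableSet_Ioi]
    have := integrableOn_Ioi_comp_mul_left_iff (fun t => h t / t) 0 hc0
    rw [mul_zero] at this
    rw [← this]
    exact integrable_const_mul_iff (isUnit_iff_ne_zero.2 hc0.ne') _
  · rw [setIntegral_congr_fun measurableSet_Ioi hcongr,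
      integral_comp_rpow_Ioi (fun y => h (c * y) / y) (neg_ne_zero.2 hγ.ne'),
      setIntegral_congr_fun measurableSet_Ioi hscale, integral_const_mul,
      integral_comp_mul_left_Ioi (fun t => h t / t) 0 hc0, mul_zero, smul_eq_mul,
      mul_inv_cancel_left₀ hc0.ne']

lemma integrable_kernel_prod (hs : 0 < s) (hα0 : 0 < α) (hα1 : α < 1) (hm : Measurable h)
    (hi : IntegrableOn (fun t => h t / t) (Ioi 0)) :
    Integrable (Function.uncurry fun u θ =>
      α / (1 - α) / (Real.pi * u) * h (simVar s α u * zolotarev α θ))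
      ((volume.restrict (Ioi 0)).prod (volume.restrict (Ioo 0 Real.pi))) := by
  have hA := measurable_zolotarev α
  have hpi := Real.pi_pos
  have hγ : 0 < α / (1 - α) := div_pos hα0 (sub_pos.2 hα1)
  have hmeas : Measurable (Function.uncurry fun u θ =>
      α / (1 - α) / (Real.pi * u) * h (simVar s α u * zolotarev α θ)) := by
    have : Measurable fun q : ℝ × ℝ => simVar s α q.1 * zolotarev α q.2 :=
      ((measurable_simVar s α).comp measurable_fst).mul (hA.comp measurable_snd)
    unfold Function.uncurry
    exact (by fun_prop : Measurable fun q : ℝ × ℝ => α / (1 - α) / (Real.pi * q.1)).mul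
      (hm.comp this)
  rw [integrable_prod_iff' hmeas.aestronglyMeasurable]
  have heq : ∀ (u θ : ℝ), α / (1 - α) / (Real.pi * u) * h (simVar s α u * zolotarev α θ) =
      Real.pi⁻¹ * (α / (1 - α) / u * h (simVar s α u * zolotarev α θ)) := by
    intro u θ; field_simp
  constructor
  · filter_upwards [ae_restrict_mem measurableSet_Ioo] with θ hθ
    simp only [Function.uncurry, heq]
    exact (((scale_integral hs hα0 hα1 (zolotarev_pos hα0 hα1 hθ)).1.2 hi).const_mul _)
  · have hconst : ∀ θ ∈ Ioo 0 Real.pi, (∫ u in Ioi 0, ‖Function.uncurry (fun u θ =>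
        α / (1 - α) / (Real.pi * u) * h (simVar s α u * zolotarev α θ)) (u, θ)‖) =
        Real.pi⁻¹ * ∫ t in Ioi 0, |h t| / t := by
      intro θ hθ
      rw [← (scale_integral (h := fun t => |h t|) hs hα0 hα1 (zolotarev_pos hα0 hα1 hθ)).2,
        ← integral_const_mul]
      refine setIntegral_congr_fun measurableSet_Ioi fun u hu => ?_
      have hu : 0 < u := hu
      simp only [Function.uncurry, heq, norm_mul, Real.norm_eq_abs, abs_of_pos (inv_pos.2 hpi),
        abs_of_pos (div_pos hγ hu)]
    exact IntegrableOn.congr_fun (integrableOn_const (by simp)) (fun θ hθ => (hconst θ hθ).symm)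
      measurableSet_Ioo

lemma integrableOn_stableKernel (hs : 0 < s) (hα0 : 0 < α) (hα1 : α < 1) (hm : Measurable h)
    (hi : IntegrableOn (fun t => h t / t) (Ioi 0)) :
    IntegrableOn (stableKernel h α s) (Ioi 0) := by
  refine (integrable_kernel_prod hs hα0 hα1 hm hi).integral_prod_left.congr
    (ae_of_all _ fun u => ?_)
  simp only [Function.uncurry, stableKernel, integral_const_mul]

lemma integral_stableKernel (hs : 0 < s) (hα0 : 0 < α) (hα1 : α < 1) (hm : Measurable h)
    (hi : IntegrableOn (fun t => h t / t) (Ioi 0)) :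
    ∫ u in Ioi 0, stableKernel h α s u = ∫ t in Ioi 0, h t / t := by
  have hpi := Real.pi_pos
  have h1 := integral_integral_swap (integrable_kernel_prod hs hα0 hα1 hm hi)
  simp only [integral_const_mul] at h1
  unfold stableKernel
  rw [h1]
  have hconst : ∀ θ ∈ Ioo 0 Real.pi, (∫ u in Ioi 0,
      α / (1 - α) / (Real.pi * u) * h (simVar s α u * zolotarev α θ)) =
      Real.pi⁻¹ * ∫ t in Ioi 0, h t / t := by
    intro θ hθ
    rw [← (scale_integral (h := h) hs hα0 hα1 (zolotarev_pos hα0 hα1 hθ)).2,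
        ← integral_const_mul]
    refine setIntegral_congr_fun measurableSet_Ioi fun u _ => ?_
    field_simp
  rw [setIntegral_congr_fun measurableSet_Ioo hconst, setIntegral_const]
  simp [hpi.le]

lemma abs_stableKernel_le (hα0 : 0 < α) (hα1 : α < 1) {u : ℝ} (hu : 0 < u) :
    |stableKernel h α s u| ≤ stableKernel (fun t => |h t|) α s u := by
  have : 0 < α / (1 - α) := div_pos hα0 (sub_pos.2 hα1)
  have hpi := Real.pi_pos
  rw [stableKernel, stableKernel, abs_mul, abs_of_pos (by positivity)]
  gcongr
  exact abs_integral_le_integral_abs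

lemma integral_abs_stableKernel_le (hs : 0 < s) (hα0 : 0 < α) (hα1 : α < 1) (hm : Measurable h)
    (hi : IntegrableOn (fun t => h t / t) (Ioi 0)) :
    ∫ u in Ioi 0, |stableKernel h α s u| ≤ ∫ t in Ioi 0, |h t| / t := by
  have hi' : IntegrableOn (fun t => |h t| / t) (Ioi 0) := by
    refine (integrableOn_congr_fun (fun t ht => ?_) measurableSet_Ioi).1 hi.abs
    have ht : 0 < t := ht
    simp only [abs_div, abs_of_pos ht]
  rw [← integral_stableKernel hs hα0 hα1 hm.abs hi']
  exact setIntegral_mono_on (integrableOn_stableKernel hs hα0 hα1 hm hi).abs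
    (integrableOn_stableKernel hs hα0 hα1 hm.abs hi') measurableSet_Ioi
    fun u hu => abs_stableKernel_le hα0 hα1 hu

lemma integrableOn_profile (hα0 : 0 < α) (hα1 : α < 1) (hm : Measurable h) {C : ℝ}
    (hC : ∀ t, 0 < t → |h t| ≤ C) {x : ℝ} (hx : 0 < x) :
    IntegrableOn (fun θ => h (x * zolotarev α θ)) (Ioo 0 Real.pi) := by
  have hA := measurable_zolotarev α
  refine Measure.integrableOn_of_bounded (M := C) (by simp)
    (hm.comp (hA.const_mul x)).aestronglyMeasurable ?_
  filter_upwards [ae_restrict_mem measurableSet_Ioo] with θ hθ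
  exact hC _ (mul_pos hx (zolotarev_pos hα0 hα1 hθ))

end kernel

/-! ### The stable density and its derivative in the time parameter -/

/-- The profile `t e^{-t}` of the stable density. -/
def profile (t : ℝ) : ℝ := t * Real.exp (-t)

/-- The profile `t (t e^{-t})'` of the derivative of the stable density. -/
def profileDeriv (t : ℝ) : ℝ := (1 - t) * (t * Real.exp (-t))

lemma pow_mul_exp_neg_le (n : ℕ) {t : ℝ} (ht : 0 ≤ t) : t ^ n * Real.exp (-t) ≤ n.factorial := by
  have h1 := Real.pow_div_factorial_le_exp t ht n
  have h2 : Real.exp t * Real.exp (-t) = 1 := by rw [← Real.exp_add]; simp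
  have h3 : (0 : ℝ) < n.factorial := by exact_mod_cast n.factorial_pos
  rw [div_le_iff₀ h3] at h1
  calc t ^ n * Real.exp (-t) ≤ Real.exp t * n.factorial * Real.exp (-t) := by gcongr
    _ = n.factorial := by rw [mul_right_comm, h2, one_mul]

lemma measurable_profile : Measurable profile := by unfold profile; fun_prop

lemma measurable_profileDeriv : Measurable profileDeriv := by unfold profileDeriv; fun_prop

lemma abs_profile_le {t : ℝ} (ht : 0 < t) : |profile t| ≤ 1 := by
  rw [profile, abs_of_nonneg (by positivity)]; exact mul_exp_neg_le_one

lemma abs_profileDeriv_le {t : ℝ} (ht : 0 < t) : |profileDeriv t| ≤ 3 := by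
  have h1 := pow_mul_exp_neg_le 1 ht.le
  have h2 := pow_mul_exp_neg_le 2 ht.le
  have h3 := Real.exp_pos (-t)
  simp only [pow_one, Nat.factorial_one, Nat.cast_one, Nat.factorial_two, Nat.cast_ofNat] at h1 h2
  have h4 : 0 < t * Real.exp (-t) := by positivity
  have h5 : 0 < t ^ 2 * Real.exp (-t) := by positivity
  have h6 : profileDeriv t = t * Real.exp (-t) - t ^ 2 * Real.exp (-t) := by
    unfold profileDeriv; ring
  rw [h6, abs_le]; constructor <;> linarith

lemma integrableOn_poly_exp (n : ℕ) {b : ℝ} (hb : 0 < b) :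
    IntegrableOn (fun t : ℝ => t ^ n * Real.exp (-b * t)) (Ioi 0) := by
  have := integrableOn_rpow_mul_exp_neg_mul_rpow (s := n) (p := 1) (b := b)
    (by have := n.cast_nonneg (α := ℝ); linarith) one_pos hb
  simpa using this

lemma profile_div {t : ℝ} (ht : t ∈ Ioi (0 : ℝ)) : profile t / t = Real.exp (-t) := by
  have : t ≠ 0 := ne_of_gt ht
  unfold profile; field_simp

lemma profileDeriv_div {t : ℝ} (ht : t ∈ Ioi (0 : ℝ)) :
    profileDeriv t / t = (1 - t) * Real.exp (-t) := by
  have : t ≠ 0 := ne_of_gt ht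
  unfold profileDeriv; field_simp

lemma integrableOn_profile_div : IntegrableOn (fun t => profile t / t) (Ioi 0) := by
  refine (integrableOn_congr_fun (fun t ht => profile_div ht) measurableSet_Ioi).2 ?_
  simpa using integrableOn_poly_exp 0 one_pos

lemma integrableOn_profileDeriv_div : IntegrableOn (fun t => profileDeriv t / t) (Ioi 0) := by
  refine (integrableOn_congr_fun (fun t ht => profileDeriv_div ht) measurableSet_Ioi).2 ?_
  refine ((integrableOn_poly_exp 0 one_pos).sub (integrableOn_poly_exp 1 one_pos)).congr
    (ae_of_all _ fun t => ?_)
  simp only [Pi.sub_apply, pow_zero, pow_one, neg_one_mul]; ring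

section density

variable {α s : ℝ}

lemma phi_eq_stableKernel (hs : 0 < s) (hα0 : 0 < α) (hα1 : α < 1) {u : ℝ} (hu : 0 < u) :
    phi s α u = stableKernel profile α s u :=
  phi_eq hs hα0 hα1 hu

lemma integrableOn_phi (hs : 0 < s) (hα0 : 0 < α) (hα1 : α < 1) :
    IntegrableOn (phi s α) (Ioi 0) :=
  (integrableOn_congr_fun (fun _ hu => phi_eq_stableKernel hs hα0 hα1 hu) measurableSet_Ioi).2
    (integrableOn_stableKernel hs hα0 hα1 measurable_profile integrableOn_profile_div)

lemma integral_phi (hs : 0 < s) (hα0 : 0 < α) (hα1 : α < 1) : ∫ u in Ioi 0, phi s α u = 1 := by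
  rw [setIntegral_congr_fun measurableSet_Ioi fun _ hu => phi_eq_stableKernel hs hα0 hα1 hu,
    integral_stableKernel hs hα0 hα1 measurable_profile integrableOn_profile_div,
    setIntegral_congr_fun measurableSet_Ioi fun t ht => profile_div ht]
  exact integral_exp_neg_Ioi_zero

lemma phi_pos (hs : 0 < s) (hα0 : 0 < α) (hα1 : α < 1) {u : ℝ} (hu : 0 < u) :
    0 < phi s α u := by
  have hx := simVar_pos (α := α) hs hu
  have hpi := Real.pi_pos
  have hγ : 0 < α / (1 - α) := div_pos hα0 (sub_pos.2 hα1)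
  rw [phi_eq hs hα0 hα1 hu]
  refine mul_pos (by positivity) ?_
  have hpos : ∀ θ ∈ Ioo 0 Real.pi, 0 < simVar s α u * zolotarev α θ *
      Real.exp (-(simVar s α u * zolotarev α θ)) := fun θ hθ => by
    have := zolotarev_pos hα0 hα1 hθ
    positivity
  rw [setIntegral_pos_iff_support_of_nonneg_ae
    ((ae_restrict_mem measurableSet_Ioo).mono fun θ hθ => (hpos θ hθ).le)
    (integrableOn_zolotarev hα0 hα1 hx.le)]
  refine lt_of_lt_of_le (b := volume (Ioo 0 Real.pi)) (by simp [hpi]) (measure_mono fun θ hθ => ?_)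
  exact ⟨(hpos θ hθ).ne', hθ⟩

lemma simVar_mul {s' : ℝ} (hs : 0 < s) (hs' : 0 < s') (hα1 : α < 1) {u : ℝ} (hu : 0 < u) :
    simVar s' α u = (s' / s) ^ (1 / (1 - α)) * simVar s α u := by
  have h1 : 1 / (1 - α) = 1 + α / (1 - α) := by
    have : 1 - α ≠ 0 := by linarith
    field_simp; ring
  rw [h1, Real.rpow_add (by positivity), Real.rpow_one, simVar_eq hs hu, simVar_eq hs' hu,
    Real.div_rpow hs'.le hs.le]
  have : s ^ (α / (1 - α)) ≠ 0 := (Real.rpow_pos_of_pos hs _).ne'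
  field_simp

/-- Self-similarity of the stable density. -/
lemma phi_scaling (hs : 0 < s) (hα0 : 0 < α) (hα1 : α < 1) {v : ℝ} (hv : 0 < v) :
    s ^ (1 / α) * phi s α (s ^ (1 / α) * v) = phi 1 α v := by
  have hr : 0 < s ^ (1 / α) := Real.rpow_pos_of_pos hs _
  have hx : simVar s α (s ^ (1 / α) * v) = simVar 1 α v := by
    rw [simVar_eq hs (mul_pos hr hv), simVar_eq one_pos hv, Real.mul_rpow hr.le hv.le,
      ← Real.rpow_mul hs.le, Real.one_rpow, one_mul, one_mul]
    have h4 : s * s ^ (α / (1 - α)) * s ^ (1 / α * -(α / (1 - α))) = 1 := by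
      nth_rewrite 1 [← Real.rpow_one s]
      rw [← Real.rpow_add hs, ← Real.rpow_add hs]
      have : 1 - α ≠ 0 := by linarith
      have h5 : 1 + α / (1 - α) + 1 / α * -(α / (1 - α)) = 0 := by field_simp; ring
      rw [h5, Real.rpow_zero]
    linear_combination v ^ (-(α / (1 - α))) * h4
  rw [phi_eq hs hα0 hα1 (mul_pos hr hv), phi_eq one_pos hα0 hα1 hv, hx]
  field_simp

/-- The integral over `t > 0` of a function which, times `(κ - 1)²`, bounds the remainder of the first
order Taylor expansion of `κ ↦ κ e^{-κ t}` at `κ = 1`. -/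
def taylorConst : ℝ := ∫ t in Ioi (0 : ℝ), (2 * t ^ 2 + t) * Real.exp (-(1 / 2) * t)

lemma integrableOn_taylor :
    IntegrableOn (fun t : ℝ => (2 * t ^ 2 + t) * Real.exp (-(1 / 2) * t)) (Ioi 0) := by
  refine (((integrableOn_poly_exp 2 (b := 1 / 2) (by norm_num)).const_mul 2).add
    (integrableOn_poly_exp 1 (b := 1 / 2) (by norm_num))).congr (ae_of_all _ fun t => ?_)
  simp only [Pi.add_apply, pow_one]; ring

lemma abs_taylor_le {κ t : ℝ} (hκ : |κ - 1| ≤ 1 / 2) (ht : 0 < t) :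
    |(profile (κ * t) - profile t - (κ - 1) * profileDeriv t) / t| ≤
      (κ - 1) ^ 2 * ((2 * t ^ 2 + t) * Real.exp (-(1 / 2) * t)) := by
  set δ := κ - 1 with hδ
  have hκδ : κ = 1 + δ := by rw [hδ]; ring
  have e1 : (profile (κ * t) - profile t - δ * profileDeriv t) / t =
      Real.exp (-t) * ((1 + δ) * (Real.exp (-(δ * t)) - 1 + δ * t) - δ ^ 2 * t) := by
    rw [profile, profile, profileDeriv, hκδ,
      show -((1 + δ) * t) = -t + -(δ * t) by ring, Real.exp_add]
    field_simp
    ring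
  have e2 : |Real.exp (-(δ * t)) - 1 + δ * t| ≤ (δ * t) ^ 2 * Real.exp (t / 2) := by
    have h1 := Complex.norm_exp_sub_sum_le_norm_mul_exp ((-(δ * t) : ℝ) : ℂ) 2
    rw [Finset.sum_range_succ, Finset.sum_range_one, ← Complex.ofReal_exp] at h1
    have h2 : ((Real.exp (-(δ * t)) : ℝ) : ℂ) - (((-(δ * t) : ℝ) : ℂ) ^ 0 / (Nat.factorial 0 : ℕ) +
        ((-(δ * t) : ℝ) : ℂ) ^ 1 / (Nat.factorial 1 : ℕ)) =
        ((Real.exp (-(δ * t)) - 1 + δ * t : ℝ) : ℂ) := by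
      push_cast; simp; ring
    rw [h2, Complex.norm_real, Complex.norm_real, Real.norm_eq_abs, Real.norm_eq_abs, abs_neg,
      sq_abs] at h1
    refine h1.trans ?_
    gcongr
    rw [abs_mul, abs_of_pos ht]
    nlinarith
  have e3 : |1 + δ| ≤ 2 := by
    rw [abs_le] at hκ ⊢; constructor <;> linarith
  have e4 : Real.exp (-t) * Real.exp (t / 2) = Real.exp (-(1 / 2) * t) := by
    rw [← Real.exp_add]; ring_nf
  have e5 : Real.exp (-t) ≤ Real.exp (-(1 / 2) * t) := Real.exp_le_exp.2 (by linarith)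
  rw [e1, abs_mul, abs_of_pos (Real.exp_pos _)]
  calc Real.exp (-t) * |(1 + δ) * (Real.exp (-(δ * t)) - 1 + δ * t) - δ ^ 2 * t|
      ≤ Real.exp (-t) * (2 * ((δ * t) ^ 2 * Real.exp (t / 2)) + δ ^ 2 * t) := by
        gcongr
        refine (abs_sub _ _).trans ?_
        rw [abs_mul, abs_of_nonneg (by positivity : 0 ≤ δ ^ 2 * t)]
        gcongr
    _ = δ ^ 2 * (2 * t ^ 2) * (Real.exp (-t) * Real.exp (t / 2)) + δ ^ 2 * t * Real.exp (-t) := by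
        ring
    _ ≤ δ ^ 2 * (2 * t ^ 2) * Real.exp (-(1 / 2) * t) + δ ^ 2 * t * Real.exp (-(1 / 2) * t) := by
        rw [e4]; gcongr
    _ = _ := by ring

/-- First order Taylor expansion of the stable density in `L^1`, in the variable
`κ = (s' / s)^{1/(1-α)}`. -/
lemma integral_abs_phi_sub_le (hs : 0 < s) (hα0 : 0 < α) (hα1 : α < 1) {s' κ : ℝ} (hs' : 0 < s')
    (hκ : κ = (s' / s) ^ (1 / (1 - α))) (hκ1 : |κ - 1| ≤ 1 / 2) :
    ∫ u in Ioi 0, |phi s' α u - phi s α u - (κ - 1) * stableKernel profileDeriv α s u| ≤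
      (κ - 1) ^ 2 * taylorConst := by
  have hκ0 : 0 < κ := by rw [hκ]; positivity
  set h : ℝ → ℝ := fun t => profile (κ * t) - profile t - (κ - 1) * profileDeriv t with hh
  have hm : Measurable h := by
    have := measurable_profile
    have := measurable_profileDeriv
    have : Measurable fun t => profile (κ * t) := measurable_profile.comp (measurable_const_mul κ)
    fun_prop
  have hmaj := integrableOn_taylor.const_mul ((κ - 1) ^ 2)
  have hi : IntegrableOn (fun t => h t / t) (Ioi 0) := by
    refine hmaj.mono' (hm.div measurable_id).aestronglyMeasurable ?_
    filter_upwards [ae_restrict_mem measurableSet_Ioi] with t ht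
    exact abs_taylor_le hκ1 ht
  have hker : EqOn (fun u => |phi s' α u - phi s α u -
      (κ - 1) * stableKernel profileDeriv α s u|) (fun u => |stableKernel h α s u|) (Ioi 0) := by
    intro u hu
    have hu : 0 < u := hu
    have hx := simVar_pos (α := α) hs hu
    have i1 := integrableOn_profile hα0 hα1 measurable_profile
      (fun t ht => abs_profile_le ht) (mul_pos hκ0 hx)
    have i2 := integrableOn_profile hα0 hα1 measurable_profile
      (fun t ht => abs_profile_le ht) hx
    have i3 := integrableOn_profile hα0 hα1 measurable_profileDeriv
      (fun t ht => abs_profileDeriv_le ht) hx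
    simp only
    rw [phi_eq_stableKernel hs' hα0 hα1 hu, phi_eq_stableKernel hs hα0 hα1 hu]
    simp only [stableKernel, hh]
    rw [simVar_mul hs hs' hα1 hu, ← hκ]
    have i12 := Integrable.sub i1 i2
    have e1 := integral_sub i12 (i3.const_mul (κ - 1))
    have e2 := integral_sub i1 i2
    simp only [Pi.sub_apply] at e1
    simp only [mul_assoc] at e1 e2 ⊢
    rw [e1, e2, integral_const_mul]
    congr 1; ring
  rw [setIntegral_congr_fun measurableSet_Ioi hker]
  refine (integral_abs_stableKernel_le hs hα0 hα1 hm hi).trans ?_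
  rw [taylorConst, ← integral_const_mul]
  have hi' : IntegrableOn (fun t => |h t| / t) (Ioi 0) := by
    refine (integrableOn_congr_fun (fun t ht => ?_) measurableSet_Ioi).1 hi.abs
    have ht : 0 < t := ht
    simp only [abs_div, abs_of_pos ht]
  refine setIntegral_mono_on hi' hmaj measurableSet_Ioi fun t ht => ?_
  have := abs_taylor_le hκ1 ht
  rwa [abs_div, abs_of_pos (show (0 : ℝ) < t from ht)] at this

/-- The profile `(1 - t)² t e^{-t}` of the Fisher information of the exponential law. -/
def profileFisher (t : ℝ) : ℝ := (1 - t) ^ 2 * (t * Real.exp (-t))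

lemma integral_profileFisher :
    IntegrableOn (fun t => profileFisher t / t) (Ioi 0) ∧
      ∫ t in Ioi 0, profileFisher t / t = 1 := by
  have hc : EqOn (fun t => profileFisher t / t) (fun t => (1 - t) ^ 2 * Real.exp (-t))
      (Ioi 0) := by
    intro t ht
    have : t ≠ 0 := ne_of_gt ht
    simp only [profileFisher]; field_simp
  have hd : ∀ t ∈ Ici (0 : ℝ), HasDerivAt (fun t : ℝ => -((1 + t ^ 2) * Real.exp (-t)))
      ((1 - t) ^ 2 * Real.exp (-t)) t := by
    intro t _
    have h1 : HasDerivAt (fun t : ℝ => 1 + t ^ 2) (2 * t) t := by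
      simpa using (hasDerivAt_pow 2 t).const_add 1
    have h2 : HasDerivAt (fun t : ℝ => Real.exp (-t)) (-Real.exp (-t)) t := by
      simpa using (hasDerivAt_neg t).exp
    refine (h1.mul h2).neg.congr_deriv ?_
    ring
  have hl : Tendsto (fun t : ℝ => -((1 + t ^ 2) * Real.exp (-t))) atTop (𝓝 0) := by
    have h1 := Real.tendsto_pow_mul_exp_neg_atTop_nhds_zero 0
    have h2 := Real.tendsto_pow_mul_exp_neg_atTop_nhds_zero 2
    have h3 := (h1.add h2).neg
    simp only [add_zero, neg_zero] at h3
    refine h3.congr fun t => ?_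
    ring
  have hn : ∀ t ∈ Ioi (0 : ℝ), 0 ≤ (1 - t) ^ 2 * Real.exp (-t) := fun t _ => by positivity
  rw [integrableOn_congr_fun hc measurableSet_Ioi, setIntegral_congr_fun measurableSet_Ioi hc]
  refine ⟨integrableOn_Ioi_deriv_of_nonneg' hd hn hl, ?_⟩
  rw [integral_Ioi_of_hasDerivAt_of_nonneg' hd hn hl]
  simp

lemma abs_profileFisher_le {t : ℝ} (ht : 0 < t) : |profileFisher t| ≤ 11 := by
  have h1 := pow_mul_exp_neg_le 1 ht.le
  have h2 := pow_mul_exp_neg_le 2 ht.le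
  have h3 := pow_mul_exp_neg_le 3 ht.le
  simp only [pow_one, Nat.factorial, Nat.cast_one, mul_one] at h1 h2 h3
  norm_num at h2 h3
  have h5 : 0 < t ^ 2 * Real.exp (-t) := by positivity
  have h6 : profileFisher t =
      t * Real.exp (-t) - 2 * (t ^ 2 * Real.exp (-t)) + t ^ 3 * Real.exp (-t) := by
    unfold profileFisher; ring
  rw [abs_of_nonneg (by unfold profileFisher; positivity), h6]
  linarith

/-- The Fisher information bound `∫ ψ² / φ ≤ 1`, where `ψ` is the derivative of the stable density
in the logarithm of the similarity variable: pointwise in `u` it is the Cauchy–Schwarz inequality in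
the angle, which reduces the bound to the exponential law. -/
lemma fisher_bound (hs : 0 < s) (hα0 : 0 < α) (hα1 : α < 1) :
    IntegrableOn (fun u => stableKernel profileDeriv α s u ^ 2 / phi s α u) (Ioi 0) ∧
      ∫ u in Ioi 0, stableKernel profileDeriv α s u ^ 2 / phi s α u ≤ 1 := by
  have hmF : Measurable profileFisher := by unfold profileFisher; fun_prop
  have hpi := Real.pi_pos
  have hγ : 0 < α / (1 - α) := div_pos hα0 (sub_pos.2 hα1)
  obtain ⟨hFi, hF1⟩ := integral_profileFisher
  have hpt : ∀ u ∈ Ioi (0 : ℝ), stableKernel profileDeriv α s u ^ 2 / phi s α u ≤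
      stableKernel profileFisher α s u := by
    intro u hu
    have hu : 0 < u := hu
    have hx := simVar_pos (α := α) hs hu
    have hφ := phi_pos hs hα0 hα1 hu
    rw [phi_eq_stableKernel hs hα0 hα1 hu] at hφ ⊢
    have i1 := integrableOn_profile hα0 hα1 measurable_profile (fun t ht => abs_profile_le ht) hx
    have i2 := integrableOn_profile hα0 hα1 measurable_profileDeriv
      (fun t ht => abs_profileDeriv_le ht) hx
    have i3 := integrableOn_profile hα0 hα1 hmF (fun t ht => abs_profileFisher_le ht) hx
    set c := α / (1 - α) / (Real.pi * u) with hc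
    have hc0 : 0 < c := by positivity
    simp only [stableKernel] at hφ ⊢
    rw [← hc] at hφ ⊢
    set a := ∫ θ in Ioo 0 Real.pi, profile (simVar s α u * zolotarev α θ) with ha
    set b := ∫ θ in Ioo 0 Real.pi, profileDeriv (simVar s α u * zolotarev α θ) with hb
    set d := ∫ θ in Ioo 0 Real.pi, profileFisher (simVar s α u * zolotarev α θ) with hd
    have ha0 : 0 < a := pos_of_mul_pos_right hφ hc0.le
    have hq : 0 ≤ (b / a) ^ 2 * a - 2 * (b / a) * b + d := by
      have e1 := integral_sub (i1.const_mul ((b / a) ^ 2)) (i2.const_mul (2 * (b / a)))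
      have e2 := integral_add (Integrable.sub (i1.const_mul ((b / a) ^ 2))
        (i2.const_mul (2 * (b / a)))) i3
      simp only [Pi.sub_apply] at e2
      rw [e1, integral_const_mul, integral_const_mul, ← ha, ← hb, ← hd] at e2
      rw [← e2]
      refine setIntegral_nonneg measurableSet_Ioo fun θ hθ => ?_
      have := mul_pos hx (zolotarev_pos hα0 hα1 hθ)
      set t := simVar s α u * zolotarev α θ
      have e3 : (b / a) ^ 2 * profile t - 2 * (b / a) * profileDeriv t + profileFisher t =
          (b / a - (1 - t)) ^ 2 * (t * Real.exp (-t)) := by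
        unfold profile profileDeriv profileFisher; ring
      rw [e3]; positivity
    have hbd : b ^ 2 / a ≤ d := by
      have : (b / a) ^ 2 * a - 2 * (b / a) * b + d = d - b ^ 2 / a := by field_simp; ring
      linarith
    calc (c * b) ^ 2 / (c * a) = c * (b ^ 2 / a) := by field_simp
      _ ≤ c * d := by gcongr
  have hK := integrableOn_stableKernel hs hα0 hα1 hmF hFi
  have hint : IntegrableOn (fun u => stableKernel profileDeriv α s u ^ 2 / phi s α u) (Ioi 0) := by
    refine Integrable.mono' hK ?_ ?_
    · have m1 := (integrableOn_stableKernel hs hα0 hα1 measurable_profileDeriv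
        integrableOn_profileDeriv_div).aestronglyMeasurable.aemeasurable
      have m2 := (integrableOn_phi hs hα0 hα1).aestronglyMeasurable.aemeasurable
      exact ((m1.pow_const 2).div m2).aestronglyMeasurable
    · filter_upwards [ae_restrict_mem measurableSet_Ioi] with u hu
      rw [Real.norm_of_nonneg (div_nonneg (sq_nonneg _) (phi_pos hs hα0 hα1 hu).le)]
      exact hpt u hu
  refine ⟨hint, ?_⟩
  rw [← hF1, ← integral_stableKernel hs hα0 hα1 hmF hFi]
  exact setIntegral_mono_on hint hK measurableSet_Ioi hpt

end density

/-! ### The convolution semigroup of stable densities -/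

section semigroup

variable {α s t : ℝ}

lemma integral_bromwich (hs : 0 < s) (hα0 : 0 < α) (hα1 : α < 1) (u : ℝ) :
    ∫ y, bromwich s α u y = ((2 * Real.pi * phi s α u : ℝ) : ℂ) := by
  have hpi := Real.pi_pos
  obtain ⟨G, hG, hG0⟩ := exists_primitive s α u
  obtain ⟨L, -, hI⟩ := tendsto_primitive_line hs hα0 hα1 hG hG0
  have hphi : phi s α u = 1 / (2 * Real.pi) * (∫ y, bromwich s α u y).re := rfl
  rw [hphi, hI, Complex.ofReal_re]
  congr 1
  field_simp

lemma phi_of_nonpos (hs : 0 < s) (hα0 : 0 < α) (hα1 : α < 1) {u : ℝ} (hu : u ≤ 0) :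
    phi s α u = 0 := by
  have hphi : phi s α u = 1 / (2 * Real.pi) * (∫ y, bromwich s α u y).re := rfl
  rw [hphi, integral_bromwich_of_nonpos hs hα0 hα1 hu]; simp

/-- The exponentially tilted stable density `e^{-u} φ_{s,α}(u)`. The tilt moves the line of integration
`Re z = 1` to the imaginary axis, which turns Laplace inversion into Fourier inversion. -/
def tilted (s α u : ℝ) : ℝ := Real.exp (-u) * phi s α u

lemma tilted_nonneg (hs : 0 < s) (hα0 : 0 < α) (hα1 : α < 1) (u : ℝ) : 0 ≤ tilted s α u := by
  rcases le_or_gt u 0 with hu | hu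
  · rw [tilted, phi_of_nonpos hs hα0 hα1 hu, mul_zero]
  · exact mul_nonneg (Real.exp_pos _).le (phi_pos hs hα0 hα1 hu).le

lemma integrable_tilted (hs : 0 < s) (hα0 : 0 < α) (hα1 : α < 1) : Integrable (tilted s α) := by
  have h1 : IntegrableOn (tilted s α) (Ioi 0) := by
    refine (integrableOn_phi hs hα0 hα1).mono' ?_ ?_
    · exact (by fun_prop : Measurable fun u : ℝ => Real.exp (-u)).aestronglyMeasurable.mul
        (integrableOn_phi hs hα0 hα1).aestronglyMeasurable
    · filter_upwards [ae_restrict_mem measurableSet_Ioi] with u hu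
      have hu : 0 < u := hu
      rw [Real.norm_of_nonneg (tilted_nonneg hs hα0 hα1 u), tilted]
      exact mul_le_of_le_one_left (phi_pos hs hα0 hα1 hu).le (Real.exp_le_one_iff.2 (by linarith))
  rw [← integrable_indicator_iff measurableSet_Ioi] at h1
  refine h1.congr (ae_of_all _ fun u => ?_)
  by_cases hu : u ∈ Ioi 0
  · simp [hu]
  · rw [indicator_of_notMem hu, tilted, phi_of_nonpos hs hα0 hα1 (not_lt.1 hu), mul_zero]

/-- The Fourier transform of the tilted density, by Fourier inversion of the Bromwich integral. -/
lemma integral_tilted_mul_exp (hs : 0 < s) (hα0 : 0 < α) (hα1 : α < 1) (w : ℝ) :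
    ∫ u, Complex.exp ((-(u * w) : ℝ) * Complex.I) * (tilted s α u : ℂ) = bromwich s α 0 w := by
  have hpi := Real.pi_pos
  set f : ℝ → ℂ := bromwich s α 0 with hf
  have hinv : ∀ v : ℝ, FourierTransformInv.fourierInv f v =
      ((2 * Real.pi * tilted s α (2 * Real.pi * v) : ℝ) : ℂ) := by
    intro v
    rw [Real.fourierInv_eq']
    have h1 : ∀ y : ℝ, Complex.exp (((2 * Real.pi * inner ℝ y v : ℝ) : ℂ) * Complex.I) • f y =
        (Real.exp (-(2 * Real.pi * v)) : ℂ) * bromwich s α (2 * Real.pi * v) y := by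
      intro y
      simp only [hf, bromwich, smul_eq_mul, Complex.ofReal_exp, ← mul_assoc]
      simp only [← Complex.exp_add]
      congr 1
      simp only [RCLike.inner_apply, conj_trivial]
      push_cast; ring
    simp only [h1]
    rw [integral_const_mul, integral_bromwich hs hα0 hα1, tilted]
    push_cast; ring
  have hfc : Continuous f := continuous_bromwich s α 0
  have hfi : Integrable f := integrable_bromwich hs hα0 hα1 0
  have hFi : Integrable (FourierTransform.fourier f) := by
    have h1 : Integrable fun v : ℝ => ((2 * Real.pi * tilted s α (2 * Real.pi * v) : ℝ) : ℂ) :=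
      (((integrable_tilted hs hα0 hα1).comp_mul_left'
        (by positivity : 2 * Real.pi ≠ 0)).const_mul _).ofReal
    refine h1.comp_neg.congr (ae_of_all _ fun v => ?_)
    simp only
    rw [← hinv, Real.fourierInv_eq_fourier_neg, neg_neg]
  have key := congrFun (hfc.fourier_fourierInv_eq hfi hFi) w
  rw [← key, Real.fourier_real_eq_integral_exp_smul]
  simp only [hinv, smul_eq_mul]
  have h2 := Measure.integral_comp_mul_left
    (fun u : ℝ => Complex.exp ((-(u * w) : ℝ) * Complex.I) * (tilted s α u : ℂ)) (2 * Real.pi)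
  have h3 : ∀ v : ℝ, Complex.exp (((-2 * Real.pi * v * w : ℝ) : ℂ) * Complex.I) *
      ((2 * Real.pi * tilted s α (2 * Real.pi * v) : ℝ) : ℂ) =
      ((2 * Real.pi : ℝ) : ℂ) * (Complex.exp (((-(2 * Real.pi * v * w) : ℝ) : ℂ) * Complex.I) *
        (tilted s α (2 * Real.pi * v) : ℂ)) := by
    intro v
    rw [show -2 * Real.pi * v * w = -(2 * Real.pi * v * w) by ring]
    push_cast; ring
  simp only [h3]
  rw [integral_const_mul, h2, abs_of_pos (by positivity), Complex.real_smul, ← mul_assoc,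
    ← Complex.ofReal_mul, mul_inv_cancel₀ (by positivity : 2 * Real.pi ≠ 0), Complex.ofReal_one,
    one_mul]

/-- The finite measure with the tilted stable density. -/
def tiltedMeasure (s α : ℝ) : Measure ℝ :=
  (volume : Measure ℝ).withDensity fun u => ENNReal.ofReal (tilted s α u)

lemma isFiniteMeasure_tiltedMeasure (hs : 0 < s) (hα0 : 0 < α) (hα1 : α < 1) :
    IsFiniteMeasure (tiltedMeasure s α) :=
  isFiniteMeasure_withDensity_ofReal (integrable_tilted hs hα0 hα1).2

lemma integral_tiltedMeasure (hs : 0 < s) (hα0 : 0 < α) (hα1 : α < 1) (g : ℝ → ℂ) :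
    ∫ u, g u ∂(tiltedMeasure s α) = ∫ u, (tilted s α u : ℂ) * g u := by
  have hm : AEMeasurable (fun u => (tilted s α u).toNNReal) volume :=
    (integrable_tilted hs hα0 hα1).aestronglyMeasurable.aemeasurable.real_toNNReal
  have h1 := integral_withDensity_eq_integral_smul₀ hm g
  rw [tiltedMeasure]
  refine h1.trans (integral_congr_ae (ae_of_all _ fun u => ?_))
  simp only [NNReal.smul_def, Real.coe_toNNReal _ (tilted_nonneg hs hα0 hα1 u), Complex.real_smul]

lemma tiltedMeasure_conv (hs : 0 < s) (ht : 0 < t) (hα0 : 0 < α) (hα1 : α < 1) :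
    Measure.conv (tiltedMeasure s α) (tiltedMeasure t α) = tiltedMeasure (s + t) α := by
  have hst : 0 < s + t := by positivity
  have := isFiniteMeasure_tiltedMeasure hs hα0 hα1
  have := isFiniteMeasure_tiltedMeasure ht hα0 hα1
  have := isFiniteMeasure_tiltedMeasure hst hα0 hα1
  have hchar : ∀ r : ℝ, 0 < r → ∀ y, charFun (tiltedMeasure r α) y = bromwich r α 0 (-y) := by
    intro r hr y
    rw [charFun_apply_real, integral_tiltedMeasure hr hα0 hα1,
      ← integral_tilted_mul_exp hr hα0 hα1]
    refine integral_congr_ae (ae_of_all _ fun u => ?_)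
    simp only
    rw [mul_comm]
    congr 3
    push_cast; ring
  refine Measure.ext_of_charFun ?_
  funext y
  rw [charFun_conv, hchar s hs, hchar t ht, hchar (s + t) hst]
  simp only [bromwich, Complex.ofReal_zero, mul_zero, Complex.exp_zero, one_mul]
  rw [← Complex.exp_add]
  congr 1
  push_cast; ring

lemma integral_tilted_mul (hs : 0 < s) (hα0 : 0 < α) (hα1 : α < 1) (g : ℝ → ℂ) :
    ∫ u, (tilted s α u : ℂ) * (Complex.exp u * g u) = ∫ u in Ioi 0, (phi s α u : ℂ) * g u := by
  rw [← integral_indicator measurableSet_Ioi]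
  refine integral_congr_ae (ae_of_all _ fun u => ?_)
  by_cases hu : u ∈ Ioi 0
  · have h1 : Complex.exp (-u) * Complex.exp u = 1 := by rw [← Complex.exp_add]; simp
    simp only [indicator_of_mem hu, tilted]
    push_cast
    linear_combination (phi s α u : ℂ) * g u * h1
  · simp only [indicator_of_notMem hu, tilted, phi_of_nonpos hs hα0 hα1 (not_lt.1 hu)]
    simp

/-- The semigroup law `φ_{s,α} * φ_{t,α} = φ_{s+t,α}`. -/
lemma integral_phi_conv (hs : 0 < s) (ht : 0 < t) (hα0 : 0 < α) (hα1 : α < 1) {m : ℝ → ℂ}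
    (hm : Measurable m) {C : ℝ} (hC : ∀ u, ‖m u‖ ≤ C) :
    ∫ u in Ioi 0, (phi s α u : ℂ) * ∫ v in Ioi 0, (phi t α v : ℂ) * m (u + v) =
      ∫ w in Ioi 0, (phi (s + t) α w : ℂ) * m w := by
  have hst : 0 < s + t := by positivity
  have := isFiniteMeasure_tiltedMeasure hs hα0 hα1
  have := isFiniteMeasure_tiltedMeasure ht hα0 hα1
  set g : ℝ → ℂ := fun w => Complex.exp w * m w with hg
  have hgm : Measurable g := by fun_prop
  have hgi : Integrable g (tiltedMeasure (s + t) α) := by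
    have hmeas : AEMeasurable (fun u => ENNReal.ofReal (tilted (s + t) α u)) volume :=
      (integrable_tilted hst hα0 hα1).aestronglyMeasurable.aemeasurable.ennreal_ofReal
    rw [tiltedMeasure, integrable_withDensity_iff_integrable_smul₀' hmeas (by simp)]
    have h1 : Integrable ((Ioi (0 : ℝ)).indicator fun w => (phi (s + t) α w : ℂ) * m w) := by
      rw [integrable_indicator_iff measurableSet_Ioi]
      exact Integrable.mul_bdd (c := C) (integrableOn_phi hst hα0 hα1).ofReal hm.aestronglyMeasurable
        (ae_of_all _ hC)
    refine h1.congr (ae_of_all _ fun w => ?_)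
    simp only
    rw [ENNReal.toReal_ofReal (tilted_nonneg hst hα0 hα1 w), Complex.real_smul]
    by_cases hw : w ∈ Ioi 0
    · have h1 : Complex.exp (-w) * Complex.exp w = 1 := by rw [← Complex.exp_add]; simp
      simp only [indicator_of_mem hw, tilted, hg]
      push_cast
      linear_combination -(phi (s + t) α w : ℂ) * m w * h1
    · simp only [indicator_of_notMem hw, tilted, phi_of_nonpos hst hα0 hα1 (not_lt.1 hw)]
      simp
  have hconv := tiltedMeasure_conv hs ht hα0 hα1
  have hgi' := hgi
  rw [← hconv, Measure.conv] at hgi'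
  have hadd : Measurable fun x : ℝ × ℝ => x.1 + x.2 := by fun_prop
  have e1 := integral_map hadd.aemeasurable hgi'.aestronglyMeasurable
  have e2 := integral_prod _ ((integrable_map_measure hgi'.aestronglyMeasurable
    hadd.aemeasurable).1 hgi')
  rw [← integral_tilted_mul hst hα0 hα1, ← integral_tiltedMeasure hst hα0 hα1, ← hconv,
    Measure.conv, e1]
  refine Eq.trans ?_ e2.symm
  rw [integral_tiltedMeasure hs hα0 hα1, ← integral_tilted_mul hs hα0 hα1]
  refine integral_congr_ae (ae_of_all _ fun u => ?_)
  simp only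
  rw [integral_tiltedMeasure ht hα0 hα1, ← integral_tilted_mul ht hα0 hα1,
    ← integral_const_mul (Complex.exp u)]
  congr 1
  refine integral_congr_ae (ae_of_all _ fun v => ?_)
  simp only [Function.comp_apply, hg]
  push_cast
  rw [Complex.exp_add]; ring

end semigroup

variable {M : Type*} [MeasurableSpace M] {μ : Measure M}

/-! ### Products and duality brackets -/

/-- The product of `L^∞` as a continuous bilinear map. -/
def mulL (μ : Measure M) : Linf μ →L[ℂ] Linf μ →L[ℂ] Linf μ :=
  (ContinuousLinearMap.mul ℂ ℂ).holderL μ ∞ ∞ ∞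

/-- The action of `L^∞` on `L^1` by multiplication, as a continuous bilinear map. -/
def mulLOne (μ : Measure M) : Linf μ →L[ℂ] Lp ℂ 1 μ →L[ℂ] Lp ℂ 1 μ :=
  (ContinuousLinearMap.mul ℂ ℂ).holderL μ ∞ 1 1

/-- The bilinear bracket `∫ f g` between `L^∞` and `L^1`; it differs from `pairing` by a
conjugation of the second argument. -/
def dualPair (μ : Measure M) : Linf μ →L[ℂ] Lp ℂ 1 μ →L[ℂ] ℂ :=
  (ContinuousLinearMap.mul ℂ ℂ).lpPairing μ ∞ 1

lemma mul_eq_mulL (f g : Linf μ) : mul f g = mulL μ f g := rfl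

lemma coeFn_mul (f g : Linf μ) : mul f g =ᵐ[μ] fun x => f x * g x :=
  MemLp.coeFn_toLp _

lemma coeFn_mulLOne (f : Linf μ) (g : Lp ℂ 1 μ) : mulLOne μ f g =ᵐ[μ] fun x => f x * g x :=
  ContinuousLinearMap.coeFn_holder _ _ _

lemma dualPair_eq_integral (f : Linf μ) (g : Lp ℂ 1 μ) : dualPair μ f g = ∫ x, f x * g x ∂μ := by
  rw [dualPair, ContinuousLinearMap.lpPairing_eq_integral]; rfl

lemma integrable_mul_one (f : Linf μ) (g : Lp ℂ 1 μ) : Integrable (fun x => f x * g x) μ :=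
  (L1.integrable_coeFn (mulLOne μ f g)).congr (coeFn_mulLOne f g)

lemma norm_mul_le (f g : Linf μ) : ‖mul f g‖ ≤ ‖f‖ * ‖g‖ := by
  have := (ContinuousLinearMap.mul ℂ ℂ).norm_holder_apply_apply_le (r := ∞) f g
  have h1 : ‖ContinuousLinearMap.mul ℂ ℂ‖ = 1 := ContinuousLinearMap.opNorm_mul ..
  rw [h1, one_mul] at this
  exact this

lemma norm_mulLOne_le (f : Linf μ) (g : Lp ℂ 1 μ) : ‖mulLOne μ f g‖ ≤ ‖f‖ * ‖g‖ := by
  have := (ContinuousLinearMap.mul ℂ ℂ).norm_holder_apply_apply_le (r := 1) f g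
  have h1 : ‖ContinuousLinearMap.mul ℂ ℂ‖ = 1 := ContinuousLinearMap.opNorm_mul ..
  rw [h1, one_mul] at this
  exact this

lemma norm_dualPair_le (f : Linf μ) (g : Lp ℂ 1 μ) : ‖dualPair μ f g‖ ≤ ‖f‖ * ‖g‖ := by
  refine le_trans ?_ (norm_mulLOne_le f g)
  rw [dualPair_eq_integral, ← integral_congr_ae (coeFn_mulLOne f g), L1.norm_eq_integral_norm]
  exact norm_integral_le_integral_norm _

lemma dualPair_mul (k f : Linf μ) (g : Lp ℂ 1 μ) :
    dualPair μ (mul k f) g = dualPair μ f (mulLOne μ k g) := by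
  rw [dualPair_eq_integral, dualPair_eq_integral]
  refine integral_congr_ae ?_
  filter_upwards [coeFn_mul k f, coeFn_mulLOne k g] with x h1 h2
  rw [h1, h2]; ring

lemma pairing_eq (f : Linf μ) (g : Lp ℂ 1 μ) : pairing f g = dualPair μ f (star g) := by
  rw [dualPair_eq_integral, pairing]
  refine integral_congr_ae ?_
  filter_upwards [Lp.coeFn_star g] with x h1
  rw [h1]; rfl

lemma pairing_star (f : Linf μ) (g : Lp ℂ 1 μ) : pairing f (star g) = dualPair μ f g := by
  rw [pairing_eq, star_star]

lemma tendstoWeakStar_iff {ι : Type*} {F : ι → Linf μ} {l : Filter ι} {h : Linf μ} :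
    TendstoWeakStar F l h ↔
      ∀ g : Lp ℂ 1 μ, Tendsto (fun i => dualPair μ (F i) g) l (𝓝 (dualPair μ h g)) := by
  constructor
  · intro H g; simpa only [pairing_star] using H (star g)
  · intro H g; simpa only [pairing_eq] using H (star g)

lemma isWeakStarIntegral_iff {w : ℝ → ℝ} {F : ℝ → Linf μ} {h : Linf μ} :
    IsWeakStarIntegral w F h ↔ ∀ g : Lp ℂ 1 μ,
      IntegrableOn (fun u : ℝ => (w u : ℂ) * dualPair μ (F u) g) (Ioi 0) ∧
      dualPair μ h g = ∫ u in Ioi (0 : ℝ), (w u : ℂ) * dualPair μ (F u) g := by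
  constructor
  · intro H g; simpa only [pairing_star] using H (star g)
  · intro H g; simpa only [pairing_eq] using H (star g)

lemma mul_comm' (f g : Linf μ) : mul f g = mul g f := by
  refine Lp.ext ?_
  filter_upwards [coeFn_mul f g, coeFn_mul g f] with x h1 h2
  rw [h1, h2, mul_comm]

lemma star_add' (f g : Linf μ) : star (f + g) = star f + star g := by
  refine Lp.ext ?_
  filter_upwards [Lp.coeFn_star (f + g), Lp.coeFn_add f g, Lp.coeFn_add (star f) (star g),
    Lp.coeFn_star f, Lp.coeFn_star g] with x h1 h2 h3 h4 h5
  rw [h1, h3, Pi.star_apply, h2, Pi.add_apply, Pi.add_apply, h4, h5]; simp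

lemma star_smul' (c : ℂ) (f : Linf μ) : star (c • f) = conj c • star f := by
  refine Lp.ext ?_
  filter_upwards [Lp.coeFn_star (c • f), Lp.coeFn_smul c f, Lp.coeFn_smul (conj c) (star f),
    Lp.coeFn_star f] with x h1 h2 h3 h4
  rw [h1, h3, Pi.star_apply, h2, Pi.smul_apply, Pi.smul_apply, h4]; simp

lemma ofReal_smul_eq (c : ℝ) (f : Linf μ) : (c : ℂ) • f = c • f := by
  refine Lp.ext ?_
  filter_upwards [Lp.coeFn_smul (c : ℂ) f, Lp.coeFn_smul c f] with x h1 h2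
  rw [h1, h2]; simp

/-- Complex conjugation on `L^∞` as a real-linear map. -/
def starLM (μ : Measure M) : Linf μ →ₗ[ℝ] Linf μ where
  toFun := star
  map_add' := star_add'
  map_smul' c f := by
    have h := star_smul' (c : ℂ) f
    rwa [Complex.conj_ofReal, ofReal_smul_eq, ofReal_smul_eq] at h

lemma norm_star' (f : Linf μ) : ‖star f‖ = ‖f‖ := by
  refine le_antisymm (Lp.norm_le_norm_of_ae_le ?_) (Lp.norm_le_norm_of_ae_le ?_) <;>
  · filter_upwards [Lp.coeFn_star f] with x h1
    rw [h1]; simp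

/-- Complex conjugation on `L^∞` as a continuous real-linear map. -/
def starL (μ : Measure M) : Linf μ →L[ℝ] Linf μ :=
  (starLM μ).mkContinuous 1 fun f => by rw [one_mul]; exact (norm_star' f).le

lemma star_sub' (f g : Linf μ) : star (f - g) = star f - star g := (starLM μ).map_sub f g

lemma star_real_smul (c : ℝ) (f : Linf μ) : star (c • f) = c • star f := (starLM μ).map_smul c f

lemma dualPair_star (f : Linf μ) (g : Lp ℂ 1 μ) :
    dualPair μ (star f) g = conj (dualPair μ f (star g)) := by
  rw [dualPair_eq_integral, dualPair_eq_integral, ← integral_conj]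
  refine integral_congr_ae ?_
  filter_upwards [Lp.coeFn_star f, Lp.coeFn_star g] with x h1 h2
  rw [h1, h2]; simp

lemma dualPair_nonneg {f : Linf μ} {g : Lp ℂ 1 μ} (hf : 0 ≤ f) (hg : 0 ≤ g) :
    0 ≤ dualPair μ f g := by
  rw [dualPair_eq_integral]
  refine integral_nonneg_of_ae ?_
  filter_upwards [(Lp.coeFn_nonneg f).2 hf, (Lp.coeFn_nonneg g).2 hg] with x h1 h2
  exact mul_nonneg h1 h2

lemma absSq_nonneg (f : Linf μ) : 0 ≤ absSq f := by
  rw [← Lp.coeFn_nonneg]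
  filter_upwards [coeFn_mul (star f) f, Lp.coeFn_star f] with x h1 h2
  rw [absSq, h1, h2]
  exact star_mul_self_nonneg _

lemma nonneg_of_dualPair [SigmaFinite μ] {f : Linf μ}
    (h : ∀ g : Lp ℂ 1 μ, 0 ≤ g → 0 ≤ dualPair μ f g) : 0 ≤ f := by
  have hs : ∀ s, MeasurableSet s → μ s < ⊤ →
      IntegrableOn f s μ ∧ 0 ≤ ∫ x in s, f x ∂μ := by
    intro s hs hμ
    set g : Lp ℂ 1 μ := indicatorConstLp 1 hs hμ.ne 1 with hgdef
    have hg : g =ᵐ[μ] s.indicator fun _ => 1 := indicatorConstLp_coeFn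
    have hg0 : 0 ≤ g := by
      rw [← Lp.coeFn_nonneg]
      filter_upwards [hg] with x hx
      rw [hx]
      exact indicator_nonneg (fun _ _ => zero_le_one) x
    have hfg : (fun x => f x * g x) =ᵐ[μ] s.indicator f := by
      filter_upwards [hg] with x hx
      rw [hx]; by_cases hxs : x ∈ s <;> simp [hxs]
    refine ⟨?_, ?_⟩
    · rw [← integrable_indicator_iff hs]
      exact (integrable_mul_one f g).congr hfg
    · have := h g hg0
      rwa [dualPair_eq_integral, integral_congr_ae hfg, integral_indicator hs] at this
  rw [← Lp.coeFn_nonneg]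
  have hre : 0 ≤ᵐ[μ] fun x => (f x).re := by
    refine ae_nonneg_of_forall_setIntegral_nonneg_of_sigmaFinite ?_ ?_
    · intro s h1 h2; exact (hs s h1 h2).1.re
    · intro s h1 h2
      have := (Complex.le_def.1 (hs s h1 h2).2).1
      rw [← RCLike.re_eq_complex_re, ← integral_re (hs s h1 h2).1] at this
      simpa using this
  have him : (fun x => (f x).im) =ᵐ[μ] 0 := by
    refine ae_eq_zero_of_forall_setIntegral_eq_of_sigmaFinite ?_ ?_
    · intro s h1 h2; exact (hs s h1 h2).1.im
    · intro s h1 h2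
      have := (Complex.le_def.1 (hs s h1 h2).2).2
      rw [← RCLike.im_eq_complex_im, ← integral_im (hs s h1 h2).1] at this
      simpa using this.symm
  filter_upwards [hre, him] with x h1 h2
  exact Complex.le_def.2 ⟨h1, h2.symm⟩

lemma le_of_dualPair [SigmaFinite μ] {f f' : Linf μ}
    (h : ∀ g : Lp ℂ 1 μ, 0 ≤ g → dualPair μ f g ≤ dualPair μ f' g) : f ≤ f' := by
  rw [← sub_nonneg]
  refine nonneg_of_dualPair fun g hg => ?_
  rw [map_sub, sub_apply, sub_nonneg]
  exact h g hg

lemma dualPair_le {f f' : Linf μ} (h : f ≤ f') {g : Lp ℂ 1 μ} (hg : 0 ≤ g) :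
    dualPair μ f g ≤ dualPair μ f' g := by
  rw [← sub_nonneg, ← sub_apply, ← map_sub]
  exact dualPair_nonneg (sub_nonneg.2 h) hg

lemma ext_dualPair [SigmaFinite μ] {f f' : Linf μ}
    (h : ∀ g : Lp ℂ 1 μ, dualPair μ f g = dualPair μ f' g) : f = f' :=
  le_antisymm (le_of_dualPair fun g _ => (h g).le) (le_of_dualPair fun g _ => (h g).ge)

lemma dualPair_real_smul (c : ℝ) (f : Linf μ) (g : Lp ℂ 1 μ) :
    dualPair μ (c • f) g = c * dualPair μ f g := by
  rw [← ofReal_smul_eq, map_smul]; rfl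

/-! ### `L^∞` as the dual of `L^1` -/

/-- A continuous functional on `L^1` is represented, on products `h v` with `v ∈ L²` and a fixed
weight `h ∈ L²`, by an essentially bounded function. -/
lemma exists_linf_of_weight (ℓ : Lp ℂ 1 μ →L[ℂ] ℂ) (h : M → ℝ) (hm : Measurable h)
    (hpos : ∀ x, 0 < h x) (h2 : MemLp (fun x => (h x : ℂ)) 2 μ) :
    ∃ f : M → ℂ, AEStronglyMeasurable f μ ∧ (∀ᵐ x ∂μ, ‖f x‖ ≤ ‖ℓ‖) ∧
      ∀ (v : Lp ℂ 2 μ) (g : Lp ℂ 1 μ), (∀ᵐ x ∂μ, g x = h x * v x) → ℓ g = ∫ x, f x * g x ∂μ := by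
  let H : Lp ℂ 2 μ := h2.toLp
  have hH : H =ᵐ[μ] fun x => (h x : ℂ) := MemLp.coeFn_toLp _
  let J : Lp ℂ 2 μ →L[ℂ] Lp ℂ 1 μ := (ContinuousLinearMap.mul ℂ ℂ).holderL μ 2 2 1 H
  have hJ : ∀ v : Lp ℂ 2 μ, J v =ᵐ[μ] fun x => h x * v x := by
    intro v
    have : J v =ᵐ[μ] fun x => H x * v x := ContinuousLinearMap.coeFn_holder _ _ _
    filter_upwards [this, hH] with x h1 h2
    rw [h1, h2]
  let k : Lp ℂ 2 μ := (InnerProductSpace.toDual ℂ (Lp ℂ 2 μ)).symm (ℓ.comp J)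
  have hk : ∀ v, ℓ (J v) = ∫ x, conj (k x) * v x ∂μ := by
    intro v
    have h1 : inner ℂ k v = ℓ (J v) := by simp [k]
    rw [← h1, L2.inner_def]
    refine integral_congr_ae (ae_of_all _ fun x => ?_)
    simp [mul_comm]
  have hbound : ∀ᵐ x ∂μ, ‖k x‖ ≤ ‖ℓ‖ * h x := by
    obtain ⟨k', hk'm, hkk'⟩ := (Lp.aestronglyMeasurable k)
    set E : Set M := {x | ‖ℓ‖ * h x < ‖k' x‖} with hE
    have hEm : MeasurableSet E := measurableSet_lt (by fun_prop) hk'm.norm.measurable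
    -- testing against `1_E k` shows that `∫_E |k| (|k| - ‖ℓ‖ h) ≤ 0`
    let v : Lp ℂ 2 μ := ((Lp.memLp k).indicator hEm).toLp
    have hv : v =ᵐ[μ] E.indicator k := MemLp.coeFn_toLp _
    have e1 : ℓ (J v) = ((∫ x in E, ‖k x‖ ^ 2 ∂μ : ℝ) : ℂ) := by
      rw [hk, ← integral_complex_ofReal, ← integral_indicator hEm]
      refine integral_congr_ae ?_
      filter_upwards [hv] with x hx
      rw [hx]
      by_cases hxE : x ∈ E <;> simp [hxE, Complex.conj_mul']
    have e2 : ‖J v‖ = ∫ x in E, h x * ‖k x‖ ∂μ := by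
      rw [L1.norm_eq_integral_norm, ← integral_indicator hEm]
      refine integral_congr_ae ?_
      filter_upwards [hv, hJ v] with x hx hx2
      rw [hx2, hx]
      by_cases hxE : x ∈ E <;> simp [hxE, abs_of_pos (hpos x)]
    have i1 : Integrable (fun x => ‖k x‖ ^ 2) μ := by
      simpa using (Lp.memLp k).integrable_norm_pow (by norm_num)
    have i2 : Integrable (fun x => h x * ‖k x‖) μ := by
      refine (L1.integrable_coeFn (J k)).norm.congr ?_
      filter_upwards [hJ k] with x hx
      rw [hx, norm_mul, Complex.norm_real, Real.norm_of_nonneg (hpos x).le]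
    have e3 : ∫ x in E, ‖k x‖ * (‖k x‖ - ‖ℓ‖ * h x) ∂μ ≤ 0 := by
      have e4 : ‖ℓ (J v)‖ ≤ ‖ℓ‖ * ‖J v‖ := ℓ.le_opNorm _
      rw [e1, e2, Complex.norm_real] at e4
      have e5 := (Real.le_norm_self _).trans e4
      rw [← integral_const_mul, ← sub_nonpos, ← integral_sub i1.integrableOn
        (i2.const_mul _).integrableOn] at e5
      refine le_trans (le_of_eq ?_) e5
      congr 1; ext x; ring
    have i3 : IntegrableOn (fun x => ‖k x‖ * (‖k x‖ - ‖ℓ‖ * h x)) E μ := by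
      refine ((i1.sub (i2.const_mul ‖ℓ‖)).congr (ae_of_all _ fun x => ?_)).integrableOn
      simp only [Pi.sub_apply]; ring
    have hpos' : ∀ᵐ x ∂(μ.restrict E), 0 < ‖k x‖ * (‖k x‖ - ‖ℓ‖ * h x) := by
      filter_upwards [ae_restrict_mem hEm, ae_restrict_of_ae hkk'] with x hx hx2
      rw [hE, mem_ofPred_eq, ← hx2] at hx
      have : 0 ≤ ‖ℓ‖ * h x := mul_nonneg (norm_nonneg _) (hpos x).le
      exact mul_pos (this.trans_lt hx) (sub_pos.2 hx)
    have hzero := (integral_eq_zero_iff_of_nonneg_ae (hpos'.mono fun x hx => hx.le) i3).1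
      (le_antisymm e3 (integral_nonneg_of_ae (hpos'.mono fun x hx => hx.le)))
    have hEnull : ∀ᵐ x ∂(μ.restrict E), False := by
      filter_upwards [hpos', hzero] with x hx hx2
      exact hx.ne' hx2
    rw [ae_restrict_iff' hEm] at hEnull
    filter_upwards [hEnull, hkk'] with x hx hx2
    by_contra hc
    exact hx (by rw [hE, mem_ofPred_eq, ← hx2]; exact not_le.1 hc)
  refine ⟨fun x => conj (k x) / h x, ?_, ?_, ?_⟩
  · have hmc : Measurable fun x => (h x : ℂ) := Complex.measurable_ofReal.comp hm
    exact ((Complex.continuous_conj.comp_aestronglyMeasurable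
      (Lp.aestronglyMeasurable k)).aemeasurable.div hmc.aemeasurable).aestronglyMeasurable
  · filter_upwards [hbound] with x hx
    rw [norm_div, RCLike.norm_conj, Complex.norm_real, Real.norm_of_nonneg (hpos x).le,
      div_le_iff₀ (hpos x)]
    exact hx
  · intro v g hg
    have : g = J v := by
      refine Lp.ext ?_
      filter_upwards [hg, hJ v] with x h1 h2
      rw [h1, h2]
    rw [this, hk]
    refine integral_congr_ae ?_
    filter_upwards [hJ v] with x hx
    rw [hx]
    have : (h x : ℂ) ≠ 0 := by exact_mod_cast (hpos x).ne'
    field_simp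

/-- Every continuous functional on `L^1` of a `σ`-finite measure is given by an element of `L^∞`
of at most the same norm. -/
lemma exists_dualPair_eq [SigmaFinite μ] (ℓ : Lp ℂ 1 μ →L[ℂ] ℂ) :
    ∃ f : Linf μ, ‖f‖ ≤ ‖ℓ‖ ∧ ∀ g, dualPair μ f g = ℓ g := by
  obtain ⟨δ, hδpos, hδm, hδ⟩ := exists_pos_lintegral_lt_of_sigmaFinite μ one_ne_zero
  set h : M → ℝ := fun x => Real.sqrt (δ x) with hh
  have hm : Measurable h := by fun_prop
  have hpos : ∀ x, 0 < h x := fun x => Real.sqrt_pos.2 (by exact_mod_cast hδpos x)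
  have h2 : MemLp (fun x => (h x : ℂ)) 2 μ := by
    rw [memLp_two_iff_integrable_sq_norm (by fun_prop)]
    have : (fun x => ‖(h x : ℂ)‖ ^ 2) = fun x => (δ x : ℝ) := by
      ext x; rw [Complex.norm_real, Real.norm_of_nonneg (hpos x).le, hh]; simp
    rw [this]
    refine ⟨by fun_prop, ?_⟩
    simp only [HasFiniteIntegral, Real.enorm_of_nonneg (NNReal.coe_nonneg _),
      ENNReal.ofReal_coe_nnreal]
    exact hδ.trans ENNReal.one_lt_top
  obtain ⟨f, hfm, hfb, hf⟩ := exists_linf_of_weight ℓ h hm hpos h2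
  have hfL : MemLp f ∞ μ := memLp_top_of_bound hfm _ hfb
  refine ⟨hfL.toLp, ?_, fun g => ?_⟩
  · rw [Lp.norm_toLp, eLpNorm_exponent_top]
    exact ENNReal.toReal_le_of_le_ofReal (norm_nonneg _) (eLpNormEssSup_le_of_ae_bound hfb)
  -- the truncations `g 1_{|g| ≤ n h}` are of the form `h v` and converge to `g` in `L^1`
  obtain ⟨g', hg'm, hgg'⟩ := Lp.aestronglyMeasurable g
  let E : ℕ → Set M := fun n => {x | ‖g' x‖ ≤ n * (h x) ^ 2}
  have hEm : ∀ n, MeasurableSet (E n) := fun n =>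
    measurableSet_le hg'm.norm.measurable (by fun_prop)
  let gn : ℕ → Lp ℂ 1 μ := fun n => ((Lp.memLp g).indicator (hEm n)).toLp
  have hgn : ∀ n, gn n =ᵐ[μ] (E n).indicator g := fun n => MemLp.coeFn_toLp _
  have hlim : Tendsto gn atTop (𝓝 g) := by
    rw [tendsto_iff_norm_sub_tendsto_zero]
    have e1 : ∀ n, ‖gn n - g‖ = ∫ x, ‖(E n).indicator g x - g x‖ ∂μ := by
      intro n
      rw [L1.norm_eq_integral_norm]
      refine integral_congr_ae ?_
      filter_upwards [hgn n, Lp.coeFn_sub (gn n) g] with x h1 h3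
      rw [h3, Pi.sub_apply, h1]
    simp_rw [e1]
    have : (0 : ℝ) = ∫ _, (0 : ℝ) ∂μ := by simp
    rw [this]
    refine tendsto_integral_of_dominated_convergence (fun x => ‖g x‖) ?_
      (L1.integrable_coeFn g).norm ?_ ?_
    · intro n
      exact (((Lp.aestronglyMeasurable g).indicator (hEm n)).sub (Lp.aestronglyMeasurable g)).norm
    · intro n
      refine ae_of_all _ fun x => ?_
      by_cases hx : x ∈ E n <;> simp [hx]
    · filter_upwards [hgg'] with x hx
      obtain ⟨N, hN⟩ := exists_nat_ge (‖g' x‖ / (h x) ^ 2)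
      refine tendsto_const_nhds.congr' ?_
      filter_upwards [eventually_ge_atTop N] with n hn
      have : x ∈ E n := by
        have h3 : ‖g' x‖ / (h x) ^ 2 ≤ n := hN.trans (by exact_mod_cast hn)
        exact (div_le_iff₀ (pow_pos (hpos x) 2)).1 h3
      simp [this]
  have heq : ∀ n, dualPair μ hfL.toLp (gn n) = ℓ (gn n) := by
    intro n
    have hv : MemLp (fun x => (E n).indicator g' x / h x) 2 μ := by
      refine MemLp.of_le (h2.const_mul (n : ℂ)) ?_ ?_
      · exact ((hg'm.measurable.indicator (hEm n)).div
          (Complex.measurable_ofReal.comp hm)).aestronglyMeasurable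
      · refine ae_of_all _ fun x => ?_
        simp only [norm_div, norm_mul, Complex.norm_real, Complex.norm_natCast,
          Real.norm_of_nonneg (hpos x).le]
        rw [div_le_iff₀ (hpos x)]
        by_cases hx : x ∈ E n
        · simp only [hx, indicator_of_mem]
          have : ‖g' x‖ ≤ n * (h x) ^ 2 := hx
          linarith [this, pow_two (h x), mul_assoc (n : ℝ) (h x) (h x)]
        · simp only [hx, not_false_eq_true, indicator_of_notMem, norm_zero]
          have := hpos x
          positivity
    rw [hf hv.toLp (gn n), dualPair_eq_integral]
    · refine integral_congr_ae ?_
      filter_upwards [hfL.coeFn_toLp] with x h1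
      rw [h1]
    · filter_upwards [hgn n, hv.coeFn_toLp, hgg'] with x h1 h3 h4
      have : (h x : ℂ) ≠ 0 := by exact_mod_cast (hpos x).ne'
      rw [h1, h3, mul_div_cancel₀ _ this]
      by_cases hx : x ∈ E n <;> simp [hx, h4]
  refine tendsto_nhds_unique (((dualPair μ hfL.toLp).continuous.tendsto g).comp hlim) ?_
  refine Tendsto.congr (fun n => (heq n).symm) ?_
  exact (ℓ.continuous.tendsto g).comp hlim

lemma norm_le_of_dualPair [SigmaFinite μ] {f : Linf μ} {C : ℝ} (hC : 0 ≤ C)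
    (h : ∀ g, ‖dualPair μ f g‖ ≤ C * ‖g‖) : ‖f‖ ≤ C := by
  obtain ⟨f', hf', hff'⟩ := exists_dualPair_eq (dualPair μ f)
  rw [← ext_dualPair hff']
  exact hf'.trans (ContinuousLinearMap.opNorm_le_bound _ hC h)

/-- A weak*-convergent sequence in `L^∞` is bounded. -/
lemma exists_norm_le_of_tendsto [SigmaFinite μ] {F : ℕ → Linf μ}
    (h : ∀ g, ∃ z, Tendsto (fun n => dualPair μ (F n) g) atTop (𝓝 z)) :
    ∃ C, ∀ n, ‖F n‖ ≤ C := by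
  obtain ⟨C, hC⟩ := banach_steinhaus (g := fun n => dualPair μ (F n)) (fun g => by
    obtain ⟨z, hz⟩ := h g
    obtain ⟨C, hC⟩ := (Metric.isBounded_range_of_tendsto _ hz).exists_norm_le
    exact ⟨C, fun n => hC _ (mem_range_self n)⟩)
  refine ⟨C, fun n => norm_le_of_dualPair ((norm_nonneg _).trans (hC n)) fun g => ?_⟩
  exact ((dualPair μ (F n)).le_opNorm g).trans (by gcongr; exact hC n)

/-- A weak*-continuous linear operator on `L^∞` has a predual on `L^1`. -/
lemma exists_predual (P : Linf μ →ₗ[ℂ] Linf μ)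
    (hP : @Continuous _ _ (weakStar μ) (weakStar μ) P) (g : Lp ℂ 1 μ) :
    ∃ g' : Lp ℂ 1 μ, ∀ f, dualPair μ (P f) g = dualPair μ f g' := by
  let L : Lp ℂ 1 μ → Linf μ →ₗ[ℂ] ℂ := fun g => ((dualPair μ).flip g).toLinearMap
  have hLcont : Continuous[weakStar μ, inferInstance] (fun f => L (star (star g)) (P f)) := by
    let _ := weakStar μ
    have h1 : Continuous fun f : Linf μ => pairing f (star g) :=
      (continuous_apply (A := fun _ => ℂ) (star g)).comp
        (continuous_induced_dom (f := fun (f : Linf μ) (g : Lp ℂ 1 μ) => pairing f g))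
    refine (h1.comp hP).congr fun f => ?_
    rw [Function.comp_apply, pairing_eq]; rfl
  have htop : (⨅ g : Lp ℂ 1 μ, TopologicalSpace.induced (L g) inferInstance) = weakStar μ := by
    have : weakStar μ = ⨅ g : Lp ℂ 1 μ,
        TopologicalSpace.induced (fun f => pairing f g) inferInstance := by
      rw [weakStar]
      simp only [inferInstance, Pi.topologicalSpace, induced_iInf, induced_compose]
      rfl
    rw [this]
    have hinv : Function.Surjective (star : Lp ℂ 1 μ → Lp ℂ 1 μ) := star_involutive.surjective
    rw [← hinv.iInf_comp]
    refine iInf_congr fun g => ?_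
    congr 1
    ext f
    rw [pairing_eq]; rfl
  have hmem := (LinearMap.mem_span_iff_continuous (f := L) ((L (star (star g))).comp P)).2
    (by rw [htop]; exact hLcont)
  have hrange : Submodule.span ℂ (range L) ≤
      LinearMap.range ((ContinuousLinearMap.coeLM ℂ).comp
        ((dualPair μ).flip : Lp ℂ 1 μ →L[ℂ] Linf μ →L[ℂ] ℂ).toLinearMap) := by
    rw [Submodule.span_le]
    rintro _ ⟨g, rfl⟩
    exact ⟨g, rfl⟩
  obtain ⟨g', hg'⟩ := hrange hmem
  refine ⟨g', fun f => ?_⟩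
  have := congrArg (fun φ : Linf μ →ₗ[ℂ] ℂ => φ f) hg'
  simp only [star_star] at this
  exact this.symm

/-! ### Measurability of right-continuous families -/

/-- A function of two variables that is measurable in the first and right-continuous in the second
is jointly measurable. -/
lemma measurable_uncurry_of_right_continuous {X : Type*} [MeasurableSpace X] {F : X → ℝ → ℂ}
    (h1 : ∀ v, Measurable fun x => F x v)
    (h2 : ∀ x v, ContinuousWithinAt (F x) (Ioi v) v) : Measurable (Function.uncurry F) := by
  let a : ℕ → ℝ → ℝ := fun n v => (⌊(n + 1 : ℝ) * v⌋ + 1) / (n + 1)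
  have ha : ∀ v, Tendsto (fun n => a n v) atTop (𝓝[>] v) := by
    intro v
    have hpos : ∀ n : ℕ, (0 : ℝ) < n + 1 := fun n => by positivity
    have hgt : ∀ n, v < a n v := fun n => by
      rw [lt_div_iff₀ (hpos n), mul_comm]; exact Int.lt_floor_add_one _
    have hle : ∀ n, a n v ≤ v + 1 / (n + 1) := fun n => by
      have h3 := Int.floor_le ((n + 1 : ℝ) * v)
      have h4 : v + 1 / (n + 1) = ((n + 1) * v + 1) / (n + 1) := by
        field_simp
      rw [h4]
      exact div_le_div_of_nonneg_right (by linarith) (hpos n).le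
    refine tendsto_nhdsWithin_iff.2 ⟨?_, Eventually.of_forall hgt⟩
    refine tendsto_of_tendsto_of_tendsto_of_le_of_le tendsto_const_nhds ?_
      (fun n => (hgt n).le) hle
    simpa using tendsto_one_div_add_atTop_nhds_zero_nat.const_add v
  refine measurable_of_tendsto_metrizable
    (f := fun (n : ℕ) (q : X × ℝ) => F q.1 (a n q.2)) (fun n => ?_) ?_
  · have h3 : Measurable fun q : X × ℤ => F q.1 ((q.2 + 1) / (n + 1)) :=
      measurable_from_prod_countable_left fun k => h1 (((k : ℤ) + 1 : ℝ) / (n + 1))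
    have h4 : Measurable fun q : X × ℝ => (q.1, ⌊(n + 1 : ℝ) * q.2⌋) :=
      measurable_fst.prodMk (Int.measurable_floor.comp (measurable_snd.const_mul _))
    exact h3.comp h4
  · rw [tendsto_pi_nhds]
    intro q
    exact (h2 q.1 q.2).tendsto.comp (ha q.2)

/-! ### Positive contractions on `L^∞` -/

/-- The constant function `1` in `L^∞`. -/
def oneL (μ : Measure M) : Linf μ := (memLp_top_const (1 : ℂ)).toLp (fun _ : M => (1 : ℂ))

lemma coeFn_oneL : oneL μ =ᵐ[μ] fun _ => (1 : ℂ) := MemLp.coeFn_toLp _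

lemma mul_oneL (f : Linf μ) : mul (oneL μ) f = f := by
  refine Lp.ext ?_
  filter_upwards [coeFn_mul (oneL μ) f, coeFn_oneL (μ := μ)] with x h1 h2
  rw [h1, h2, one_mul]

lemma ae_norm_le (f : Linf μ) : ∀ᵐ x ∂μ, ‖f x‖ ≤ ‖f‖ := by
  have h := ae_le_eLpNormEssSup (f := f) (μ := μ)
  filter_upwards [h] with x hx
  rw [Lp.norm_def, eLpNorm_exponent_top, ← toReal_enorm]
  refine ENNReal.toReal_mono ?_ hx
  rw [← eLpNorm_exponent_top]
  exact (Lp.memLp f).2.ne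

lemma oneL_nonneg : 0 ≤ oneL μ := by
  rw [← Lp.coeFn_nonneg]
  filter_upwards [coeFn_oneL (μ := μ)] with x h
  rw [h]; exact zero_le_one

lemma norm_oneL_le : ‖oneL μ‖ ≤ 1 := by
  rw [oneL, Lp.norm_toLp, eLpNorm_exponent_top]
  exact ENNReal.toReal_le_of_le_ofReal zero_le_one
    (eLpNormEssSup_le_of_ae_bound (ae_of_all _ fun x => by simp))

lemma star_eq_self_of_nonneg {f : Linf μ} (hf : 0 ≤ f) : star f = f := by
  refine Lp.ext ?_
  filter_upwards [Lp.coeFn_star f, (Lp.coeFn_nonneg f).2 hf] with x h1 h2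
  rw [h1, Pi.star_apply]
  exact (Complex.conj_eq_iff_im.2 (Complex.le_def.1 h2).2.symm)

lemma nonneg_norm_smul_sub {f : Linf μ} (hf : star f = f) : 0 ≤ ‖f‖ • oneL μ - f := by
  rw [← Lp.coeFn_nonneg]
  have hs := Lp.coeFn_star f
  rw [hf] at hs
  filter_upwards [Lp.coeFn_sub (‖f‖ • oneL μ) f, Lp.coeFn_smul ‖f‖ (oneL μ),
    coeFn_oneL (μ := μ), ae_norm_le f, hs] with x h1 h2 h3 h4 h5
  rw [h1, Pi.sub_apply, h2, Pi.smul_apply, h3]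
  have him : (f x).im = 0 := Complex.conj_eq_iff_im.1 h5.symm
  refine Complex.le_def.2 ⟨?_, by simp [him]⟩
  have := (Complex.re_le_norm (f x)).trans h4
  simpa using this

section positive

variable {P : Linf μ →ₗ[ℂ] Linf μ}

lemma map_star_of_positive (hP : ∀ f, 0 ≤ f → 0 ≤ P f) (f : Linf μ) : P (star f) = star (P f) := by
  have hsa : ∀ f : Linf μ, star f = f → star (P f) = P f := by
    intro f hf
    have h1 := star_eq_self_of_nonneg (hP _ (nonneg_norm_smul_sub hf))
    have h2 := star_eq_self_of_nonneg (hP _ (oneL_nonneg (μ := μ)))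
    rw [← ofReal_smul_eq, map_sub, map_smul, star_sub', star_smul', h2, Complex.conj_ofReal] at h1
    exact sub_right_injective h1
  have h1 := hsa (f + star f) (by rw [star_add', star_star, add_comm])
  have h2 := hsa (Complex.I • (f - star f)) (by
    rw [star_smul', star_sub', star_star, Complex.conj_I]; module)
  rw [map_smul, star_smul', Complex.conj_I, map_sub, star_sub'] at h2
  rw [map_add, star_add'] at h1
  have h3 : Complex.I • (star (P f) - star (P (star f)) + (P f - P (star f))) = 0 := by
    rw [smul_add, ← h2]; module
  have h4 : star (P f) - star (P (star f)) + (P f - P (star f)) = 0 :=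
    (smul_eq_zero.1 h3).resolve_left Complex.I_ne_zero
  have h5 : (2 : ℂ) • (P (star f) - star (P f)) = 0 := by
    have e : (2 : ℂ) • (P (star f) - star (P f)) =
        -(star (P f) + star (P (star f)) - (P f + P (star f))) -
          (star (P f) - star (P (star f)) + (P f - P (star f))) := by module
    rw [e, h4, h1]; simp
  exact sub_eq_zero.1 ((smul_eq_zero.1 h5).resolve_left two_ne_zero)

/-- The defect `P |f|² - |P f|²` in the Kadison–Schwarz inequality. -/
def carre (P : Linf μ → Linf μ) (f : Linf μ) : Linf μ := P (absSq f) - absSq (P f)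

lemma absSq_eq (f : Linf μ) : absSq f = mulL μ (star f) f := rfl

lemma map_oneL_le (hP : ∀ f, 0 ≤ f → 0 ≤ P f) (hP1 : ∀ f, ‖P f‖ ≤ ‖f‖) : P (oneL μ) ≤ oneL μ := by
  have h0 := hP _ (oneL_nonneg (μ := μ))
  have h1 := nonneg_norm_smul_sub (star_eq_self_of_nonneg h0)
  have h2 : ‖P (oneL μ)‖ • oneL μ ≤ oneL μ := by
    rw [← Lp.coeFn_le]
    filter_upwards [Lp.coeFn_smul ‖P (oneL μ)‖ (oneL μ), coeFn_oneL (μ := μ)] with x h3 h4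
    rw [h3, Pi.smul_apply, h4, Complex.real_smul, mul_one]
    exact_mod_cast (hP1 _).trans norm_oneL_le
  exact (sub_nonneg.1 h1).trans h2

/-- The Kadison–Schwarz inequality for positive contractions of `L^∞`. -/
lemma carre_nonneg (hP : ∀ f, 0 ≤ f → 0 ≤ P f) (hP1 : ∀ f, ‖P f‖ ≤ ‖f‖) (f : Linf μ) :
    0 ≤ carre P f := by
  -- the inequality `P |f - a|² ≥ 0` for each constant `a`
  have key : ∀ a : ℂ, 0 ≤ P (absSq f) - conj a • P f - a • star (P f) +
      (conj a * a) • oneL μ := by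
    intro a
    have e1 : absSq (f - a • oneL μ) =
        absSq f - conj a • f - a • star f + (conj a * a) • oneL μ := by
      have ho : star (oneL μ) = oneL μ := star_eq_self_of_nonneg oneL_nonneg
      have m1 : ∀ k : Linf μ, mulL μ (oneL μ) k = k := mul_oneL
      have m2 : ∀ k : Linf μ, mulL μ k (oneL μ) = k := fun k => by
        rw [← mul_eq_mulL, mul_comm', mul_oneL]
      rw [absSq_eq, absSq_eq, star_sub', star_smul', ho]
      simp only [map_sub, map_smul, sub_apply, smul_apply, m1, m2]
      module
    have h1 := hP _ (absSq_nonneg (f - a • oneL μ))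
    rw [e1, map_add, map_sub, map_sub, map_smul, map_smul, map_smul, map_star_of_positive hP] at h1
    have h2 : (conj a * a) • P (oneL μ) ≤ (conj a * a) • oneL μ := by
      have h3 := map_oneL_le hP hP1
      rw [← Lp.coeFn_le] at h3 ⊢
      filter_upwards [h3, Lp.coeFn_smul (conj a * a) (P (oneL μ)),
        Lp.coeFn_smul (conj a * a) (oneL μ)] with x h4 h5 h6
      rw [h5, h6, Pi.smul_apply, Pi.smul_apply, smul_eq_mul, smul_eq_mul]
      exact mul_le_mul_of_nonneg_left h4 (star_mul_self_nonneg a)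
    exact h1.trans (by gcongr)
  have key2 : ∀ᵐ x ∂μ, ∀ n : ℕ, 0 ≤ P (absSq f) x -
      conj (TopologicalSpace.denseSeq ℂ n) * P f x -
      TopologicalSpace.denseSeq ℂ n * conj (P f x) +
      conj (TopologicalSpace.denseSeq ℂ n) * TopologicalSpace.denseSeq ℂ n := by
    rw [ae_all_iff]
    intro n
    set a := TopologicalSpace.denseSeq ℂ n
    filter_upwards [(Lp.coeFn_nonneg _).2 (key a),
      Lp.coeFn_add (P (absSq f) - conj a • P f - a • star (P f)) ((conj a * a) • oneL μ),
      Lp.coeFn_sub (P (absSq f) - conj a • P f) (a • star (P f)),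
      Lp.coeFn_sub (P (absSq f)) (conj a • P f), Lp.coeFn_smul (conj a) (P f),
      Lp.coeFn_smul a (star (P f)), Lp.coeFn_smul (conj a * a) (oneL μ), Lp.coeFn_star (P f),
      coeFn_oneL (μ := μ)] with x h1 h2 h3 h4 h5 h6 h7 h8 h9
    rw [h2, Pi.add_apply, h3, Pi.sub_apply, h4, Pi.sub_apply, h5, h6, h7, Pi.smul_apply,
      Pi.smul_apply, Pi.smul_apply, h8, h9] at h1
    simpa using h1
  rw [← Lp.coeFn_nonneg]
  filter_upwards [key2, Lp.coeFn_sub (P (absSq f)) (absSq (P f)), coeFn_mul (star (P f)) (P f),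
    Lp.coeFn_star (P f)] with x h1 h2 h3 h4
  have hcl : IsClosed {a : ℂ | 0 ≤ P (absSq f) x - conj a * P f x - a * conj (P f x) +
      conj a * a} := isClosed_le continuous_const (by fun_prop)
  have hall : ∀ a : ℂ, 0 ≤ P (absSq f) x - conj a * P f x - a * conj (P f x) + conj a * a :=
    fun a => (hcl.closure_subset_iff.2 (by rintro _ ⟨n, rfl⟩; exact h1 n))
      (TopologicalSpace.denseRange_denseSeq ℂ a)
  have h5 := hall (P f x)
  rw [carre, h2, Pi.sub_apply, show absSq (P f) = mul (star (P f)) (P f) from rfl, h3, h4]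
  refine le_of_le_of_eq h5 ?_
  simp only [Pi.star_apply, RCLike.star_def]
  ring

lemma carre_smul (c : ℝ) (f : Linf μ) : carre P (c • f) = (c ^ 2) • carre P f := by
  rw [← ofReal_smul_eq, ← ofReal_smul_eq]
  simp only [carre, absSq_eq, map_smul, star_smul', smul_apply, Complex.conj_ofReal]
  push_cast
  module

/-- The sesquilinear form whose diagonal is `carre P`. -/
def carreForm (P : Linf μ →ₗ[ℂ] Linf μ) (f g : Linf μ) : Linf μ :=
  P (mul (star f) g) - mul (star (P f)) (P g)

lemma carre_sub_smul (c : ℝ) (f k : Linf μ) :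
    carre P (f - (c : ℂ) • k) = carre P f - (c : ℂ) • (carreForm P f k + carreForm P k f) +
      ((c : ℂ) ^ 2) • carre P k := by
  simp only [carre, carreForm, absSq_eq, mul_eq_mulL, map_sub, map_smul, star_sub', star_smul',
    sub_apply, smul_apply, Complex.conj_ofReal]
  module

lemma carreForm_self (f : Linf μ) : carreForm P f f = carre P f := rfl

end positive

/-! ### Weak* averages of a semigroup -/

/-- The weak* average `∫_0^∞ w(u) T_u f du`. -/
def avg (T : ℝ → Linf μ →ₗ[ℂ] Linf μ) (w : ℝ → ℝ) (f : Linf μ) : Linf μ :=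
  open Classical in
  if h : ∃ k, IsWeakStarIntegral w (fun u => T u f) k then h.choose else 0

/-- Compatibility of an operator with weak* averages, after multiplication by a fixed function:
`P (k ∫ w(u) T_u f du) = ∫ w(u) P (k T_u f) du`. -/
def CommutesAvg (T : ℝ → Linf μ →ₗ[ℂ] Linf μ) (P : Linf μ → Linf μ) : Prop :=
  ∀ (k f : Linf μ) (g : Lp ℂ 1 μ),
    Measurable (fun u => dualPair μ (P (mul k (T (max u 0) f))) g) ∧
    ∀ w : ℝ → ℝ, IntegrableOn w (Ioi 0) → dualPair μ (P (mul k (avg T w f))) g =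
      ∫ u in Ioi (0 : ℝ), (w u : ℂ) * dualPair μ (P (mul k (T u f))) g

section averages

variable {T : ℝ → Linf μ →ₗ[ℂ] Linf μ} (hT : IsPositiveSemigroup T)

include hT

lemma right_continuous_orbit (f : Linf μ) (g : Lp ℂ 1 μ) (u : ℝ) :
    ContinuousWithinAt (fun u => dualPair μ (T (max u 0) f) g) (Ioi u) u := by
  rcases lt_or_ge u 0 with hu | hu
  · have : (fun u => dualPair μ (T (max u 0) f) g) =ᶠ[𝓝 u] fun _ => dualPair μ (T 0 f) g := by
      filter_upwards [gt_mem_nhds hu] with v hv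
      rw [max_eq_right hv.le]
    exact (continuousAt_const.congr this.symm).continuousWithinAt
  · obtain ⟨g', hg'⟩ := exists_predual (T u) (hT.weakStar_continuous u hu) g
    have h1 := tendstoWeakStar_iff.1 (hT.tendsto_zero f) g'
    have h2 : Tendsto (fun v => v - u) (𝓝[>] u) (𝓝[>] 0) := by
      refine tendsto_nhdsWithin_iff.2 ⟨?_, ?_⟩
      · have : Continuous fun v : ℝ => v - u := by fun_prop
        simpa using (this.tendsto u).mono_left nhdsWithin_le_nhds
      · filter_upwards [self_mem_nhdsWithin] with v hv
        exact sub_pos.2 (show u < v from hv)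
    have h3 := h1.comp h2
    rw [ContinuousWithinAt, max_eq_left hu, hg' f]
    refine h3.congr' ?_
    filter_upwards [self_mem_nhdsWithin] with v hv
    have hv : u < v := hv
    rw [max_eq_left (hu.trans hv.le), Function.comp_apply, ← hg', ← hT.map_add u (v - u) hu
      (sub_nonneg.2 hv.le), add_sub_cancel]

lemma measurable_orbit (f : Linf μ) (g : Lp ℂ 1 μ) :
    Measurable fun u => dualPair μ (T (max u 0) f) g := by
  have h := measurable_uncurry_of_right_continuous (X := Unit)
    (F := fun _ u => dualPair μ (T (max u 0) f) g) (fun _ => measurable_const)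
    fun _ u => right_continuous_orbit hT f g u
  exact h.of_uncurry_left (x := ())

lemma norm_dualPair_orbit_le {u : ℝ} (hu : 0 ≤ u) (f : Linf μ) (g : Lp ℂ 1 μ) :
    ‖dualPair μ (T u f) g‖ ≤ ‖f‖ * ‖g‖ :=
  (norm_dualPair_le _ _).trans (by gcongr; exact hT.contraction u hu f)

lemma aestronglyMeasurable_orbit (f : Linf μ) (g : Lp ℂ 1 μ) :
    AEStronglyMeasurable (fun u => dualPair μ (T u f) g) (volume.restrict (Ioi 0)) := by
  refine (measurable_orbit hT f g).aestronglyMeasurable.congr ?_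
  filter_upwards [ae_restrict_mem measurableSet_Ioi] with u hu
  rw [max_eq_left (le_of_lt hu)]

lemma integrableOn_orbit {w : ℝ → ℝ} (hw : IntegrableOn w (Ioi 0)) (f : Linf μ) (g : Lp ℂ 1 μ) :
    IntegrableOn (fun u => (w u : ℂ) * dualPair μ (T u f) g) (Ioi 0) := by
  refine Integrable.mul_bdd (c := ‖f‖ * ‖g‖) hw.ofReal (aestronglyMeasurable_orbit hT f g) ?_
  filter_upwards [ae_restrict_mem measurableSet_Ioi] with u hu
  exact norm_dualPair_orbit_le hT (le_of_lt hu) f g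

lemma norm_integral_orbit_le {w : ℝ → ℝ} (hw : IntegrableOn w (Ioi 0)) (f : Linf μ)
    (g : Lp ℂ 1 μ) : ‖∫ u in Ioi (0 : ℝ), (w u : ℂ) * dualPair μ (T u f) g‖ ≤
      (∫ u in Ioi (0 : ℝ), |w u|) * ‖f‖ * ‖g‖ := by
  rw [mul_assoc, ← integral_mul_const]
  refine norm_integral_le_of_norm_le (hw.abs.mul_const _) ?_
  filter_upwards [ae_restrict_mem measurableSet_Ioi] with u hu
  rw [norm_mul, Complex.norm_real, Real.norm_eq_abs]
  have := norm_dualPair_orbit_le hT (le_of_lt hu) f g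
  gcongr

variable [SigmaFinite μ]

lemma avg_spec {w : ℝ → ℝ} (hw : IntegrableOn w (Ioi 0)) (f : Linf μ) :
    IsWeakStarIntegral w (fun u => T u f) (avg T w f) := by
  have hex : ∃ k, IsWeakStarIntegral w (fun u => T u f) k := by
    let ℓ : Lp ℂ 1 μ →ₗ[ℂ] ℂ :=
      { toFun := fun g => ∫ u in Ioi (0 : ℝ), (w u : ℂ) * dualPair μ (T u f) g
        map_add' := fun g g' => by
          rw [← integral_add (integrableOn_orbit hT hw f g) (integrableOn_orbit hT hw f g')]
          simp only [map_add, mul_add]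
        map_smul' := fun c g => by
          rw [RingHom.id_apply, smul_eq_mul, ← integral_const_mul]
          refine integral_congr_ae (ae_of_all _ fun u => ?_)
          simp only [map_smul, smul_eq_mul]; ring }
    obtain ⟨k, -, hk⟩ := exists_dualPair_eq (ℓ.mkContinuous ((∫ u in Ioi (0 : ℝ), |w u|) * ‖f‖)
      (fun g => norm_integral_orbit_le hT hw f g))
    exact ⟨k, isWeakStarIntegral_iff.2 fun g => ⟨integrableOn_orbit hT hw f g, hk g⟩⟩
  rw [avg, dif_pos hex]
  exact hex.choose_spec

lemma dualPair_avg {w : ℝ → ℝ} (hw : IntegrableOn w (Ioi 0)) (f : Linf μ) (g : Lp ℂ 1 μ) :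
    dualPair μ (avg T w f) g = ∫ u in Ioi (0 : ℝ), (w u : ℂ) * dualPair μ (T u f) g :=
  (isWeakStarIntegral_iff.1 (avg_spec hT hw f) g).2

lemma norm_avg_le {w : ℝ → ℝ} (hw : IntegrableOn w (Ioi 0)) (f : Linf μ) :
    ‖avg T w f‖ ≤ (∫ u in Ioi (0 : ℝ), |w u|) * ‖f‖ := by
  have h0 : 0 ≤ ∫ u in Ioi (0 : ℝ), |w u| := integral_nonneg fun u => abs_nonneg _
  refine norm_le_of_dualPair (by positivity) fun g => ?_
  rw [dualPair_avg hT hw]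
  exact norm_integral_orbit_le hT hw f g

/-- The weak* average as a continuous linear operator. -/
def avgL {w : ℝ → ℝ} (hw : IntegrableOn w (Ioi 0)) : Linf μ →L[ℂ] Linf μ :=
  LinearMap.mkContinuous
    { toFun := avg T w
      map_add' := fun f f' => ext_dualPair fun g => by
        rw [map_add, add_apply, dualPair_avg hT hw, dualPair_avg hT hw, dualPair_avg hT hw,
          ← integral_add (integrableOn_orbit hT hw f g) (integrableOn_orbit hT hw f' g)]
        simp only [map_add, add_apply, mul_add]
      map_smul' := fun c f => ext_dualPair fun g => by
        rw [RingHom.id_apply, map_smul, smul_apply, dualPair_avg hT hw, dualPair_avg hT hw,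
          smul_eq_mul, ← integral_const_mul]
        refine integral_congr_ae (ae_of_all _ fun u => ?_)
        simp only [map_smul, smul_apply, smul_eq_mul]; ring }
    (∫ u in Ioi (0 : ℝ), |w u|) (norm_avg_le hT hw)

lemma avgL_apply {w : ℝ → ℝ} (hw : IntegrableOn w (Ioi 0)) (f : Linf μ) :
    avgL hT hw f = avg T w f := rfl

lemma avg_nonneg {w : ℝ → ℝ} (hw : IntegrableOn w (Ioi 0)) (hw0 : ∀ u, 0 < u → 0 ≤ w u)
    {f : Linf μ} (hf : 0 ≤ f) : 0 ≤ avg T w f := by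
  refine nonneg_of_dualPair fun g hg => ?_
  rw [dualPair_avg hT hw]
  refine integral_nonneg_of_ae ?_
  filter_upwards [ae_restrict_mem measurableSet_Ioi] with u hu
  exact mul_nonneg (by exact_mod_cast hw0 u hu)
    (dualPair_nonneg (hT.positive u (le_of_lt hu) f hf) hg)

lemma star_avg {w : ℝ → ℝ} (hw : IntegrableOn w (Ioi 0)) (f : Linf μ) :
    star (avg T w f) = avg T w (star f) := by
  refine ext_dualPair fun g => ?_
  rw [dualPair_star, dualPair_avg hT hw, dualPair_avg hT hw, ← integral_conj]
  refine setIntegral_congr_fun measurableSet_Ioi fun u hu => ?_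
  simp only [map_mul, Complex.conj_ofReal]
  rw [map_star_of_positive (hT.positive u (le_of_lt hu)), dualPair_star]

lemma commutesAvg_self {v : ℝ} (hv : 0 ≤ v) : CommutesAvg T (T v) := by
  intro k f g
  obtain ⟨g', hg'⟩ := exists_predual (T v) (hT.weakStar_continuous v hv) g
  simp only [hg', dualPair_mul]
  exact ⟨measurable_orbit hT f _, fun w hw => dualPair_avg hT hw f _⟩

omit [SigmaFinite μ] in
lemma measurable_orbit_mul (k f : Linf μ) (g : Lp ℂ 1 μ) :
    Measurable (Function.uncurry fun u v =>
      dualPair μ (T (max v 0) (mul k (T (max u 0) f))) g) := by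
  refine measurable_uncurry_of_right_continuous (fun v => ?_)
    fun u v => right_continuous_orbit hT _ g v
  obtain ⟨g', hg'⟩ := exists_predual _ (hT.weakStar_continuous _ (le_max_right v 0)) g
  simp only [hg', dualPair_mul]
  exact measurable_orbit hT f _

lemma commutesAvg_avg {v : ℝ → ℝ} (hv : IntegrableOn v (Ioi 0)) : CommutesAvg T (avg T v) := by
  intro k f g
  have hm := measurable_orbit_mul hT k f g
  have hva := hv.aestronglyMeasurable
  constructor
  · have h1 : (fun u => dualPair μ (avg T v (mul k (T (max u 0) f))) g) = fun u =>
        ∫ y in Ioi (0 : ℝ), ((hva.mk v : ℝ → ℝ) y : ℂ) *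
          dualPair μ (T (max y 0) (mul k (T (max u 0) f))) g := by
      funext u
      rw [dualPair_avg hT hv]
      refine integral_congr_ae ?_
      filter_upwards [ae_restrict_mem measurableSet_Ioi, hva.ae_eq_mk] with y hy hy2
      have hy' : (0 : ℝ) < y := hy
      rw [max_eq_left hy'.le, hy2]
    rw [h1]
    have h2 : StronglyMeasurable (Function.uncurry fun u y => ((hva.mk v : ℝ → ℝ) y : ℂ) *
        dualPair μ (T (max y 0) (mul k (T (max u 0) f))) g) := by
      refine Measurable.stronglyMeasurable (Measurable.mul ?_ hm)
      exact Complex.measurable_ofReal.comp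
        (hva.stronglyMeasurable_mk.measurable.comp measurable_snd)
    exact (h2.integral_prod_right (ν := volume.restrict (Ioi (0 : ℝ)))).measurable
  · intro w hw
    rw [dualPair_avg hT hv]
    have h1 : ∀ y ∈ Ioi (0 : ℝ), (v y : ℂ) * dualPair μ (T y (mul k (avg T w f))) g =
        ∫ u in Ioi (0 : ℝ), (v y : ℂ) * ((w u : ℂ) *
          dualPair μ (T (max y 0) (mul k (T (max u 0) f))) g) := by
      intro y hy
      have hy : 0 < y := hy
      rw [integral_const_mul, ((commutesAvg_self hT hy.le) k f g).2 w hw]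
      congr 1
      refine setIntegral_congr_fun measurableSet_Ioi fun u hu => ?_
      have hu' : (0 : ℝ) < u := hu
      simp only [max_eq_left hy.le, max_eq_left hu'.le]
    rw [setIntegral_congr_fun measurableSet_Ioi h1]
    have hint : Integrable (Function.uncurry fun y u => (v y : ℂ) * ((w u : ℂ) *
        dualPair μ (T (max y 0) (mul k (T (max u 0) f))) g))
        ((volume.restrict (Ioi (0 : ℝ))).prod (volume.restrict (Ioi (0 : ℝ)))) := by
      have i1 := Integrable.mul_prod hv.ofReal hw.ofReal (L := ℂ)
      have i2 := Integrable.mul_bdd (c := ‖k‖ * ‖f‖ * ‖g‖) i1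
        ((hm.comp measurable_swap).aestronglyMeasurable) (ae_of_all _ fun q => by
          refine (norm_dualPair_orbit_le hT (le_max_right _ _) _ g).trans ?_
          gcongr
          refine (norm_mul_le _ _).trans ?_
          gcongr
          exact hT.contraction _ (le_max_right _ _) f)
      refine i2.congr (ae_of_all _ fun q => ?_)
      simp only [Function.uncurry, Function.comp_apply, Prod.fst_swap, Prod.snd_swap, mul_assoc]
      rfl
    rw [integral_integral_swap hint]
    refine setIntegral_congr_fun measurableSet_Ioi fun u hu => ?_
    rw [dualPair_avg hT hv, ← integral_const_mul]
    refine setIntegral_congr_fun measurableSet_Ioi fun y hy => ?_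
    have hu' : (0 : ℝ) < u := hu
    have hy' : (0 : ℝ) < y := hy
    simp only [max_eq_left hu'.le, max_eq_left hy'.le]
    ring

lemma avg_comm {v : ℝ} (hv : 0 ≤ v) {w : ℝ → ℝ} (hw : IntegrableOn w (Ioi 0)) (f : Linf μ) :
    T v (avg T w f) = avg T w (T v f) := by
  refine ext_dualPair fun g => ?_
  have h1 := (commutesAvg_self hT hv (oneL μ) f g).2 w hw
  simp only [mul_oneL] at h1
  rw [h1, dualPair_avg hT hw]
  refine setIntegral_congr_fun measurableSet_Ioi fun u hu => ?_
  rw [← hT.map_add v u hv (le_of_lt hu), ← hT.map_add u v (le_of_lt hu) hv, add_comm]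

/-- Jensen's inequality for the quadratic map `carre P`, in the form of a Cauchy–Schwarz inequality
with a weight: if `carre P (T_u h) ≤ T_u (carre P h)` then
`carre P (∫ ψ(u) T_u h du) ≤ (∫ ψ² / φ) ∫ φ(u) T_u (carre P h) du`. -/
lemma carre_avg_le {P : Linf μ →ₗ[ℂ] Linf μ} (hP : ∀ f, 0 ≤ f → 0 ≤ P f)
    (hP1 : ∀ f, ‖P f‖ ≤ ‖f‖) (hPT : CommutesAvg T P) {φ ψ : ℝ → ℝ}
    (hφ : IntegrableOn φ (Ioi 0)) (hφ0 : ∀ u, 0 < u → 0 < φ u) (hψ : IntegrableOn ψ (Ioi 0))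
    (hi : IntegrableOn (fun u => ψ u ^ 2 / φ u) (Ioi 0))
    (hi1 : ∫ u in Ioi (0 : ℝ), ψ u ^ 2 / φ u ≤ 1) (h : Linf μ)
    (hle : ∀ u, 0 < u → carre P (T u h) ≤ T u (carre P h)) :
    carre P (avg T ψ h) ≤ avg T φ (carre P h) := by
  set F := avg T ψ h with hF
  refine le_of_dualPair fun g hg => ?_
  set Z := dualPair μ (carre P F) g with hZ
  have hZ0 : 0 ≤ Z := dualPair_nonneg (carre_nonneg hP hP1 F) hg
  set B : ℝ → ℂ := fun u => dualPair μ (carreForm P (T u h) F + carreForm P F (T u h)) g with hB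
  -- both cross terms are of the form covered by `CommutesAvg`
  have hBdecomp : ∀ (k : Linf μ), dualPair μ (carreForm P k F + carreForm P F k) g =
      (dualPair μ (P (mul F (star k))) g - dualPair μ (P (mul (oneL μ) (star k)))
        (mulLOne μ (P F) g)) + (dualPair μ (P (mul (star F) k)) g -
        dualPair μ (P (mul (oneL μ) k)) (mulLOne μ (star (P F)) g)) := by
    intro k
    rw [mul_oneL, mul_oneL, ← dualPair_mul, ← dualPair_mul, map_star_of_positive hP k,
      mul_comm' F, mul_comm' (P F), carreForm, carreForm]
    simp only [map_add, map_sub, add_apply, sub_apply]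
  have hstar : ∀ u, 0 < u → star (T u h) = T u (star h) := fun u hu =>
    (map_star_of_positive (hT.positive u hu.le) h).symm
  have hbd : ∀ (k f : Linf μ) (g : Lp ℂ 1 μ), IntegrableOn (fun u => (ψ u : ℂ) *
      dualPair μ (P (mul k (T u f))) g) (Ioi 0) := by
    intro k f g
    refine Integrable.mul_bdd (c := ‖k‖ * ‖f‖ * ‖g‖) hψ.ofReal ?_ ?_
    · refine (hPT k f g).1.aestronglyMeasurable.congr ?_
      filter_upwards [ae_restrict_mem measurableSet_Ioi] with u hu
      rw [max_eq_left (le_of_lt hu)]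
    · filter_upwards [ae_restrict_mem measurableSet_Ioi] with u hu
      refine (norm_dualPair_le _ g).trans ?_
      gcongr
      refine (hP1 _).trans ((norm_mul_le _ _).trans ?_)
      gcongr
      exact hT.contraction _ (le_of_lt hu) f
  have hcongr : EqOn (fun u => (ψ u : ℂ) * B u) (fun u =>
      ((ψ u : ℂ) * dualPair μ (P (mul F (T u (star h)))) g -
        (ψ u : ℂ) * dualPair μ (P (mul (oneL μ) (T u (star h)))) (mulLOne μ (P F) g)) +
      ((ψ u : ℂ) * dualPair μ (P (mul (star F) (T u h))) g -
        (ψ u : ℂ) * dualPair μ (P (mul (oneL μ) (T u h))) (mulLOne μ (star (P F)) g)))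
      (Ioi 0) := by
    intro u hu
    simp only [hB, hBdecomp, hstar u hu]
    ring
  have iB : IntegrableOn (fun u => (ψ u : ℂ) * B u) (Ioi 0) := by
    rw [integrableOn_congr_fun hcongr measurableSet_Ioi]
    exact ((hbd _ _ _).sub (hbd _ _ _)).add ((hbd _ _ _).sub (hbd _ _ _))
  have eB : ∫ u in Ioi (0 : ℝ), (ψ u : ℂ) * B u = 2 * Z := by
    have j1 := integral_add ((hbd F (star h) g).sub (hbd (oneL μ) (star h) (mulLOne μ (P F) g)))
      ((hbd (star F) h g).sub (hbd (oneL μ) h (mulLOne μ (star (P F)) g)))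
    have j2 := integral_sub (hbd F (star h) g) (hbd (oneL μ) (star h) (mulLOne μ (P F) g))
    have j3 := integral_sub (hbd (star F) h g) (hbd (oneL μ) h (mulLOne μ (star (P F)) g))
    simp only [Pi.sub_apply] at j1
    rw [setIntegral_congr_fun measurableSet_Ioi hcongr, j1, j2, j3, ← (hPT _ _ _).2 ψ hψ,
      ← (hPT _ _ _).2 ψ hψ, ← (hPT _ _ _).2 ψ hψ, ← (hPT _ _ _).2 ψ hψ, ← star_avg hT hψ, ← hF,
      ← hBdecomp, carreForm_self, ← two_smul ℂ (carre P F), map_smul, smul_apply, smul_eq_mul]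
  -- `0 ≤ carre P (T_u h - c F)` with `c = ψ(u) / φ(u)`
  have hpt : ∀ u ∈ Ioi (0 : ℝ), 0 ≤ (φ u : ℂ) * dualPair μ (T u (carre P h)) g -
      (ψ u : ℂ) * B u + ((ψ u ^ 2 / φ u : ℝ) : ℂ) * Z := by
    intro u hu
    have hu : 0 < u := hu
    have hφu := hφ0 u hu
    set c : ℝ := ψ u / φ u with hc
    have h1 := dualPair_nonneg (carre_nonneg hP hP1 (T u h - (c : ℂ) • F)) hg
    rw [carre_sub_smul, map_add, map_sub, map_smul, map_smul, add_apply, sub_apply, smul_apply,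
      smul_apply, ← hZ, smul_eq_mul, smul_eq_mul] at h1
    have h2 := dualPair_le (hle u hu) hg
    have h3 : 0 ≤ dualPair μ (T u (carre P h)) g - (c : ℂ) * B u + (c : ℂ) ^ 2 * Z :=
      h1.trans (by gcongr)
    have h4 : (0 : ℂ) ≤ (φ u : ℂ) := by exact_mod_cast hφu.le
    have hφc : (φ u : ℂ) ≠ 0 := by exact_mod_cast hφu.ne'
    refine (mul_nonneg h4 h3).trans (le_of_eq ?_)
    rw [hc]; push_cast
    field_simp
  have iW := integrableOn_orbit hT hφ (carre P h) g
  have iZ : IntegrableOn (fun u => ((ψ u ^ 2 / φ u : ℝ) : ℂ) * Z) (Ioi 0) :=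
    hi.ofReal.mul_const Z
  have hfin : 0 ≤ ∫ u in Ioi (0 : ℝ), ((φ u : ℂ) * dualPair μ (T u (carre P h)) g -
      (ψ u : ℂ) * B u + ((ψ u ^ 2 / φ u : ℝ) : ℂ) * Z) :=
    integral_nonneg_of_ae ((ae_restrict_mem measurableSet_Ioi).mono hpt)
  have k1 := integral_add (iW.sub iB) iZ
  have k2 := integral_sub iW iB
  simp only [Pi.sub_apply] at k1
  rw [k1, k2, eB, ← dualPair_avg hT hφ, integral_mul_const, integral_complex_ofReal] at hfin
  have hI : ((∫ u in Ioi (0 : ℝ), ψ u ^ 2 / φ u : ℝ) : ℂ) * Z ≤ 1 * Z := by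
    gcongr
    exact_mod_cast hi1
  have h5 : 0 ≤ dualPair μ (avg T φ (carre P h)) g - 2 * Z + 1 * Z := hfin.trans (by gcongr)
  rw [← sub_nonneg]
  refine h5.trans (le_of_eq ?_)
  ring

end averages

section

/-! ### The subordinated semigroup -/

/-- The properties of the subordinated semigroup from which the gradient estimates follow. The
last one says that `t ↦ S_t f` is norm differentiable, and that its derivative `R f` at time `a`
satisfies `S_y |R f|² - |S_y R f|² ≤ (p / a)² S_a (S_y |f|² - |S_y f|²)`. -/
structure IsRegularSemigroup (S : ℝ → Linf μ → Linf μ) (p : ℝ) : Prop where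
  linear : ∀ t, 0 < t → ∃ P : Linf μ →L[ℂ] Linf μ, S t = P
  positive : ∀ t, 0 < t → ∀ f, 0 ≤ f → 0 ≤ S t f
  contraction : ∀ t, 0 < t → ∀ f, ‖S t f‖ ≤ ‖f‖
  map_add : ∀ s t, 0 < s → 0 < t → ∀ f, S (s + t) f = S s (S t f)
  tendsto_zero : ∀ f, TendstoWeakStar (fun t => S t f) (𝓝[>] 0) f
  seq_continuous : ∀ t, 0 < t → ∀ (F : ℕ → Linf μ) (f : Linf μ) (C : ℝ), (∀ n, ‖F n‖ ≤ C) →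
    TendstoWeakStar F atTop f → TendstoWeakStar (fun n => S t (F n)) atTop (S t f)
  gammaTwo : GammaTwo S
  deriv : ∀ a, 0 < a → ∃ R : Linf μ →L[ℂ] Linf μ, (∀ f, HasDerivAt (fun s => S s f) (R f) a) ∧
    ∀ y, 0 < y → ∀ f, carre (S y) (R f) ≤ ((p / a) ^ 2) • S a (carre (S y) f)

lemma real_smul_le_smul {c : ℝ} (hc : 0 ≤ c) {f f' : Linf μ} (h : f ≤ f') : c • f ≤ c • f' := by
  rw [← Lp.coeFn_le] at h ⊢
  filter_upwards [h, Lp.coeFn_smul c f, Lp.coeFn_smul c f'] with x h1 h2 h3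
  rw [h2, h3, Pi.smul_apply, Pi.smul_apply, Complex.real_smul, Complex.real_smul]
  exact mul_le_mul_of_nonneg_left h1 (by exact_mod_cast hc)

variable {T : ℝ → Linf μ →ₗ[ℂ] Linf μ} {α : ℝ}

lemma subord_eq_avg {t : ℝ} (ht : t ≠ 0) (f : Linf μ) :
    subord T α t f = avg T (phi t α) f := by
  rw [subord, if_neg ht, avg]

section averages

variable [SigmaFinite μ] (hT : IsPositiveSemigroup T)

include hT

lemma avg_linear_weight {w₁ w₂ w₃ : ℝ → ℝ} (h₁ : IntegrableOn w₁ (Ioi 0))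
    (h₂ : IntegrableOn w₂ (Ioi 0)) (h₃ : IntegrableOn w₃ (Ioi 0)) (c : ℝ) (f : Linf μ) :
    avg T (fun u => w₁ u - w₂ u - c * w₃ u) f = avg T w₁ f - avg T w₂ f - c • avg T w₃ f := by
  refine ext_dualPair fun g => ?_
  have i₁ := integrableOn_orbit hT h₁ f g
  have i₂ := integrableOn_orbit hT h₂ f g
  have i₃ := integrableOn_orbit hT h₃ f g
  have e := integral_sub (i₁.sub i₂) (i₃.const_mul c)
  simp only [Pi.sub_apply] at e
  have hw : IntegrableOn (fun u => w₁ u - w₂ u - c * w₃ u) (Ioi 0) :=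
    (h₁.sub h₂).sub (h₃.const_mul c)
  rw [dualPair_avg hT hw, map_sub, map_sub, sub_apply, sub_apply,
    dualPair_real_smul, dualPair_avg hT h₁, dualPair_avg hT h₂, dualPair_avg hT h₃,
    ← integral_const_mul, ← integral_sub i₁ i₂, ← e]
  refine integral_congr_ae (ae_of_all _ fun u => ?_)
  push_cast
  ring

lemma tendsto_avg {w : ℝ → ℝ} (hw : IntegrableOn w (Ioi 0)) {F : ℕ → Linf μ} {f : Linf μ} {C : ℝ}
    (hF : ∀ n, ‖F n‖ ≤ C) (hf : TendstoWeakStar F atTop f) :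
    TendstoWeakStar (fun n => avg T w (F n)) atTop (avg T w f) := by
  rw [tendstoWeakStar_iff] at hf ⊢
  intro g
  simp only [dualPair_avg hT hw]
  refine tendsto_integral_of_dominated_convergence (fun u => ‖w u‖ * (C * ‖g‖))
    (fun n => (integrableOn_orbit hT hw (F n) g).aestronglyMeasurable) (hw.norm.mul_const _)
    (fun n => ?_) ?_
  · filter_upwards [ae_restrict_mem measurableSet_Ioi] with u hu
    rw [norm_mul, Complex.norm_real]
    gcongr
    refine (norm_dualPair_orbit_le hT (le_of_lt hu) _ _).trans ?_
    gcongr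
    exact hF n
  · filter_upwards [ae_restrict_mem measurableSet_Ioi] with u hu
    obtain ⟨g', hg'⟩ := exists_predual (T u) (hT.weakStar_continuous u (le_of_lt hu)) g
    simp only [hg']
    exact (hf g').const_mul _

section subordination

variable (hα0 : 0 < α) (hα1 : α < 1)

include hα0 hα1

lemma norm_subord_le {t : ℝ} (ht : 0 < t) (f : Linf μ) : ‖subord T α t f‖ ≤ ‖f‖ := by
  have hi := integrableOn_phi ht hα0 hα1
  rw [subord_eq_avg ht.ne']
  refine (norm_avg_le hT hi f).trans (le_of_eq ?_)
  rw [setIntegral_congr_fun measurableSet_Ioi fun u hu => abs_of_pos (phi_pos ht hα0 hα1 hu),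
    integral_phi ht hα0 hα1, one_mul]

lemma subord_nonneg {t : ℝ} (ht : 0 < t) {f : Linf μ} (hf : 0 ≤ f) : 0 ≤ subord T α t f := by
  rw [subord_eq_avg ht.ne']
  exact avg_nonneg hT (integrableOn_phi ht hα0 hα1) (fun u hu => (phi_pos ht hα0 hα1 hu).le) hf

lemma subord_add {s t : ℝ} (hs : 0 < s) (ht : 0 < t) (f : Linf μ) :
    subord T α (s + t) f = subord T α s (subord T α t f) := by
  have hi := integrableOn_phi hs hα0 hα1
  have hi' := integrableOn_phi ht hα0 hα1
  rw [subord_eq_avg hs.ne', subord_eq_avg ht.ne', subord_eq_avg (add_pos hs ht).ne']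
  refine ext_dualPair fun g => ?_
  have key := integral_phi_conv hs ht hα0 hα1 (measurable_orbit hT f g) (C := ‖f‖ * ‖g‖)
    (fun u => norm_dualPair_orbit_le hT (le_max_right _ _) f g)
  rw [dualPair_avg hT hi, dualPair_avg hT (integrableOn_phi (add_pos hs ht) hα0 hα1)]
  refine Eq.trans ?_ (key.symm.trans ?_)
  · refine setIntegral_congr_fun measurableSet_Ioi fun u hu => ?_
    have hu : 0 < u := hu
    simp only [max_eq_left hu.le]
  · refine setIntegral_congr_fun measurableSet_Ioi fun u hu => ?_
    have hu : 0 < u := hu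
    simp only [avg_comm hT hu.le hi', dualPair_avg hT hi']
    congr 1
    refine setIntegral_congr_fun measurableSet_Ioi fun v hv => ?_
    have hv : 0 < v := hv
    simp only [max_eq_left (add_pos hu hv).le]
    rw [add_comm u v, hT.map_add v u hv.le hu.le]

lemma tendsto_subord_zero (f : Linf μ) :
    TendstoWeakStar (fun t => subord T α t f) (𝓝[>] 0) f := by
  rw [tendstoWeakStar_iff]
  intro g
  set m : ℝ → ℂ := fun u => dualPair μ (T (max u 0) f) g with hm
  have hmm : Measurable m := measurable_orbit hT f g
  have hi := integrableOn_phi one_pos hα0 hα1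
  -- the scaling `φ_t(u) du = φ_1(v) dv`, `u = t^{1/α} v`
  have key : ∀ t : ℝ, 0 < t → dualPair μ (subord T α t f) g =
      ∫ v in Ioi (0 : ℝ), (phi 1 α v : ℂ) * m (t ^ (1 / α) * v) := by
    intro t ht
    have hr : 0 < t ^ (1 / α) := Real.rpow_pos_of_pos ht _
    rw [subord_eq_avg ht.ne', dualPair_avg hT (integrableOn_phi ht hα0 hα1)]
    have e1 := integral_comp_mul_left_Ioi (fun u => (phi t α u : ℂ) * m u) 0 hr
    rw [mul_zero] at e1
    have e2 : ∫ u in Ioi (0 : ℝ), (phi t α u : ℂ) * dualPair μ (T u f) g =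
        ∫ u in Ioi (0 : ℝ), (phi t α u : ℂ) * m u := by
      refine setIntegral_congr_fun measurableSet_Ioi fun u hu => ?_
      have hu : 0 < u := hu
      simp only [hm, max_eq_left hu.le]
    have e3 : ∫ v in Ioi (0 : ℝ), (phi 1 α v : ℂ) * m (t ^ (1 / α) * v) =
        (t ^ (1 / α)) • ∫ v in Ioi (0 : ℝ), (phi t α (t ^ (1 / α) * v) : ℂ) *
          m (t ^ (1 / α) * v) := by
      rw [← integral_smul]
      refine setIntegral_congr_fun measurableSet_Ioi fun v hv => ?_
      simp only [← phi_scaling ht hα0 hα1 hv, Complex.real_smul]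
      push_cast
      ring
    rw [e2, e3, e1, smul_smul, mul_inv_cancel₀ hr.ne', one_smul]
  have hlim : Tendsto (fun t : ℝ => ∫ v in Ioi (0 : ℝ), (phi 1 α v : ℂ) * m (t ^ (1 / α) * v))
      (𝓝[>] 0) (𝓝 (∫ v in Ioi (0 : ℝ), (phi 1 α v : ℂ) * dualPair μ f g)) := by
    refine tendsto_integral_filter_of_dominated_convergence
      (fun v => ‖phi 1 α v‖ * (‖f‖ * ‖g‖)) (Eventually.of_forall fun t => ?_)
      (Eventually.of_forall fun t => ae_of_all _ fun v => ?_) (hi.norm.mul_const _) ?_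
    · exact hi.ofReal.aestronglyMeasurable.mul
        (hmm.comp (measurable_const_mul _)).aestronglyMeasurable
    · rw [norm_mul, Complex.norm_real]
      gcongr
      exact norm_dualPair_orbit_le hT (le_max_right _ _) f g
    · filter_upwards [ae_restrict_mem measurableSet_Ioi] with v hv
      have hv : 0 < v := hv
      refine Tendsto.const_mul _ ?_
      have h1 := tendstoWeakStar_iff.1 (hT.tendsto_zero f) g
      have h2 : Tendsto (fun t : ℝ => t ^ (1 / α) * v) (𝓝[>] 0) (𝓝[>] 0) := by
        refine tendsto_nhdsWithin_iff.2 ⟨?_, ?_⟩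
        · have h3 : ContinuousAt (fun t : ℝ => t ^ (1 / α) * v) 0 :=
            (Real.continuousAt_rpow_const _ _ (Or.inr (by positivity))).mul_const v
          have h4 := h3.tendsto.mono_left (nhdsWithin_le_nhds (s := Ioi 0))
          rwa [Real.zero_rpow (by positivity), zero_mul] at h4
        · filter_upwards [self_mem_nhdsWithin] with t ht
          exact mul_pos (Real.rpow_pos_of_pos ht _) hv
      refine (h1.comp h2).congr' ?_
      filter_upwards [self_mem_nhdsWithin] with t ht
      have h3 : 0 < t ^ (1 / α) * v := mul_pos (Real.rpow_pos_of_pos ht _) hv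
      simp only [hm, Function.comp_apply, max_eq_left h3.le]
  rw [integral_mul_const, integral_complex_ofReal, integral_phi one_pos hα0 hα1,
    Complex.ofReal_one, one_mul] at hlim
  refine hlim.congr' ?_
  filter_upwards [self_mem_nhdsWithin] with t ht
  exact (key t ht).symm

lemma hasDerivAt_subord {a : ℝ} (ha : 0 < a) (f : Linf μ) :
    HasDerivAt (fun s => subord T α s f)
      ((1 / (1 - α) / a) • avg T (stableKernel profileDeriv α a) f) a := by
  set A := avg T (stableKernel profileDeriv α a) f with hA
  set κ : ℝ → ℝ := fun s => (s / a) ^ (1 / (1 - α)) with hκ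
  have hκ1 : κ a = 1 := by simp [hκ, ha.ne']
  have hκd : HasDerivAt κ (1 / (1 - α) / a) a := by
    have h1 : HasDerivAt (fun s : ℝ => s / a) (1 / a) a := (hasDerivAt_id a).div_const a
    have h2 := h1.rpow_const (p := 1 / (1 - α)) (Or.inl (by simp [ha.ne']))
    refine h2.congr_deriv ?_
    rw [div_self ha.ne', Real.one_rpow]
    ring
  have hG : HasDerivAt (fun s => avg T (phi a α) f + (κ s - 1) • A) ((1 / (1 - α) / a) • A) a :=
    ((hκd.sub_const 1).smul_const A).const_add _
  have hK := integrableOn_stableKernel ha hα0 hα1 measurable_profileDeriv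
    integrableOn_profileDeriv_div
  have hE : (fun s => subord T α s f - (avg T (phi a α) f + (κ s - 1) • A)) =O[𝓝 a]
      fun s => ‖s - a‖ ^ 2 := by
    have h1 : (fun s => κ s - 1) =O[𝓝 a] fun s => ‖s - a‖ := by
      have := hκd.isBigO_sub
      rw [hκ1] at this
      exact this.norm_right
    refine Asymptotics.IsBigO.trans ?_ (h1.pow 2)
    refine Asymptotics.IsBigO.of_bound (taylorConst * ‖f‖) ?_
    have h2 : ∀ᶠ s in 𝓝 a, |κ s - 1| < 1 / 2 := by
      have h3 : Tendsto (fun s => |κ s - 1|) (𝓝 a) (𝓝 |κ a - 1|) :=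
        ((hκd.continuousAt.tendsto).sub_const 1).abs
      rw [hκ1, sub_self, abs_zero] at h3
      exact h3.eventually_lt_const (by norm_num)
    filter_upwards [h2, lt_mem_nhds ha] with s hs hs0
    have hi := integrableOn_phi hs0 hα0 hα1
    have hi' := integrableOn_phi ha hα0 hα1
    have h4 := norm_avg_le hT ((hi.sub hi').sub (hK.const_mul (κ s - 1))) f
    have h5 := avg_linear_weight hT hi hi' hK (κ s - 1) f
    rw [subord_eq_avg hs0.ne', ← sub_sub, hA, ← h5]
    refine h4.trans ?_
    have h6 := integral_abs_phi_sub_le ha hα0 hα1 hs0 (κ := κ s) rfl hs.le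
    rw [norm_pow, Real.norm_eq_abs, sq_abs]
    calc _ ≤ (κ s - 1) ^ 2 * taylorConst * ‖f‖ := by
          gcongr
          exact h6
      _ = _ := by ring
  have hE' := (hE.hasFDerivAt (by norm_num)).hasDerivAt
  refine ((hG.add hE').congr_deriv (by simp)).congr_of_eventuallyEq (Eventually.of_forall fun s => ?_)
  simp

lemma carre_orbit_le (hΓ : GammaTwo fun t f => T t f) {v y : ℝ} (hv : 0 < v) (hy : 0 < y)
    (h : Linf μ) : carre (subord T α y) (T v h) ≤ T v (carre (subord T α y) h) := by
  have hi := integrableOn_phi hy hα0 hα1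
  have he : EqOn (fun u => phi y α u ^ 2 / phi y α u) (phi y α) (Ioi 0) := fun u hu => by
    have := (phi_pos hy hα0 hα1 hu).ne'
    simp only; field_simp
  have h1 := carre_avg_le hT (hT.positive v hv.le) (hT.contraction v hv.le)
    (commutesAvg_self hT hv.le) hi (fun u hu => phi_pos hy hα0 hα1 hu) hi
    ((integrableOn_congr_fun he measurableSet_Ioi).2 hi)
    (by rw [setIntegral_congr_fun measurableSet_Ioi he, integral_phi hy hα0 hα1])
    h (fun u hu => hΓ v u hv hu h)
  have hl : ∀ f f', avg T (phi y α) (f - f') = avg T (phi y α) f - avg T (phi y α) f' :=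
    map_sub (avgL hT hi)
  simp only [carre, subord_eq_avg hy.ne', hl, map_sub, avg_comm hT hv.le hi] at h1 ⊢
  rw [sub_le_sub_iff] at h1 ⊢
  rw [add_comm]
  exact h1

lemma exists_linear_subord {t : ℝ} (ht : 0 < t) :
    ∃ P : Linf μ →L[ℂ] Linf μ, subord T α t = P := by
  refine ⟨avgL hT (integrableOn_phi ht hα0 hα1), funext fun f => ?_⟩
  rw [subord_eq_avg ht.ne', avgL_apply]

lemma carre_subord_avg_le (hΓ : GammaTwo fun t f => T t f) {y s : ℝ} (hy : 0 < y) (hs : 0 < s)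
    {ψ : ℝ → ℝ} (hψ : IntegrableOn ψ (Ioi 0))
    (hi : IntegrableOn (fun u => ψ u ^ 2 / phi s α u) (Ioi 0))
    (hi1 : ∫ u in Ioi (0 : ℝ), ψ u ^ 2 / phi s α u ≤ 1) (h : Linf μ) :
    carre (subord T α y) (avg T ψ h) ≤ subord T α s (carre (subord T α y) h) := by
  obtain ⟨P, he⟩ := exists_linear_subord hT hα0 hα1 hy
  have hC : CommutesAvg T (subord T α y) := by
    have := commutesAvg_avg hT (integrableOn_phi hy hα0 hα1)
    have e : subord T α y = avg T (phi y α) := funext fun f => subord_eq_avg hy.ne' f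
    rwa [← e] at this
  rw [subord_eq_avg hs.ne', he]
  rw [he] at hC
  refine carre_avg_le (P := P.toLinearMap) hT (fun f hf => ?_) (fun f => ?_) hC
    (integrableOn_phi hs hα0 hα1) (fun u hu => phi_pos hs hα0 hα1 hu) hψ hi hi1 h fun u hu => ?_
  · exact he ▸ subord_nonneg hT hα0 hα1 hy hf
  · exact he ▸ norm_subord_le hT hα0 hα1 hy f
  · exact he ▸ carre_orbit_le hT hα0 hα1 hΓ hu hy h

lemma isRegularSemigroup_subord (hΓ : GammaTwo fun t f => T t f) :
    IsRegularSemigroup (subord T α) (1 / (1 - α)) where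
  linear t ht := exists_linear_subord hT hα0 hα1 ht
  positive t ht f hf := subord_nonneg hT hα0 hα1 ht hf
  contraction t ht f := norm_subord_le hT hα0 hα1 ht f
  map_add s t hs ht f := subord_add hT hα0 hα1 hs ht f
  tendsto_zero f := tendsto_subord_zero hT hα0 hα1 f
  seq_continuous t ht F f C hF hf := by
    simp only [subord_eq_avg ht.ne']
    exact tendsto_avg hT (integrableOn_phi ht hα0 hα1) hF hf
  gammaTwo t u ht hu f := by
    have hi := integrableOn_phi hu hα0 hα1
    have he : EqOn (fun v => phi u α v ^ 2 / phi u α v) (phi u α) (Ioi 0) := fun v hv => by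
      have := (phi_pos hu hα0 hα1 hv).ne'
      simp only; field_simp
    have := carre_subord_avg_le hT hα0 hα1 hΓ ht hu hi
      ((integrableOn_congr_fun he measurableSet_Ioi).2 hi)
      (by rw [setIntegral_congr_fun measurableSet_Ioi he, integral_phi hu hα0 hα1]) f
    rw [← subord_eq_avg hu.ne'] at this
    exact this
  deriv a ha := by
    have hK := integrableOn_stableKernel ha hα0 hα1 measurable_profileDeriv
      integrableOn_profileDeriv_div
    refine ⟨((1 / (1 - α) / a : ℝ) : ℂ) • avgL hT hK, fun f => hasDerivAt_subord hT hα0 hα1 ha f,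
      fun y hy f => ?_⟩
    obtain ⟨h1, h2⟩ := fisher_bound ha hα0 hα1
    have h3 := carre_subord_avg_le hT hα0 hα1 hΓ hy ha hK h1 h2 f
    obtain ⟨P, he⟩ := exists_linear_subord hT hα0 hα1 hy
    have h4 : carre (subord T α y) (((1 / (1 - α) / a : ℝ) : ℂ) • avg T
        (stableKernel profileDeriv α a) f) = (1 / (1 - α) / a) ^ 2 • carre (subord T α y)
          (avg T (stableKernel profileDeriv α a) f) := by
      rw [he]; exact carre_smul (P := P.toLinearMap) _ _
    refine (le_of_eq h4).trans ?_
    exact real_smul_le_smul (sq_nonneg _) h3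

end subordination

end averages

end

section

/-! ### Time derivatives -/

/-- The derivative at time `a` of the orbit `t ↦ S_t f`. -/
def derivOp (S : ℝ → Linf μ → Linf μ) (a : ℝ) (f : Linf μ) : Linf μ := deriv (fun s => S s f) a

variable {S : ℝ → Linf μ → Linf μ} {p : ℝ}

namespace IsRegularSemigroup

variable (hS : IsRegularSemigroup S p)

include hS

lemma hasDerivAt {a : ℝ} (ha : 0 < a) (f : Linf μ) :
    HasDerivAt (fun s => S s f) (derivOp S a f) a := by
  obtain ⟨R, hR, -⟩ := hS.deriv a ha
  exact (hR f).differentiableAt.hasDerivAt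

lemma carre_derivOp_le {a y : ℝ} (ha : 0 < a) (hy : 0 < y) (f : Linf μ) :
    carre (S y) (derivOp S a f) ≤ ((p / a) ^ 2) • S a (carre (S y) f) := by
  obtain ⟨R, hR, hR2⟩ := hS.deriv a ha
  rw [derivOp, (hR f).deriv]
  exact hR2 y hy f

lemma map_real_smul {t : ℝ} (ht : 0 < t) (c : ℝ) (f : Linf μ) : S t (c • f) = c • S t f := by
  obtain ⟨P, hP⟩ := hS.linear t ht
  rw [hP, ← ofReal_smul_eq, ← ofReal_smul_eq, map_smul]

lemma map_sub {t : ℝ} (ht : 0 < t) (f f' : Linf μ) : S t (f - f') = S t f - S t f' := by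
  obtain ⟨P, hP⟩ := hS.linear t ht
  rw [hP, _root_.map_sub]

lemma mono {t : ℝ} (ht : 0 < t) {f f' : Linf μ} (h : f ≤ f') : S t f ≤ S t f' := by
  rw [← sub_nonneg, ← hS.map_sub ht]
  exact hS.positive t ht _ (sub_nonneg.2 h)

lemma map_star {t : ℝ} (ht : 0 < t) (f : Linf μ) : S t (star f) = star (S t f) := by
  obtain ⟨P, hP⟩ := hS.linear t ht
  have := hS.positive t ht
  rw [hP] at this ⊢
  exact map_star_of_positive (P := P.toLinearMap) this f

lemma carre_nonneg {y : ℝ} (hy : 0 < y) (f : Linf μ) : 0 ≤ carre (S y) f := by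
  obtain ⟨P, hP⟩ := hS.linear y hy
  have h1 := hS.positive y hy
  have h2 := hS.contraction y hy
  rw [hP] at h1 h2 ⊢
  exact SubordGamma.carre_nonneg (P := P.toLinearMap) h1 h2 f

lemma carre_smul {y : ℝ} (hy : 0 < y) (c : ℝ) (f : Linf μ) :
    carre (S y) (c • f) = (c ^ 2) • carre (S y) f := by
  obtain ⟨P, hP⟩ := hS.linear y hy
  rw [hP]
  exact SubordGamma.carre_smul (P := P.toLinearMap) c f

lemma derivOp_eq {a r : ℝ} (ha : 0 < a) (har : a < r) (f : Linf μ) :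
    derivOp S r f = S (r - a) (derivOp S a f) := by
  have hra : 0 < r - a := sub_pos.2 har
  obtain ⟨P, hP⟩ := hS.linear (r - a) hra
  have h1 : HasDerivAt (fun s => S s f) (derivOp S a f) (r - (r - a)) := by
    rw [sub_sub_cancel]; exact hS.hasDerivAt ha f
  have h2 := h1.comp_sub_const r (r - a)
  have h3 := ((P.restrictScalars ℝ).hasFDerivAt (x := S (r - (r - a)) f)).comp_hasDerivAt r h2
  rw [hP]
  refine HasDerivAt.deriv (h3.congr_of_eventuallyEq ?_)
  filter_upwards [lt_mem_nhds (show r - a < r by linarith)] with s hs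
  have := hS.map_add (r - a) (s - (r - a)) hra (by linarith) f
  rw [add_sub_cancel] at this
  rw [this, hP]
  rfl

lemma contDiffOn (f : Linf μ) : ContDiffOn ℝ ∞ (fun s => S s f) (Ioi 0) := by
  rw [contDiffOn_infty]
  intro n
  induction n generalizing f with
  | zero =>
    rw [Nat.cast_zero, contDiffOn_zero]
    exact fun a ha => (hS.hasDerivAt ha f).continuousAt.continuousWithinAt
  | succ n ih =>
    rw [Nat.cast_succ, contDiffOn_succ_iff_deriv_of_isOpen isOpen_Ioi]
    refine ⟨fun a ha => (hS.hasDerivAt ha f).differentiableAt.differentiableWithinAt,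
      fun h => by simp at h, fun r hr => ContDiffAt.contDiffWithinAt ?_⟩
    have hr : 0 < r := hr
    have h1 : ContDiffAt ℝ n (fun s => S s (derivOp S (r / 2) f)) (r - r / 2) :=
      (ih (derivOp S (r / 2) f)).contDiffAt (Ioi_mem_nhds (by linarith))
    have h2 : ContDiffAt ℝ n (fun s => S (s - r / 2) (derivOp S (r / 2) f)) r :=
      h1.comp r (contDiffAt_id.sub contDiffAt_const)
    refine h2.congr_of_eventuallyEq ?_
    filter_upwards [lt_mem_nhds (show r / 2 < r by linarith)] with s hs
    exact hS.derivOp_eq (by linarith) hs f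

lemma iteratedDeriv_eq {a : ℝ} (ha : 0 < a) (f : Linf μ) (n : ℕ) {s : ℝ} (hs : n * a < s) :
    iteratedDeriv n (fun r => S r f) s = S (s - n * a) ((derivOp S a)^[n] f) ∧
      iteratedDeriv (n + 1) (fun r => S r f) s = derivOp S (s - n * a) ((derivOp S a)^[n] f) := by
  have key : ∀ n : ℕ, (∀ s : ℝ, n * a < s →
      iteratedDeriv n (fun r => S r f) s = S (s - n * a) ((derivOp S a)^[n] f)) →
      ∀ s : ℝ, n * a < s →
      iteratedDeriv (n + 1) (fun r => S r f) s = derivOp S (s - n * a) ((derivOp S a)^[n] f) := by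
    intro n hn s hs
    rw [iteratedDeriv_succ]
    have h1 := (hS.hasDerivAt (sub_pos.2 hs) ((derivOp S a)^[n] f)).comp_sub_const s (n * a)
    refine HasDerivAt.deriv (h1.congr_of_eventuallyEq ?_)
    filter_upwards [lt_mem_nhds hs] with r hr
    exact hn r hr
  have key2 : ∀ n : ℕ, ∀ s : ℝ, n * a < s →
      iteratedDeriv n (fun r => S r f) s = S (s - n * a) ((derivOp S a)^[n] f) := by
    intro n
    induction n with
    | zero => intro s _; simp
    | succ n ih =>
      intro s hs
      push_cast at hs ⊢
      rw [key n ih s (by linarith), hS.derivOp_eq ha (by linarith), Function.iterate_succ_apply']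
      congr 1
      ring
  exact ⟨key2 n s hs, key n (key2 n) s hs⟩

lemma carre_iterate_derivOp_le {a y : ℝ} (ha : 0 < a) (hy : 0 < y) (f : Linf μ) (n : ℕ) :
    carre (S y) ((derivOp S a)^[n + 1] f) ≤
      (((p / a) ^ 2) ^ (n + 1)) • S ((n + 1 : ℕ) * a) (carre (S y) f) := by
  induction n with
  | zero => simpa using hS.carre_derivOp_le ha hy f
  | succ n ih =>
    rw [Function.iterate_succ_apply']
    refine (hS.carre_derivOp_le ha hy _).trans ?_
    have hna : 0 < ((n + 1 : ℕ) : ℝ) * a := by positivity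
    have h1 := hS.mono ha ih
    rw [hS.map_real_smul ha, ← hS.map_add a _ ha hna] at h1
    have h2 := real_smul_le_smul (sq_nonneg (p / a)) h1
    rw [smul_smul, ← pow_succ'] at h2
    refine h2.trans (le_of_eq ?_)
    congr 2
    push_cast
    ring

/-- The estimate for the `j`-th time derivative: `∂_s^j S_s = (∂_a S_a)^j` at `s = j a`. -/
lemma carre_iteratedDeriv_le {y s : ℝ} (hy : 0 < y) (hs : 0 < s) (f : Linf μ) (j : ℕ) :
    carre (S y) (s ^ j • iteratedDeriv j (fun r => S r f) s) ≤
      ((10 * j * p) ^ (2 * j)) • S s (carre (S y) f) := by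
  cases j with
  | zero =>
    simp only [pow_zero, one_smul, iteratedDeriv_zero, mul_zero]
    exact hS.gammaTwo y s hy hs f
  | succ n =>
    have hn : (0 : ℝ) < n + 1 := by positivity
    set a : ℝ := s / (n + 1) with ha
    have ha0 : 0 < a := by positivity
    have hsa : s = (n + 1) * a := by rw [ha]; field_simp
    have h1 := (hS.iteratedDeriv_eq ha0 f n (s := s) (by rw [hsa]; linarith)).2
    have h2 : s - n * a = a := by rw [hsa]; ring
    rw [h1, h2, ← Function.iterate_succ_apply' (derivOp S a), hS.carre_smul hy]
    have h3 := real_smul_le_smul (sq_nonneg (s ^ (n + 1)))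
      (hS.carre_iterate_derivOp_le ha0 hy f n)
    have h4 : ((n + 1 : ℕ) : ℝ) * a = s := by rw [hsa]; push_cast; ring
    rw [smul_smul, h4] at h3
    refine h3.trans ?_
    have h5 : (s ^ (n + 1)) ^ 2 * ((p / a) ^ 2) ^ (n + 1) = ((n + 1) * p) ^ (2 * (n + 1)) := by
      rw [← pow_mul, ← pow_mul, mul_comm (n + 1) 2, ← mul_pow, hsa]
      congr 1
      field_simp
    have h6 : ((n + 1) * p) ^ (2 * (n + 1)) ≤ (10 * ((n + 1 : ℕ) : ℝ) * p) ^ (2 * (n + 1)) := by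
      have h7 : 10 * ((n + 1 : ℕ) : ℝ) * p = 10 * ((n + 1) * p) := by push_cast; ring
      rw [h7, mul_pow 10]
      exact le_mul_of_one_le_left (Even.pow_nonneg (even_two_mul _) _)
        (one_le_pow₀ (by norm_num))
    rw [h5, ← sub_nonneg, ← sub_smul]
    have h8 := real_smul_le_smul (sub_nonneg.2 h6) (hS.positive s hs _ (hS.carre_nonneg hy f))
    rwa [smul_zero] at h8

end IsRegularSemigroup

end

/-! ### The gradient form as a limit -/

lemma tendstoWeakStar_of_tendsto {ι : Type*} {F : ι → Linf μ} {l : Filter ι} {f : Linf μ}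
    (h : Tendsto F l (𝓝 f)) : TendstoWeakStar F l f :=
  tendstoWeakStar_iff.2 fun g => (((dualPair μ).flip g).continuous.tendsto f).comp h

lemma TendstoWeakStar.mul_left {ι : Type*} {F : ι → Linf μ} {l : Filter ι} {f : Linf μ}
    (h : TendstoWeakStar F l f) (k : Linf μ) :
    TendstoWeakStar (fun i => mul k (F i)) l (mul k f) := by
  rw [tendstoWeakStar_iff] at h ⊢
  intro g
  simp only [dualPair_mul]
  exact h _

lemma TendstoWeakStar.add {ι : Type*} {F F' : ι → Linf μ} {l : Filter ι} {f f' : Linf μ}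
    (h : TendstoWeakStar F l f) (h' : TendstoWeakStar F' l f') :
    TendstoWeakStar (fun i => F i + F' i) l (f + f') := by
  rw [tendstoWeakStar_iff] at h h' ⊢
  intro g
  simp only [map_add, add_apply]
  exact (h g).add (h' g)

lemma TendstoWeakStar.const_smul {ι : Type*} {F : ι → Linf μ} {l : Filter ι} {f : Linf μ}
    (h : TendstoWeakStar F l f) (c : ℝ) :
    TendstoWeakStar (fun i => c • F i) l (c • f) := by
  rw [tendstoWeakStar_iff] at h ⊢
  intro g
  simp only [dualPair_real_smul]
  exact (h g).const_mul _

lemma TendstoWeakStar.comp {ι κ : Type*} {F : ι → Linf μ} {l : Filter ι} {f : Linf μ}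
    (h : TendstoWeakStar F l f) {u : κ → ι} {l' : Filter κ} (hu : Tendsto u l' l) :
    TendstoWeakStar (fun i => F (u i)) l' f :=
  fun g => (h g).comp hu

lemma TendstoWeakStar.exists_norm_le [SigmaFinite μ] {F : ℕ → Linf μ} {f : Linf μ}
    (h : TendstoWeakStar F atTop f) : ∃ C, ∀ n, ‖F n‖ ≤ C :=
  exists_norm_le_of_tendsto fun g => ⟨_, tendstoWeakStar_iff.1 h g⟩

lemma TendstoWeakStar.le [SigmaFinite μ] {ι : Type*} {F F' : ι → Linf μ} {l : Filter ι} [l.NeBot]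
    {f f' : Linf μ} (h : TendstoWeakStar F l f) (h' : TendstoWeakStar F' l f')
    (hle : ∀ i, F i ≤ F' i) : f ≤ f' :=
  le_of_dualPair fun g hg => le_of_tendsto_of_tendsto (tendstoWeakStar_iff.1 h g)
    (tendstoWeakStar_iff.1 h' g) (Eventually.of_forall fun i => dualPair_le (hle i) hg)

lemma isNegGen_negGen {S : ℝ → Linf μ → Linf μ} {f : Linf μ} (h : InDomain S f) :
    IsNegGen S f (negGen S f) := by
  rw [negGen, dif_pos h]
  exact h.choose_spec

/-- A sequence of positive times tending to `0`. Along a sequence, weak* convergent difference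
quotients are bounded. -/
def smallTime (n : ℕ) : ℝ := 1 / (n + 1)

lemma smallTime_pos (n : ℕ) : 0 < smallTime n := by unfold smallTime; positivity

lemma tendsto_smallTime : Tendsto smallTime atTop (𝓝[>] 0) :=
  tendsto_nhdsWithin_iff.2 ⟨tendsto_one_div_add_atTop_nhds_zero_nat,
    Eventually.of_forall smallTime_pos⟩

namespace IsRegularSemigroup

variable {S : ℝ → Linf μ → Linf μ} {p : ℝ} [SigmaFinite μ] (hS : IsRegularSemigroup S p)

include hS

lemma tendsto_gammaForm {f : Linf μ} (hf : GammaDefined S f f) :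
    TendstoWeakStar (fun n => (1 / 2 : ℝ) • (smallTime n)⁻¹ • carre (S (smallTime n)) f) atTop
      (gammaForm S f f) := by
  obtain ⟨h1, h2, h3⟩ := hf
  set D : Linf μ → ℕ → Linf μ := fun k n => (smallTime n)⁻¹ • (k - S (smallTime n) k) with hD
  have hlim : ∀ {k}, InDomain S k → TendstoWeakStar (D k) atTop (negGen S k) := fun hk =>
    (isNegGen_negGen hk).comp tendsto_smallTime
  obtain ⟨C, hC⟩ := (hlim h2).exists_norm_le
  obtain ⟨C', hC'⟩ := (hlim h1).exists_norm_le
  have hC0 : 0 ≤ C := (norm_nonneg _).trans (hC 0)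
  have hC0' : 0 ≤ C' := (norm_nonneg _).trans (hC' 0)
  -- the product of the two increments is of second order
  have hrem : Tendsto (fun n => smallTime n • mul (D (star f) n) (D f n)) atTop (𝓝 0) := by
    refine squeeze_zero_norm (a := fun n => smallTime n * (C' * C)) (fun n => ?_) ?_
    · rw [norm_smul, Real.norm_of_nonneg (smallTime_pos n).le]
      have := smallTime_pos n
      gcongr
      refine (norm_mul_le _ _).trans ?_
      gcongr
      exacts [hC' n, hC n]
    · simpa using (tendsto_smallTime.mono_right nhdsWithin_le_nhds).mul_const (C' * C)
  have hsum := ((((hlim h3).const_smul (-1)).add ((hlim h1).mul_left f)).add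
    ((hlim h2).mul_left (star f))).add ((tendstoWeakStar_of_tendsto hrem).const_smul (-1))
  have hfin := hsum.const_smul (1 / 2)
  have e1 : gammaForm S f f = (1 / 2 : ℝ) • ((-1 : ℝ) • negGen S (mul (star f) f) +
      mul f (negGen S (star f)) + mul (star f) (negGen S f) + (-1 : ℝ) • (0 : Linf μ)) := by
    rw [gammaForm, smul_zero, add_zero, neg_one_smul, mul_comm' f]
  rw [e1]
  convert hfin using 3 with n
  have hy := smallTime_pos n
  have hst := hS.map_star hy f
  simp only [hD, carre, absSq, hst]
  have hD2 : ∀ k l : Linf μ, (-1 : ℝ) • smallTime n • mul ((smallTime n)⁻¹ • k)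
      ((smallTime n)⁻¹ • l) = -((smallTime n)⁻¹ • mul k l) := by
    intro k l
    have h4 : ((smallTime n : ℝ) : ℂ) ≠ 0 := by exact_mod_cast hy.ne'
    simp only [← ofReal_smul_eq, mul_eq_mulL, map_smul, smul_apply, smul_smul]
    rw [← neg_smul]
    congr 1
    push_cast
    field_simp
  have hD1 : ∀ k l : Linf μ, mul k ((smallTime n)⁻¹ • l) = (smallTime n)⁻¹ • mul k l := by
    intro k l
    simp only [← ofReal_smul_eq, mul_eq_mulL, map_smul]
  rw [hD2, hD1, hD1, mul_comm' f, neg_one_smul, ← smul_neg, ← smul_neg, ← smul_add, ← smul_add,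
    ← smul_add]
  congr 1
  simp only [mul_eq_mulL, _root_.map_sub, sub_apply]
  abel

/-- Dividing a Kadison–Schwarz type estimate by the time `y` and letting `y → 0+`. -/
lemma gammaForm_le {f k : Linf μ} (hf : GammaDefined S f f) (hk : GammaDefined S k k) {c s : ℝ}
    (hs : 0 < s) (h : ∀ y, 0 < y → carre (S y) k ≤ c • S s (carre (S y) f)) :
    gammaForm S k k ≤ c • S s (gammaForm S f f) := by
  have h1 := hS.tendsto_gammaForm hf
  obtain ⟨C, hC⟩ := h1.exists_norm_le
  have h2 := (hS.seq_continuous s hs _ _ C hC h1).const_smul c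
  refine (hS.tendsto_gammaForm hk).le h2 fun n => ?_
  have hy := smallTime_pos n
  have h3 := real_smul_le_smul (c := 1 / 2 * (smallTime n)⁻¹) (by positivity) (h _ hy)
  rw [hS.map_real_smul hs, hS.map_real_smul hs, smul_smul]
  refine h3.trans (le_of_eq ?_)
  rw [smul_smul, smul_smul, smul_smul]
  congr 1
  ring

end IsRegularSemigroup

/-! ### The domain of the generator -/

/-- For a nonnegative superadditive function the quotient `a(y) / y` converges as `y → 0+`. -/
lemma exists_tendsto_div_of_superadditive {a : ℝ → ℝ} {c : ℝ} (hc : 0 < c)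
    (h0 : ∀ y, 0 < y → y < c → 0 ≤ a y)
    (hadd : ∀ x y, 0 < x → 0 < y → x + y < c → a x + a y ≤ a (x + y)) :
    ∃ L, Tendsto (fun y => a y / y) (𝓝[>] 0) (𝓝 L) := by
  have hmul : ∀ (n : ℕ) (y : ℝ), 0 < y → (n + 1) * y < c → (n + 1) * a y ≤ a ((n + 1) * y) := by
    intro n y hy
    induction n with
    | zero => intro _; simp
    | succ n ih =>
      intro hlt
      push_cast at hlt ⊢
      have h1 := ih (by nlinarith)
      have h2 := hadd ((n + 1) * y) y (by positivity) hy (by linarith)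
      rw [show ((n : ℝ) + 1 + 1) * y = (n + 1) * y + y by ring]
      linarith
  have hmono : ∀ x y, 0 < x → x ≤ y → y < c → a x ≤ a y := by
    intro x y hx hxy hy
    rcases hxy.eq_or_lt with rfl | hxy
    · exact le_rfl
    · have h1 := hadd x (y - x) hx (sub_pos.2 hxy) (by linarith)
      have h2 := h0 (y - x) (sub_pos.2 hxy) (by linarith)
      rw [add_sub_cancel] at h1
      linarith
  have hcomp : ∀ x y, 0 < y → y < x → x < c → a y / y ≤ a x / (x - y) := by
    intro x y hy hyx hx
    have hx0 : 0 < x := hy.trans hyx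
    obtain ⟨n, hn⟩ : ∃ n : ℕ, ⌊x / y⌋₊ = n + 1 :=
      Nat.exists_eq_succ_of_ne_zero (Nat.floor_pos.2 ((one_le_div hy).2 hyx.le)).ne'
    have h1 : ((n : ℝ) + 1) * y ≤ x := by
      have := Nat.floor_le (div_pos hx0 hy).le
      rw [hn] at this
      push_cast at this
      exact (le_div_iff₀ hy).1 this
    have h2 : x < ((n : ℝ) + 1 + 1) * y := by
      have := Nat.lt_floor_add_one (x / y)
      rw [hn] at this
      push_cast at this
      exact (div_lt_iff₀ hy).1 this
    have h3 := (hmul n y hy (h1.trans_lt hx)).trans (hmono _ x (by positivity) h1 hx)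
    rw [div_le_div_iff₀ hy (sub_pos.2 hyx)]
    have h4 := h0 y hy (hyx.trans hx)
    nlinarith
  set A : Set ℝ := (fun y => a y / y) '' Ioo 0 c with hA
  have hbdd : BddBelow A := ⟨0, by
    rintro _ ⟨y, hy, rfl⟩
    exact div_nonneg (h0 y hy.1 hy.2) hy.1.le⟩
  have hne : A.Nonempty := ⟨_, mem_image_of_mem _ (⟨by linarith, by linarith⟩ : c / 2 ∈ Ioo 0 c)⟩
  refine ⟨sInf A, tendsto_order.2 ⟨fun b hb => ?_, fun b hb => ?_⟩⟩
  · filter_upwards [Ioo_mem_nhdsGT hc] with y hy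
    exact hb.trans_le (csInf_le hbdd (mem_image_of_mem _ hy))
  · obtain ⟨_, ⟨x, hx, rfl⟩, hxb⟩ := exists_lt_of_csInf_lt hne hb
    have h1 : Tendsto (fun y : ℝ => a x / (x - y)) (𝓝[>] 0) (𝓝 (a x / (x - 0))) := by
      refine Tendsto.mono_left ?_ nhdsWithin_le_nhds
      exact tendsto_const_nhds.div (tendsto_const_nhds.sub tendsto_id) (by simpa using hx.1.ne')
    rw [sub_zero] at h1
    filter_upwards [h1.eventually_lt_const hxb, Ioo_mem_nhdsGT hx.1] with y hy1 hy2
    exact (hcomp x y hy2.1 hy2.2 hx.2).trans_lt hy1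

lemma exists_nonneg_decomp (g : Lp ℂ 1 μ) : ∃ k₁ k₂ k₃ : Lp ℂ 1 μ, 0 ≤ k₁ ∧ 0 ≤ k₂ ∧ 0 ≤ k₃ ∧
    g = k₁ + Complex.I • k₂ - (1 + Complex.I) • k₃ := by
  have hg := L1.integrable_coeFn g
  have i1 : Integrable (fun x => (((g x).re + ‖g x‖ : ℝ) : ℂ)) μ := (hg.re.add hg.norm).ofReal
  have i2 : Integrable (fun x => (((g x).im + ‖g x‖ : ℝ) : ℂ)) μ := (hg.im.add hg.norm).ofReal
  have i3 : Integrable (fun x => ((‖g x‖ : ℝ) : ℂ)) μ := hg.norm.ofReal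
  refine ⟨i1.toL1 _, i2.toL1 _, i3.toL1 _, ?_, ?_, ?_, ?_⟩
  · rw [← Lp.coeFn_nonneg]
    filter_upwards [i1.coeFn_toL1] with x hx
    rw [hx, Pi.zero_apply]
    exact_mod_cast neg_le_iff_add_nonneg'.1 ((neg_le_abs _).trans (Complex.abs_re_le_norm (g x)))
  · rw [← Lp.coeFn_nonneg]
    filter_upwards [i2.coeFn_toL1] with x hx
    rw [hx, Pi.zero_apply]
    exact_mod_cast neg_le_iff_add_nonneg'.1 ((neg_le_abs _).trans (Complex.abs_im_le_norm (g x)))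
  · rw [← Lp.coeFn_nonneg]
    filter_upwards [i3.coeFn_toL1] with x hx
    rw [hx, Pi.zero_apply]
    exact_mod_cast norm_nonneg _
  · refine Lp.ext ?_
    filter_upwards [Lp.coeFn_sub (i1.toL1 _ + Complex.I • i2.toL1 _)
      ((1 + Complex.I) • i3.toL1 _), Lp.coeFn_add (i1.toL1 _) (Complex.I • i2.toL1 _),
      Lp.coeFn_smul Complex.I (i2.toL1 _), Lp.coeFn_smul (1 + Complex.I) (i3.toL1 _),
      i1.coeFn_toL1, i2.coeFn_toL1, i3.coeFn_toL1] with x h1 h2 h3 h4 h5 h6 h7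
    rw [h1, Pi.sub_apply, h2, Pi.add_apply, h3, h4, Pi.smul_apply, Pi.smul_apply, h5, h6, h7]
    conv_lhs => rw [← Complex.re_add_im (g x)]
    push_cast
    simp only [smul_eq_mul]
    ring

/-- If `⟨F_y, g⟩` converges as `y → 0+` for each nonnegative `g ∈ L^1`, then `F_y` converges
weak*. -/
lemma exists_tendstoWeakStar [SigmaFinite μ] {F : ℝ → Linf μ}
    (h : ∀ g : Lp ℂ 1 μ, 0 ≤ g → ∃ z, Tendsto (fun y => dualPair μ (F y) g) (𝓝[>] 0) (𝓝 z)) :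
    ∃ f, TendstoWeakStar F (𝓝[>] 0) f := by
  have hall : ∀ g : Lp ℂ 1 μ, ∃ z, Tendsto (fun y => dualPair μ (F y) g) (𝓝[>] 0) (𝓝 z) := by
    intro g
    obtain ⟨k₁, k₂, k₃, h₁, h₂, h₃, hg⟩ := exists_nonneg_decomp g
    obtain ⟨z₁, hz₁⟩ := h k₁ h₁
    obtain ⟨z₂, hz₂⟩ := h k₂ h₂
    obtain ⟨z₃, hz₃⟩ := h k₃ h₃
    refine ⟨z₁ + Complex.I * z₂ - (1 + Complex.I) * z₃, ?_⟩
    simp only [hg, map_sub, map_add, map_smul, smul_eq_mul]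
    exact (hz₁.add (hz₂.const_mul _)).sub (hz₃.const_mul _)
  choose z hz using hall
  have hzn : ∀ g, Tendsto (fun n => dualPair μ (F (smallTime n)) g) atTop (𝓝 (z g)) :=
    fun g => (hz g).comp tendsto_smallTime
  obtain ⟨C, hC⟩ := exists_norm_le_of_tendsto fun g => ⟨_, hzn g⟩
  let ℓ : Lp ℂ 1 μ →ₗ[ℂ] ℂ :=
    { toFun := z
      map_add' := fun g g' => tendsto_nhds_unique (hz (g + g'))
        (by simpa only [map_add] using (hz g).add (hz g'))
      map_smul' := fun c g => tendsto_nhds_unique (hz (c • g))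
        (by simpa only [map_smul, RingHom.id_apply] using (hz g).const_smul c) }
  obtain ⟨f, -, hf⟩ := exists_dualPair_eq (ℓ.mkContinuous C fun g => by
    refine le_of_tendsto (hzn g).norm (Eventually.of_forall fun n => ?_)
    refine (norm_dualPair_le _ _).trans ?_
    gcongr
    exact hC n)
  refine ⟨f, tendstoWeakStar_iff.2 fun g => ?_⟩
  rw [hf g]
  exact hz g

lemma tendsto_mul {ι : Type*} {l : Filter ι} {F F' : ι → Linf μ} {k k' : Linf μ}
    (h : Tendsto F l (𝓝 k)) (h' : Tendsto F' l (𝓝 k')) :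
    Tendsto (fun i => mul (F i) (F' i)) l (𝓝 (mul k k')) := by
  rw [tendsto_iff_norm_sub_tendsto_zero] at h ⊢
  have hlim := (h.mul h'.norm).add ((tendsto_iff_norm_sub_tendsto_zero.1 h').const_mul ‖k‖)
  rw [zero_mul, mul_zero, add_zero] at hlim
  refine squeeze_zero (fun i => norm_nonneg _) (fun i => ?_) hlim
  have e : mul (F i) (F' i) - mul k k' = mul (F i - k) (F' i) + mul k (F' i - k') := by
    simp only [mul_eq_mulL, map_sub, sub_apply]
    abel
  rw [e]
  exact (norm_add_le _ _).trans (add_le_add (norm_mul_le _ _) (norm_mul_le _ _))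

namespace IsRegularSemigroup

variable {S : ℝ → Linf μ → Linf μ} {p : ℝ} (hS : IsRegularSemigroup S p)

include hS

lemma inDomain {t : ℝ} (ht : 0 < t) (f : Linf μ) : InDomain S (S t f) := by
  refine ⟨-derivOp S t f, tendstoWeakStar_of_tendsto ?_⟩
  refine ((hS.hasDerivAt ht f).tendsto_slope_zero_right.neg).congr' ?_
  filter_upwards [self_mem_nhdsWithin] with y hy
  rw [← hS.map_add y t hy ht, add_comm y t, ← smul_neg, neg_sub]

/-- Here `carre S_y (S_{c-y} f)` is the increment between the times `0` and `y` of the function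
`y ↦ S_y |S_{c-y} f|²`, whose increments over intervals of a fixed length are nondecreasing by the
criterion `Γ² ≥ 0`. -/
lemma carre_superadditive {c x y : ℝ} (hx : 0 < x) (hy : 0 < y) (hxy : x + y < c) (f : Linf μ) :
    carre (S x) (S (c - x) f) + carre (S y) (S (c - y) f) ≤
      carre (S (x + y)) (S (c - (x + y)) f) := by
  have e1 : S (c - x) f = S y (S (c - (x + y)) f) := by
    rw [← hS.map_add y _ hy (by linarith)]; congr 1; ring
  have e2 : S (c - y) f = S x (S (c - (x + y)) f) := by
    rw [← hS.map_add x _ hx (by linarith)]; congr 1; ring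
  set k := S (c - (x + y)) f
  rw [e1, e2]
  have h1 := hS.gammaTwo y x hy hx k
  have h2 : carre (S (x + y)) k = carre (S x) (S y k) + S x (carre (S y) k) := by
    simp only [carre]
    rw [hS.map_sub hx, hS.map_add x y hx hy, hS.map_add x y hx hy]
    abel
  rw [h2]
  gcongr
  exact h1

variable [SigmaFinite μ]

/-- The weak* limit of the difference quotients of `y ↦ S_y |S_{c-y} f|²` at `y = 0`. -/
lemma exists_tendsto_carre {c : ℝ} (hc : 0 < c) (f : Linf μ) :
    ∃ k, TendstoWeakStar (fun y : ℝ => y⁻¹ • carre (S y) (S (c - y) f)) (𝓝[>] 0) k := by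
  refine exists_tendstoWeakStar fun g hg => ?_
  set a : ℝ → ℝ := fun y => (dualPair μ (carre (S y) (S (c - y) f)) g).re with ha
  have hnn : ∀ y, 0 < y → 0 ≤ dualPair μ (carre (S y) (S (c - y) f)) g := fun y hy =>
    dualPair_nonneg (hS.carre_nonneg hy _) hg
  obtain ⟨L, hL⟩ := exists_tendsto_div_of_superadditive (a := a) hc
    (fun y hy _ => (Complex.le_def.1 (hnn y hy)).1) (fun x y hx hy hxy => by
      have h1 := dualPair_le (hS.carre_superadditive hx hy hxy f) hg
      rw [_root_.map_add, add_apply] at h1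
      exact (Complex.le_def.1 h1).1)
  refine ⟨L, ((Complex.continuous_ofReal.tendsto L).comp hL).congr' ?_⟩
  filter_upwards [self_mem_nhdsWithin] with y hy
  have h2 : dualPair μ (carre (S y) (S (c - y) f)) g = (a y : ℂ) :=
    Complex.ext rfl (Complex.le_def.1 (hnn y hy)).2.symm
  rw [dualPair_real_smul, h2, Function.comp_apply, div_eq_inv_mul]
  push_cast
  rfl

omit [SigmaFinite μ] in
lemma tendsto_smul_apply {q : ℝ → Linf μ} {k : Linf μ} (hq : Tendsto q (𝓝[>] 0) (𝓝 k)) :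
    TendstoWeakStar (fun y => S y (q y)) (𝓝[>] 0) k := by
  have h1 : Tendsto (fun y => S y (q y - k)) (𝓝[>] 0) (𝓝 0) := by
    refine squeeze_zero_norm' ?_ (tendsto_iff_norm_sub_tendsto_zero.1 hq)
    filter_upwards [self_mem_nhdsWithin] with y hy
    exact hS.contraction y hy _
  have h2 := (tendstoWeakStar_of_tendsto h1).add (hS.tendsto_zero k)
  rw [zero_add] at h2
  refine fun g => (h2 g).congr' ?_
  filter_upwards [self_mem_nhdsWithin] with y hy
  rw [hS.map_sub hy, sub_add_cancel]

lemma inDomain_absSq {c : ℝ} (hc : 0 < c) (f : Linf μ) : InDomain S (absSq (S c f)) := by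
  obtain ⟨w, hw⟩ := hS.exists_tendsto_carre hc f
  set R := derivOp S c f
  have hneg : Tendsto (fun y : ℝ => -y) (𝓝[>] 0) (𝓝[≠] 0) := by
    refine tendsto_nhdsWithin_iff.2 ⟨?_, ?_⟩
    · have : Tendsto (fun y : ℝ => -y) (𝓝 0) (𝓝 (-0)) := continuous_neg.tendsto 0
      rw [neg_zero] at this
      exact this.mono_left nhdsWithin_le_nhds
    · filter_upwards [self_mem_nhdsWithin] with y hy
      exact neg_ne_zero.2 (ne_of_gt hy)
  have hslope : Tendsto (fun y : ℝ => y⁻¹ • (S c f - S (c - y) f)) (𝓝[>] 0) (𝓝 R) := by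
    refine ((hasDerivAt_iff_tendsto_slope_zero.1 (hS.hasDerivAt hc f)).comp hneg).congr fun y => ?_
    rw [Function.comp_apply, inv_neg, neg_smul, ← smul_neg, neg_sub, ← sub_eq_add_neg]
  have hcont : Tendsto (fun y : ℝ => S (c - y) f) (𝓝[>] 0) (𝓝 (S c f)) := by
    have h1 : Tendsto (fun y : ℝ => c - y) (𝓝[>] 0) (𝓝 c) := by
      have : Continuous fun y : ℝ => c - y := by fun_prop
      simpa using (this.tendsto 0).mono_left nhdsWithin_le_nhds
    exact (hS.hasDerivAt hc f).continuousAt.tendsto.comp h1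
  have hstar : Tendsto (fun y : ℝ => star (y⁻¹ • (S c f - S (c - y) f))) (𝓝[>] 0) (𝓝 (star R)) :=
    ((starL μ).continuous.tendsto _).comp hslope
  have hq := (tendsto_mul (tendsto_const_nhds (x := star (S c f))) hslope).add
    (tendsto_mul hstar hcont)
  have hq2 := hS.tendsto_smul_apply hq
  refine ⟨(-1 : ℝ) • (w + (mul (star (S c f)) R + mul (star R) (S c f))), fun g => ?_⟩
  refine ((hw.add hq2).const_smul (-1) g).congr' ?_
  filter_upwards [Ioo_mem_nhdsGT hc] with y hy
  have hcy : 0 < c - y := sub_pos.2 hy.2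
  congr 1
  have e1 : mul (star (S c f)) (y⁻¹ • (S c f - S (c - y) f)) +
      mul (star (y⁻¹ • (S c f - S (c - y) f))) (S (c - y) f) =
      y⁻¹ • (absSq (S c f) - absSq (S (c - y) f)) := by
    rw [star_real_smul]
    simp only [← ofReal_smul_eq, absSq, mul_eq_mulL, star_sub', _root_.map_sub, map_smul, smul_apply,
      sub_apply]
    module
  have e2 : S y (S (c - y) f) = S c f := by
    rw [← hS.map_add y (c - y) hy.1 hcy, add_sub_cancel]
  rw [e1, hS.map_real_smul hy.1, hS.map_sub hy.1, carre, e2]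
  module

lemma gammaDefined {t : ℝ} (ht : 0 < t) (f : Linf μ) : GammaDefined S (S t f) (S t f) :=
  ⟨by rw [← hS.map_star ht]; exact hS.inDomain ht _, hS.inDomain ht f, hS.inDomain_absSq ht f⟩

lemma gammaDefined_iteratedDeriv {s : ℝ} (hs : 0 < s) (f : Linf μ) (j : ℕ) :
    GammaDefined S (s ^ j • iteratedDeriv j (fun r => S r f) s)
      (s ^ j • iteratedDeriv j (fun r => S r f) s) := by
  have ha : 0 < s / (j + 1) := by positivity
  have hlt : j * (s / (j + 1)) < s := by
    rw [mul_div_assoc', div_lt_iff₀ (by positivity)]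
    linarith
  rw [(hS.iteratedDeriv_eq ha f j hlt).1, ← hS.map_real_smul (sub_pos.2 hlt)]
  exact hS.gammaDefined (sub_pos.2 hlt) _

lemma map_gammaForm_le {s v t : ℝ} (hs : 0 < s) (hv : 0 < v) (ht : 0 < t) (f : Linf μ) :
    S s (gammaForm S (S (v + t) f) (S (v + t) f)) ≤ S (v + s) (gammaForm S (S t f) (S t f)) := by
  have h1 : gammaForm S (S (v + t) f) (S (v + t) f) ≤ (1 : ℝ) • S v (gammaForm S (S t f) (S t f)) :=
    hS.gammaForm_le (hS.gammaDefined ht f) (hS.gammaDefined (add_pos hv ht) f) hv fun y hy => by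
      rw [one_smul, hS.map_add v t hv ht]
      exact hS.gammaTwo y v hy hv (S t f)
  rw [one_smul] at h1
  rw [add_comm v s, hS.map_add s v hs hv]
  exact hS.mono hs h1

end IsRegularSemigroup

end SubordGamma

end

theorem lemma2 {M : Type*} [MeasurableSpace M] (μ : Measure M) [SigmaFinite μ]
    (T : ℝ → SubordGamma.Linf μ →ₗ[ℂ] SubordGamma.Linf μ)
    (hT : SubordGamma.IsPositiveSemigroup T)
    (hΓ : SubordGamma.GammaTwo (fun t f => T t f))
    (α : ℝ) (hα0 : 0 < α) (hα1 : α < 1) :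
    -- the subordinated family is well defined by the weak* integral, and smooth in time
    (∀ t : ℝ, 0 < t → ∀ f : SubordGamma.Linf μ,
      SubordGamma.IsWeakStarIntegral (SubordGamma.phi t α) (fun u => T u f)
        (SubordGamma.subord T α t f)) ∧
    (∀ f : SubordGamma.Linf μ,
      ContDiffOn ℝ ∞ (fun s : ℝ => SubordGamma.subord T α s f) (Ioi 0)) ∧
    -- it satisfies the criterion
    SubordGamma.GammaTwo (SubordGamma.subord T α) ∧
    -- it satisfies the differential form of the criterion
    (∀ t : ℝ, 0 < t → ∀ f : SubordGamma.Linf μ,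
      SubordGamma.GammaDefined (SubordGamma.subord T α)
        (SubordGamma.subord T α t f) (SubordGamma.subord T α t f)) ∧
    (∀ s v t : ℝ, 0 < s → 0 < v → 0 < t → ∀ f : SubordGamma.Linf μ,
      SubordGamma.subord T α s
          (SubordGamma.gammaForm (SubordGamma.subord T α)
            (SubordGamma.subord T α (v + t) f) (SubordGamma.subord T α (v + t) f)) ≤
        SubordGamma.subord T α (v + s)
          (SubordGamma.gammaForm (SubordGamma.subord T α)
            (SubordGamma.subord T α t f) (SubordGamma.subord T α t f))) ∧
    -- the gradient estimate for the time derivatives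
    (∀ f : SubordGamma.Linf μ, SubordGamma.GammaDefined (SubordGamma.subord T α) f f →
      ∀ (j : ℕ) (s : ℝ), 0 < s →
        SubordGamma.GammaDefined (SubordGamma.subord T α)
          (s ^ j • iteratedDeriv j (fun r : ℝ => SubordGamma.subord T α r f) s)
          (s ^ j • iteratedDeriv j (fun r : ℝ => SubordGamma.subord T α r f) s) ∧
        SubordGamma.gammaForm (SubordGamma.subord T α)
          (s ^ j • iteratedDeriv j (fun r : ℝ => SubordGamma.subord T α r f) s)
          (s ^ j • iteratedDeriv j (fun r : ℝ => SubordGamma.subord T α r f) s) ≤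
        (10 * (j : ℝ) / (1 - α)) ^ (2 * j) •
          SubordGamma.subord T α s
            (SubordGamma.gammaForm (SubordGamma.subord T α) f f)) := by
  have hS := SubordGamma.isRegularSemigroup_subord hT hα0 hα1 hΓ
  refine ⟨fun t ht f => ?_, hS.contDiffOn, hS.gammaTwo, fun t ht f => hS.gammaDefined ht f,
    fun s v t hs hv ht f => hS.map_gammaForm_le hs hv ht f, fun f hf j s hs => ?_⟩
  · rw [SubordGamma.subord_eq_avg ht.ne']
    exact SubordGamma.avg_spec hT (SubordGamma.integrableOn_phi ht hα0 hα1) f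
  · have hj := hS.gammaDefined_iteratedDeriv hs f j
    refine ⟨hj, hS.gammaForm_le hf hj hs fun y hy => ?_⟩
    have h := hS.carre_iteratedDeriv_le hy hs f j
    rwa [mul_one_div] at h
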